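/- **Conventions.** For $Z\subset\mathbb R^N$ let $c(Z)=\{(hx,h): h\ge 0,\ x\in Z\}\subset\mathbb R^N\times\mathbb R$ with the induced Euclidean metric, and $c_L(Z)=\{(hx,h)\in c(Z): h\ge L\}$. For a complex $Z$ we write $c(Z)$ for the cone on its underlying space. A map $\phi$ between metric spaces is *coarse* if for every $R>0$ there is $R'>0$ with $d(x,y)<R\Rightarrow d(\phi(x),\phi(y))<R'$, and preimages of bounded sets are bounded. Two maps are *close* if their distance is uniformly bounded. A map of pairs $(A,A_0)\to(B,B_0)$ is a map $A\to B$ sending $A_0$ into $B_0$. For $p\colon A\to[0,\infty)$ let $I_pA=\{(x,t)\in A\times\mathbb R: 0\le t\le p(x)+1\}$; a homotopy along $p$ between $f_0$ and $f_1$ is a map $H$ on $I_pA$ with $H(x,0)=f_0(x)$ and $H(x,p(x)+1)=f_1(x)$, and it is a homotopy of maps of pairs if it sends $I_pA$ into $B$ and $I_pA_0$ into $B_0$. It is a coarse homotopy if $p$ and $H$ are coarse. A *local order* on a geometric simplicial complex is a partial order of its vertices that is total on each simplex. The *standard subdivision* $S(X)$ of a locally ordered complex $X$ has the vertices $v_{ij}=(v_i+v_j)/2$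 with $v_i\le v_j$ in a common simplex, the order $v_{ij}\le v_{kl}\iff v_k\le v_i\le v_j\le v_l$, and as simplices the chains of vertices $v_{ij}$ coming from one simplex of $X$. The *standard triangulation* of $c(X)$ consists of the cone with apex $0$ over $X\times\{1\}$ and, for each integer $k\ge1$, a triangulation of the slab between the heights $k$ and $k+1$. Let $2^n\le k<2^{n+1}$, let $K=S^n(X)$, and denote by $(v)_h$ the point $(hv,h)$. If $k+1<2^{n+1}$, the simplices of the slab are those with vertices $(v_0)_k,\dots,(v_j)_k,(v_j)_{k+1},\dots,(v_m)_{k+1}$ for $v_0<\dots<v_m$ spanning a simplex of $K$, and their faces. If $k+1=2^{n+1}$, they are those with vertices $(v_0)_k,\dots,(v_m)_k,\big(\tfrac{u_0+w_0}2\big)_{k+1},\dots,\big(\tfrac{u_l+w_l}2\big)_{k+1}$ for vertices $u_l\le\dots\le u_0\le v_0<\dots<v_m\le w_0\le\dots\le w_l$ of a simplex of $K$ with the pairs $(u_i,w_i)$ distinct, and their faces (including the simplices of $K$ at height $k$ and of $S(K)$ at height $k+1$). For an integer $L\ge 1$ the simplices all of whose vertices have height at least $L$ triangulate $c_L(X)$.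 **Statement.** Let $X,Y\subset\mathbb R^N$ be finite geometric simplicial complexes with arbitrary local orders, and let $X_0\subset X$, $Y_0\subset Y$ be subcomplexes. 1. Let $\phi\colon(c(Y),c(Y_0))\to(c(X),c(X_0))$ be a coarse map of pairs. Then there are an integer $L>0$ and a proper Lipschitz map of pairs $f\colon(c_L(Y),c_L(Y_0))\to(c(X),c(X_0))$ that is close to $\phi|_{c_L(Y)}$ and that is simplicial from the standard triangulation of $c_L(Y)$ to the standard triangulation of $c(X)$ rescaled by some constant $C>0$. Moreover, for every subcomplex $Y_1\subset Y$ such that $\phi|_{c(Y_1)}$ is Lipschitz: - there is a Lipschitz map $H\colon c_L(Y_1)\times[0,1]\to c(X)$ with $H(\cdot,0)=\phi$ and $H(\cdot,1)=f$ on $c_L(Y_1)$ and $H(c_L(Y_1\cap Y_0)\times[0,1])\subset c(X_0)$; - there is a proper Lipschitz map of pairs $\bar f\colon(c_L(Y),c_L(Y_0))\to(c(X),c(X_0))$ that is close to $f$ and coincides with $\phi$ on $c_L(Y_1)$. 2. Let $Y_1\subset Y$ be a subcomplex, let $\phi,\psi\colon(c(Y),c(Y_0))\to(c(X),c(X_0))$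 be coarse maps of pairs, and let $H\colon I_pc(Y)\to c(X)$ be a coarse homotopy of maps of pairs from $\phi$ to $\psi$, along a coarse map $p\colon c(Y)\to[0,\infty)$, such that $p|_{c(Y_1)}$ is Lipschitz and $H|_{I_pc(Y_1)}$ is proper and Lipschitz. Let $L>0$, and let $f,g\colon(c_L(Y),c_L(Y_0))\to(c(X),c(X_0))$ be proper Lipschitz maps of pairs, close to $\phi$ and $\psi$ on $c_L(Y)$ respectively, with $f=\phi$ and $g=\psi$ on $c_L(Y_1)$. Then there are a coarse Lipschitz function $q\colon c_L(Y)\to[0,\infty)$ with $q=p$ on $c_L(Y_1)$, and with $q=p$ on all of $c_L(Y)$ if $p$ is Lipschitz, and a proper Lipschitz homotopy of maps of pairs $G\colon I_qc_L(Y)\to c(X)$ from $f$ to $g$ that coincides with $H$ on $I_pc_L(Y_1)$. -/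

import Mathlib

open Set

noncomputable section

namespace ConeApprox

/-! ### Coarse, Lipschitz and proper maps on subsets of metric spaces

A map defined on a subset `S` is represented by a total function of which only the values on `S`
are used. -/

/-- `f` and `g` are close (coarsely equivalent) on `S`. -/
def CloseOn {A B : Type*} [PseudoMetricSpace B] (f g : A → B) (S : Set A) : Prop :=
  ∃ R : ℝ, ∀ x ∈ S, dist (f x) (g x) ≤ R

/-- `f`, restricted to `S`, is a coarse map for the bounded coarse structures: it is controlled,
and preimages of bounded sets are bounded. -/
def CoarseOn {A B : Type*} [PseudoMetricSpace A] [PseudoMetricSpace B]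
    (f : A → B) (S : Set A) : Prop :=
  (∀ R : ℝ, 0 < R → ∃ R' : ℝ, 0 < R' ∧
      ∀ x ∈ S, ∀ y ∈ S, dist x y < R → dist (f x) (f y) < R') ∧
    ∀ B' : Set B, Bornology.IsBounded B' → Bornology.IsBounded (S ∩ f ⁻¹' B')

/-- `f`, restricted to `S`, is Lipschitz. -/
def LipOn {A B : Type*} [PseudoMetricSpace A] [PseudoMetricSpace B]
    (f : A → B) (S : Set A) : Prop :=
  ∃ K : NNReal, LipschitzOnWith K f S

/-- `f`, restricted to `S`, is proper: preimages of compact sets are compact. -/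
def ProperOn {A B : Type*} [TopologicalSpace A] [TopologicalSpace B]
    (f : A → B) (S : Set A) : Prop :=
  ∀ C : Set B, IsCompact C → IsCompact (S ∩ f ⁻¹' C)

/-- `f` maps the pair `(S, S₀)` to the pair `(T, T₀)`. -/
def MapsPair {A B : Type*} (f : A → B) (S S₀ : Set A) (T T₀ : Set B) : Prop :=
  MapsTo f S T ∧ MapsTo f S₀ T₀

/-- The cylinder `I_p S = {(x, t) | x ∈ S, 0 ≤ t ≤ p x + 1}`. -/
def cylinder {A : Type*} (p : A → ℝ) (S : Set A) : Set (A × ℝ) :=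
  {z | z.1 ∈ S ∧ 0 ≤ z.2 ∧ z.2 ≤ p z.1 + 1}

/-! ### Metric cones -/

/-- The Hilbert space `E × ℝ` in which the cones live. -/
abbrev ConeSpace (E : Type*) : Type _ := WithLp 2 (E × ℝ)

section Cones

variable {E : Type*} [NormedAddCommGroup E] [InnerProductSpace ℝ E]

/-- The point `(h x, h)`. -/
def conePoint (h : ℝ) (x : E) : ConeSpace E := WithLp.toLp 2 (h • x, h)

/-- The metric cone with flat base `c(Y) = {(h x, h) | h ≥ 0, x ∈ Y}`. -/
def cone (Y : Set E) : Set (ConeSpace E) :=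
  {z | ∃ h : ℝ, 0 ≤ h ∧ ∃ x ∈ Y, z = conePoint h x}

/-- The part `c_R(Y)` of the cone of height at least `R`. -/
def coneAbove (R : ℝ) (Y : Set E) : Set (ConeSpace E) :=
  {z ∈ cone Y | R ≤ z.snd}

end Cones

/-! ### Standard subdivisions and the standard triangulation of a cone

A triangulation is described by the collection of the (finite, non-empty) vertex sets of its
simplices. -/

section Triangulations

variable {E : Type*} [NormedAddCommGroup E] [InnerProductSpace ℝ E]

/-- `le` is a local order on the complex with simplices `F`: a partial order on the vertices which
is total on the vertices of each simplex. -/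
structure IsLocalOrder (F : Set (Finset E)) (le : E → E → Prop) : Prop where
  refl : ∀ s ∈ F, ∀ v ∈ s, le v v
  antisymm : ∀ s ∈ F, ∀ t ∈ F, ∀ v ∈ s, ∀ w ∈ t, le v w → le w v → v = w
  trans : ∀ r ∈ F, ∀ s ∈ F, ∀ t ∈ F, ∀ u ∈ r, ∀ v ∈ s, ∀ w ∈ t, le u v → le v w → le u w
  total : ∀ s ∈ F, ∀ v ∈ s, ∀ w ∈ s, le v w ∨ le w v

/-- The order on the vertices `v_{ij} = (v_i + v_j) / 2` (with `v_i ≤ v_j` in a common simplex) of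
the standard subdivision: `v_{ij} ≤ v_{kl}` if and only if `v_k ≤ v_i ≤ v_j ≤ v_l`. -/
def subdivLe (F : Set (Finset E)) (le : E → E → Prop) (p q : E) : Prop :=
  ∃ i j k l : E, (∃ s ∈ F, i ∈ s ∧ j ∈ s) ∧ (∃ s ∈ F, k ∈ s ∧ l ∈ s) ∧
    le k i ∧ le i j ∧ le j l ∧ p = midpoint ℝ i j ∧ q = midpoint ℝ k l

/-- The simplices of the standard subdivision: chains of vertices `v_{ij}` which all lie in one
simplex of the given complex. -/
def subdivFaces (F : Set (Finset E)) (le : E → E → Prop) : Set (Finset E) :=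
  {t | t.Nonempty ∧
    (∃ s ∈ F, ∀ p ∈ t, ∃ i ∈ s, ∃ j ∈ s, le i j ∧ p = midpoint ℝ i j) ∧
    ∀ p ∈ t, ∀ q ∈ t, subdivLe F le p q ∨ subdivLe F le q p}

/-- The standard subdivision of a locally ordered complex (simplices together with the order). -/
def stdSubdiv (K : Set (Finset E) × (E → E → Prop)) : Set (Finset E) × (E → E → Prop) :=
  (subdivFaces K.1 K.2, subdivLe K.1 K.2)

/-- The simplices at the tip of the cone: the convex hull of the apex and `X × {1}`. -/
def tipFaces (F : Set (Finset E)) : Set (Finset (ConeSpace E)) :=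
  {t | t.Nonempty ∧ ∃ s ∈ F, ∀ p ∈ t, p = 0 ∨ ∃ v ∈ s, p = conePoint 1 v}

/-- The canonical product triangulation of the slab of the cone between the heights `k` and
`k + 1`: the simplices `(v_0,0), …, (v_j,0), (v_j,1), …, (v_m,1)`, for `v_0 < ⋯ < v_m` in a simplex,
and their faces. -/
def productSlab (k : ℕ) (K : Set (Finset E) × (E → E → Prop)) : Set (Finset (ConeSpace E)) :=
  {t | t.Nonempty ∧ ∃ s ∈ K.1,
    (∀ p ∈ t, ∃ v ∈ s, p = conePoint (k : ℝ) v ∨ p = conePoint ((k : ℝ) + 1) v) ∧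
    ∀ v ∈ s, ∀ w ∈ s, conePoint (k : ℝ) v ∈ t → conePoint ((k : ℝ) + 1) w ∈ t → K.2 v w}

/-- The standard product subdivision of the slab between the heights `k` and `k + 1`, with the given
triangulation at the bottom and its standard subdivision at the top: the simplices
`(v_0,0), …, (v_m,0), ((u_0,w_0),1), …, ((u_l,w_l),1)` for vertices
`u_l ≤ ⋯ ≤ u_0 ≤ v_0 < ⋯ < v_m ≤ w_0 ≤ ⋯ ≤ w_l` of a simplex, and their faces. -/
def subdivSlab (k : ℕ) (K : Set (Finset E) × (E → E → Prop)) : Set (Finset (ConeSpace E)) :=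
  {t | t.Nonempty ∧ ∃ s ∈ K.1,
    (∀ p ∈ t, (∃ v ∈ s, p = conePoint (k : ℝ) v) ∨
      ∃ u ∈ s, ∃ w ∈ s, K.2 u w ∧ p = conePoint ((k : ℝ) + 1) (midpoint ℝ u w)) ∧
    (∀ x y : E, conePoint ((k : ℝ) + 1) x ∈ t → conePoint ((k : ℝ) + 1) y ∈ t →
      subdivLe K.1 K.2 x y ∨ subdivLe K.1 K.2 y x) ∧
    ∀ v ∈ s, ∀ u ∈ s, ∀ w ∈ s, K.2 u w → conePoint (k : ℝ) v ∈ t →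
      conePoint ((k : ℝ) + 1) (midpoint ℝ u w) ∈ t → K.2 u v ∧ K.2 v w}

/-- The slab between the heights `k` and `k + 1`, where `2 ^ n ≤ k < 2 ^ (n + 1)` and the cross
section of height `k` carries the `n`-th standard subdivision. -/
def slabFaces (F : Set (Finset E)) (le : E → E → Prop) (k : ℕ) : Set (Finset (ConeSpace E)) :=
  {t | (Nat.log 2 (k + 1) = Nat.log 2 k ∧ t ∈ productSlab k (stdSubdiv^[Nat.log 2 k] (F, le))) ∨
    (Nat.log 2 (k + 1) ≠ Nat.log 2 k ∧ t ∈ subdivSlab k (stdSubdiv^[Nat.log 2 k] (F, le)))}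

/-- The simplices of the standard triangulation of the cone on a locally ordered complex. -/
def coneFaces (F : Set (Finset E)) (le : E → E → Prop) : Set (Finset (ConeSpace E)) :=
  tipFaces F ∪ {t | ∃ k : ℕ, 1 ≤ k ∧ t ∈ slabFaces F le k}

/-- The simplices of the standard triangulation of the part of the cone of height at least `L`. -/
def coneFacesAbove (L : ℕ) (F : Set (Finset E)) (le : E → E → Prop) :
    Set (Finset (ConeSpace E)) :=
  {t ∈ coneFaces F le | ∀ p ∈ t, (L : ℝ) ≤ p.snd}

end Triangulations

/-- The collection of simplices rescaled by `C`. -/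
def scaleFaces {V : Type*} [AddCommGroup V] [Module ℝ V] (C : ℝ) (K : Set (Finset V)) :
    Set (Finset V) :=
  {t | ∃ s ∈ K, (t : Set V) = (fun p : V => C • p) '' (s : Set V)}

/-- `f` is simplicial with respect to the triangulations `K` and `K'`: it maps the vertices of each
simplex of `K` onto the vertices of a simplex of `K'` and is affine on each simplex of `K`. -/
def IsSimplicial {V W : Type*} [AddCommGroup V] [Module ℝ V] [AddCommGroup W] [Module ℝ W]
    (f : V → W) (K : Set (Finset V)) (K' : Set (Finset W)) : Prop :=
  ∀ s ∈ K, (∃ t ∈ K', (t : Set W) = f '' (s : Set V)) ∧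
    ∀ c : V → ℝ, (∀ p ∈ s, 0 ≤ c p) → ∑ p ∈ s, c p = 1 →
      f (∑ p ∈ s, c p • p) = ∑ p ∈ s, c p • f p

end ConeApprox

end

/-!
The argument has a metric part, which uses no triangulation, and a combinatorial part, which gives
uniform control of the standard triangulation of the cone.

Metric part. The cone on a finite complex is a Lipschitz retract of the ambient space
(`isLipRetract_cone`), so its points can be joined by chains of steps of bounded length whose
number is bounded linearly by the distance. Hence a coarse map on a cone satisfies `d (φ x) (φ y)
≤ a * d x y + b` (`CoarseOn.largeLipOn`), and so does a coarse homotopy on a cylinder over the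
cone (`CoarseOn.largeLipOn_cylinder`). A map which is Lipschitz on a large scale in this sense,
with values in a Lipschitz retract, is close to a Lipschitz map, and the two can be made to agree
on a subset on which the given map is Lipschitz already: restrict it to a maximal set which
contains this subset and whose other points have distance at least `1` from all points of the set,
extend by McShane's theorem and retract (`LargeLipOn.exists_lipOn_eqOn`). To treat pairs, this is
done first on the subspace and then on the whole space; the maps fit together because cones on
subcomplexes meet at a definite angle (`exists_cone_regular`, `LargeLipOn.lipOn_union`,
`LargeLipOn.exists_lipOn_eqOn_pair`). Applied to maps, this gives the relative approximation `f̄`;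
applied to maps on cylinders with prescribed values at the two ends, it gives the homotopies
(`exists_lipschitz_homotopy_of_close`, `exists_lipschitz_homotopy_of_coarse`). Properness is
preserved under closeness.

Combinatorial part. A simplicial approximation needs barycentric coordinates for the standard
triangulation which are uniformly Lipschitz at all heights, and simplices of uniformly bounded
diameter (`exists_coneWeights`). A point of a simplex with vertices `v₀ < ⋯ < vₘ` is encoded by
the monotone step function on `[0, 1]` which takes the value `vᵢ` on an interval whose length is
the `i`-th barycentric coordinate; the point is the mean value of the step function. Passing to
the standard subdivision means folding the interval along `t ↦ |2 t - 1|` and taking midpoints of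
the two values which come together (`foldStep`, `IsTame.stdSubdiv`). Folding preserves the mean
value, at most doubles the measure of the set on which two step functions differ, and halves the
variation. Therefore the simplices of the `n`-th subdivision have diameter of order `2⁻ⁿ`, and its
barycentric coordinates have Lipschitz constants of order `2ⁿ`; both powers of two are compensated
by the scale of the cone at heights between `2ⁿ` and `2ⁿ⁺¹`. In a slab, the barycentric
coordinates of a point are read off by cutting its step function at one parameter, which depends
only on the height: to the left of it the values are vertices at the bottom, and to the right of
it they are vertices at the top (`slabBreak`, `slabLaw_slabFaces`). This treats slabs with and
without subdivision alike, and shows that the coordinates of adjacent slabs agree on their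
intersection (`slabLaw_top_eq_bottom`).

Since the number of vertices of a simplex is bounded, every point has a vertex with weight bounded
below, and by the Lipschitz condition a ball of fixed radius lies in the open star of this vertex
(`ConeWeights.exists_vertex`). After rescaling the target, the images of the vertices of any
simplex lie in such a ball, so the vertices chosen for them span a simplex, and affine
interpolation gives the simplicial map (`exists_simplicial_approximation`).
-/

namespace ConeApprox

/-! ### Lipschitz approximation of large-scale Lipschitz maps -/

section Close

variable {A B : Type*} [PseudoMetricSpace B]

theorem CloseOn.symm {f g : A → B} {S : Set A} (h : CloseOn f g S) : CloseOn g f S :=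
  h.imp fun _ hR x hx => by rw [dist_comm]; exact hR x hx

theorem CloseOn.trans {f g h : A → B} {S : Set A} (h₁ : CloseOn f g S) (h₂ : CloseOn g h S) :
    CloseOn f h S := by
  obtain ⟨R, hR⟩ := h₁
  obtain ⟨R', hR'⟩ := h₂
  exact ⟨R + R', fun x hx => (dist_triangle _ (g x) _).trans (add_le_add (hR x hx) (hR' x hx))⟩

theorem CloseOn.mono {f g : A → B} {S T : Set A} (h : CloseOn f g T) (hST : S ⊆ T) :
    CloseOn f g S :=
  h.imp fun _ hR x hx => hR x (hST hx)

end Close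

section Approximation

variable {A B W : Type*} [PseudoMetricSpace A] [PseudoMetricSpace B]

/-- `f` is large-scale Lipschitz on `S`. -/
def LargeLipOn (f : A → B) (S : Set A) : Prop :=
  ∃ a b : ℝ, 0 ≤ a ∧ 0 ≤ b ∧ ∀ x ∈ S, ∀ y ∈ S, dist (f x) (f y) ≤ a * dist x y + b

/-- `T` is empty or a Lipschitz retract of the ambient space. -/
def IsLipRetract (T : Set B) : Prop :=
  T.Nonempty → ∃ r : B → B, (∃ K : NNReal, LipschitzWith K r) ∧ (∀ x, r x ∈ T) ∧ ∀ x ∈ T, r x = x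

theorem lipOn_iff {f : A → B} {S : Set A} :
    LipOn f S ↔ ∃ C : ℝ, 0 ≤ C ∧ ∀ x ∈ S, ∀ y ∈ S, dist (f x) (f y) ≤ C * dist x y := by
  constructor
  · rintro ⟨K, hK⟩
    exact ⟨K, K.2, fun x hx y hy => hK.dist_le_mul x hx y hy⟩
  · rintro ⟨C, hC, h⟩
    exact ⟨⟨C, hC⟩, LipschitzOnWith.of_dist_le_mul fun x hx y hy => h x hx y hy⟩

theorem LipOn.mono {f : A → B} {S T : Set A} (h : LipOn f T) (hST : S ⊆ T) : LipOn f S :=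
  h.imp fun _ hK => hK.mono hST

theorem LipOn.congr {f g : A → B} {S : Set A} (h : LipOn f S) (hfg : ∀ x ∈ S, g x = f x) :
    LipOn g S := by
  obtain ⟨C, hC, h⟩ := lipOn_iff.1 h
  exact lipOn_iff.2 ⟨C, hC, fun x hx y hy => by rw [hfg x hx, hfg y hy]; exact h x hx y hy⟩

theorem LipOn.largeLipOn {f : A → B} {S : Set A} (h : LipOn f S) : LargeLipOn f S := by
  obtain ⟨C, hC, h⟩ := lipOn_iff.1 h
  exact ⟨C, 0, hC, le_rfl, fun x hx y hy => by simpa using h x hx y hy⟩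

theorem LargeLipOn.mono {f : A → B} {S T : Set A} (h : LargeLipOn f T) (hST : S ⊆ T) :
    LargeLipOn f S := by
  obtain ⟨a, b, ha, hb, h⟩ := h
  exact ⟨a, b, ha, hb, fun x hx y hy => h x (hST hx) y (hST hy)⟩

theorem LargeLipOn.of_close {f g : A → B} {S : Set A} (h : LargeLipOn g S) (hfg : CloseOn f g S) :
    LargeLipOn f S := by
  obtain ⟨a, b, ha, hb, h⟩ := h
  obtain ⟨R, hR⟩ := hfg
  refine ⟨a, b + 2 * |R|, ha, by positivity, fun x hx y hy => ?_⟩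
  have h1 := (hR x hx).trans (le_abs_self R)
  have h2 := (hR y hy).trans (le_abs_self R)
  rw [dist_comm] at h2
  have h3 := h x hx y hy
  have h4 := dist_triangle4 (f x) (g x) (g y) (f y)
  linarith

/-- A map which is large-scale Lipschitz and Lipschitz at a small scale is Lipschitz. -/
theorem LargeLipOn.lipOn_of_local {f : A → B} {S : Set A} (h : LargeLipOn f S) {ε C : ℝ}
    (hε : 0 < ε) (hC : 0 ≤ C)
    (hloc : ∀ x ∈ S, ∀ y ∈ S, dist x y < ε → dist (f x) (f y) ≤ C * dist x y) : LipOn f S := by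
  obtain ⟨a, b, ha, hb, h⟩ := h
  refine lipOn_iff.2 ⟨C + a + b / ε, by positivity, fun x hx y hy => ?_⟩
  have hd : 0 ≤ dist x y := dist_nonneg
  rcases lt_or_ge (dist x y) ε with hlt | hge
  · have h1 := hloc x hx y hy hlt
    have h2 : 0 ≤ (a + b / ε) * dist x y := by positivity
    linarith [add_mul C (a + b / ε) (dist x y), add_assoc C a (b / ε)]
  · have h1 := h x hx y hy
    have h2 : b ≤ b / ε * dist x y := by
      rw [div_mul_eq_mul_div, le_div_iff₀ hε]
      exact mul_le_mul_of_nonneg_left hge hb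
    have h3 : 0 ≤ C * dist x y := by positivity
    linarith [add_mul (C + a) (b / ε) (dist x y), add_mul C a (dist x y)]

/-- Gluing of Lipschitz maps: two pieces which, near each other, are joined through their common
part by paths of comparable length. -/
theorem LargeLipOn.lipOn_union {f : A → B} {S T : Set A} (h : LargeLipOn f (S ∪ T))
    (hS : LipOn f S) (hT : LipOn f T)
    (hreg : ∃ ε κ : ℝ, 0 < ε ∧ 0 ≤ κ ∧ ∀ x ∈ S, ∀ y ∈ T, dist x y < ε →
      ∃ w ∈ S ∩ T, dist x w ≤ κ * dist x y) : LipOn f (S ∪ T) := by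
  obtain ⟨ε, κ, hε, hκ, hreg⟩ := hreg
  obtain ⟨C, hC, hS⟩ := lipOn_iff.1 hS
  obtain ⟨D, hD, hT⟩ := lipOn_iff.1 hT
  have key : ∀ x ∈ S, ∀ y ∈ T, dist x y < ε →
      dist (f x) (f y) ≤ (C + D + C * κ + D * κ) * dist x y := by
    intro x hx y hy hxy
    obtain ⟨w, ⟨hwS, hwT⟩, hw⟩ := hreg x hx y hy hxy
    have h1 := hS x hx w hwS
    have h2 := hT w hwT y hy
    have h3 := dist_triangle (f x) (f w) (f y)
    have h4 : dist w y ≤ (κ + 1) * dist x y := by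
      have := dist_triangle w x y
      rw [dist_comm w x] at this
      linarith
    have h5 := mul_le_mul_of_nonneg_left hw hC
    have h6 := mul_le_mul_of_nonneg_left h4 hD
    have h7 : 0 ≤ C * dist x y := by positivity
    nlinarith
  refine h.lipOn_of_local hε (C := C + D + C * κ + D * κ) (by positivity) ?_
  have hd : ∀ x y : A, 0 ≤ dist x y := fun _ _ => dist_nonneg
  rintro x (hx | hx) y (hy | hy) hxy
  · refine (hS x hx y hy).trans (mul_le_mul_of_nonneg_right ?_ (hd x y))
    have : 0 ≤ C * κ + D * κ := by positivity
    linarith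
  · exact key x hx y hy hxy
  · rw [dist_comm x y, dist_comm (f x)]
    rw [dist_comm x y] at hxy
    exact key y hy x hx hxy
  · refine (hT x hx y hy).trans (mul_le_mul_of_nonneg_right ?_ (hd x y))
    have : 0 ≤ C * κ + D * κ := by positivity
    linarith

variable [NormedAddCommGroup W] [NormedSpace ℝ W] [FiniteDimensional ℝ W]

/-- A large-scale Lipschitz map into a Lipschitz retract which is Lipschitz on `P` is close to a
Lipschitz map with the same values on `P`. The given map is Lipschitz on every subset which is
`1`-separated away from `P`; its values on a maximal such subset are extended by McShane's
theorem and retracted to the target. -/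
theorem LargeLipOn.exists_lipOn_eqOn {f : A → W} {S P : Set A} {T : Set W}
    (hf : LargeLipOn f S) (hPS : P ⊆ S) (hP : LipOn f P) (hT : IsLipRetract T)
    (hST : MapsTo f S T) :
    ∃ g : A → W, LipOn g S ∧ (∀ x ∈ P, g x = f x) ∧ CloseOn g f S ∧ MapsTo g S T := by
  rcases S.eq_empty_or_nonempty with rfl | ⟨x₀, hx₀⟩
  · exact ⟨f, ⟨0, by simp⟩, fun _ _ => rfl, ⟨0, fun _ h => h.elim⟩, fun _ h => h.elim⟩
  obtain ⟨r, ⟨Kr, hr⟩, hrT, hrid⟩ := hT ⟨f x₀, hST hx₀⟩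
  -- subsets in which distinct points are `1`-separated unless both lie in `P`; maximality among
  -- them gives `1`-density in `S`
  let 𝒮 : Set (Set A) :=
    {Q | Q ⊆ S ∧ ∀ x ∈ Q, ∀ y ∈ Q, x ≠ y → (x ∈ P ∧ y ∈ P) ∨ 1 ≤ dist x y}
  obtain ⟨Q, hPQ, hQ⟩ := zorn_subset_nonempty 𝒮 (by
    intro c hc hchain hne
    refine ⟨⋃₀ c, ⟨sUnion_subset fun Q hQ => (hc hQ).1, ?_⟩, fun s hs => subset_sUnion_of_mem hs⟩
    rintro x ⟨Q₁, hQ₁, hx⟩ y ⟨Q₂, hQ₂, hy⟩ hxy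
    rcases hchain.total hQ₁ hQ₂ with h | h
    · exact (hc hQ₂).2 x (h hx) y hy hxy
    · exact (hc hQ₁).2 x hx y (h hy) hxy) P ⟨hPS, fun x hx y hy _ => Or.inl ⟨hx, hy⟩⟩
  have hQS : Q ⊆ S := hQ.prop.1
  obtain ⟨a, b, ha, hb, hab⟩ := hf
  have hfQ : LipOn f Q := by
    obtain ⟨C, hC, hP⟩ := lipOn_iff.1 hP
    refine lipOn_iff.2 ⟨C + a + b, by positivity, fun x hx y hy => ?_⟩
    have hd : 0 ≤ dist x y := dist_nonneg
    rcases eq_or_ne x y with rfl | hxy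
    · simp
    rcases hQ.prop.2 x hx y hy hxy with ⟨h1, h2⟩ | h
    · have := hP x h1 y h2
      nlinarith [mul_nonneg ha hd, mul_nonneg hb hd]
    · have := hab x (hQS hx) y (hQS hy)
      nlinarith [mul_nonneg hC hd, mul_nonneg hb (sub_nonneg.2 h)]
  have hdense : ∀ x ∈ S, ∃ y ∈ Q, dist x y ≤ 1 := by
    intro x hx
    by_contra! hcon
    have hxQ : x ∉ Q := fun h => by
      have := hcon x h
      rw [dist_self] at this
      linarith
    refine hxQ (hQ.mem_of_prop_insert (x := x) ⟨insert_subset hx hQS, ?_⟩)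
    rintro y (rfl | hy) z (rfl | hz) hyz
    · exact absurd rfl hyz
    · exact Or.inr (hcon z hz).le
    · exact Or.inr (by rw [dist_comm]; exact (hcon y hy).le)
    · exact hQ.prop.2 y hy z hz hyz
  obtain ⟨K, hK⟩ := hfQ
  obtain ⟨g, hg, hgQ⟩ := hK.extend_finite_dimension
  have hrg := hr.comp hg
  set K' := Kr * (lipschitzExtensionConstant W * K)
  have hval : ∀ y ∈ Q, (r ∘ g) y = f y := fun y hy => by
    simp only [Function.comp, ← hgQ hy]
    exact hrid _ (hST (hQS hy))
  refine ⟨r ∘ g, ⟨K', hrg.lipschitzOnWith⟩, fun x hx => hval x (hPQ hx),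
    ⟨K' + a + b, fun x hx => ?_⟩, fun x _ => hrT _⟩
  obtain ⟨y, hy, hxy⟩ := hdense x hx
  have h1 := hrg.dist_le_mul x y
  have h2 := hab y (hQS hy) x hx
  rw [dist_comm y x] at h2
  have h3 := dist_triangle ((r ∘ g) x) (f y) (f x)
  rw [hval y hy] at h1
  have h4 : (K' : ℝ) * dist x y ≤ K' := mul_le_of_le_one_right K'.2 hxy
  have h5 : a * dist x y ≤ a := mul_le_of_le_one_right ha hxy
  linarith

/-- The version of `LargeLipOn.exists_lipOn_eqOn` for maps of pairs: the map is first approximated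
on `S₀`, and then on all of `S`, relative to `P ∪ S₀`. -/
theorem LargeLipOn.exists_lipOn_eqOn_pair {f : A → W} {S S₀ P : Set A} {T T₀ : Set W}
    (hf : LargeLipOn f S) (hPS : P ⊆ S) (hS₀ : S₀ ⊆ S) (hP : LipOn f P) (hT : IsLipRetract T)
    (hT₀ : IsLipRetract T₀) (hTT : T₀ ⊆ T) (hST : MapsPair f S S₀ T T₀)
    (hreg : ∃ ε κ : ℝ, 0 < ε ∧ 0 ≤ κ ∧ ∀ x ∈ P, ∀ y ∈ S₀, dist x y < ε →
      ∃ w ∈ P ∩ S₀, dist x w ≤ κ * dist x y) :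
    ∃ g : A → W, LipOn g S ∧ (∀ x ∈ P, g x = f x) ∧ CloseOn g f S ∧ MapsPair g S S₀ T T₀ := by
  classical
  obtain ⟨g₀, hg₀L, hg₀P, ⟨R, hR⟩, hg₀T⟩ := (hf.mono hS₀).exists_lipOn_eqOn (P := P ∩ S₀)
    inter_subset_right (hP.mono inter_subset_left) hT₀ hST.2
  let f₁ : A → W := fun x => if x ∈ S₀ then g₀ x else f x
  have hf₁ : ∀ x ∈ S₀, f₁ x = g₀ x := fun x hx => if_pos hx
  have hf₁P : ∀ x ∈ P, f₁ x = f x := fun x hx => by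
    by_cases h : x ∈ S₀
    · rw [hf₁ x h, hg₀P x ⟨hx, h⟩]
    · exact if_neg h
  have hclose : CloseOn f₁ f S := ⟨|R|, fun x hx => by
    by_cases h : x ∈ S₀
    · rw [hf₁ x h]; exact (hR x h).trans (le_abs_self R)
    · simp [f₁, h]⟩
  have hf₁L : LargeLipOn f₁ S := hf.of_close hclose
  have hLip : LipOn f₁ (P ∪ S₀) := (hf₁L.mono (union_subset hPS hS₀)).lipOn_union
    (hP.congr hf₁P) (hg₀L.congr hf₁) hreg
  obtain ⟨g, hgL, hgP, hgf, hgT⟩ := hf₁L.exists_lipOn_eqOn (union_subset hPS hS₀) hLip hT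
    (fun x hx => by
      by_cases h : x ∈ S₀
      · rw [hf₁ x h]; exact hTT (hg₀T h)
      · simpa [f₁, h] using hST.1 hx)
  refine ⟨g, hgL, fun x hx => (hgP x (Or.inl hx)).trans (hf₁P x hx), hgf.trans hclose, hgT,
    fun x hx => ?_⟩
  rw [hgP x (Or.inr hx), hf₁ x hx]
  exact hg₀T hx

end Approximation

/-! ### Coarse maps on retracts, and properness -/

section Coarse

variable {A B : Type*} [PseudoMetricSpace A] [PseudoMetricSpace B]

theorem CoarseOn.mono {f : A → B} {S T : Set A} (h : CoarseOn f T) (hST : S ⊆ T) :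
    CoarseOn f S := by
  refine ⟨fun R hR => ?_, fun B' hB' => (h.2 B' hB').subset (inter_subset_inter_left _ hST)⟩
  obtain ⟨R', hR', h'⟩ := h.1 R hR
  exact ⟨R', hR', fun x hx y hy => h' x (hST hx) y (hST hy)⟩

/-- A map close to a map for which preimages of bounded sets are bounded has the same property. -/
theorem CloseOn.isBounded_preimage {f g : A → B} {S : Set A} (h : CloseOn f g S)
    (hg : ∀ B' : Set B, Bornology.IsBounded B' → Bornology.IsBounded (S ∩ g ⁻¹' B'))
    {B' : Set B} (hB' : Bornology.IsBounded B') : Bornology.IsBounded (S ∩ f ⁻¹' B') := by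
  obtain ⟨R, hR⟩ := h
  refine (hg _ (hB'.cthickening (δ := R))).subset fun x hx => ⟨hx.1, ?_⟩
  exact Metric.mem_cthickening_of_dist_le (g x) (f x) R B' hx.2
    (by rw [dist_comm]; exact hR x hx.1)

/-- A Lipschitz map on a closed set is proper if preimages of bounded sets are bounded. -/
theorem LipOn.properOn [ProperSpace A] {f : A → B} {S : Set A} (h : LipOn f S) (hS : IsClosed S)
    (hb : ∀ B' : Set B, Bornology.IsBounded B' → Bornology.IsBounded (S ∩ f ⁻¹' B')) [T2Space B] :
    ProperOn f S := by
  intro C hC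
  obtain ⟨K, hK⟩ := h
  exact Metric.isCompact_of_isClosed_isBounded
    (hK.continuousOn.preimage_isClosed_of_isClosed hS hC.isClosed) (hb C hC.isBounded)

theorem CoarseOn.of_lipOn_close {f g : A → B} {S : Set A} (hf : LipOn f S) (hg : CoarseOn g S)
    (h : CloseOn f g S) : CoarseOn f S := by
  obtain ⟨C, hC, hf⟩ := lipOn_iff.1 hf
  refine ⟨fun R hR => ⟨C * R + 1, by positivity, fun x hx y hy hxy => ?_⟩,
    fun B' hB' => h.isBounded_preimage hg.2 hB'⟩
  have := hf x hx y hy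
  have := mul_le_mul_of_nonneg_left hxy.le hC
  linarith

theorem dist_le_of_chain {f : ℕ → B} {R : ℝ} (n : ℕ)
    (h : ∀ i < n, dist (f i) (f (i + 1)) ≤ R) : dist (f 0) (f n) ≤ n * R := by
  have := dist_le_range_sum_dist f n
  refine this.trans ((Finset.sum_le_sum fun i hi => h i (Finset.mem_range.1 hi)).trans ?_)
  simp

variable {V : Type*} [NormedAddCommGroup V] [NormedSpace ℝ V]

/-- In a Lipschitz retract any two points are joined by a chain whose length is controlled by
their distance. -/
theorem IsLipRetract.exists_chain {S : Set V} (hS : IsLipRetract S) :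
    ∃ K : ℝ, 0 < K ∧ ∀ x ∈ S, ∀ y ∈ S, ∃ (n : ℕ) (γ : ℕ → V), (n : ℝ) ≤ dist x y + 2 ∧
      γ 0 = x ∧ γ n = y ∧ (∀ i, γ i ∈ S) ∧ ∀ i, dist (γ i) (γ (i + 1)) < K := by
  rcases S.eq_empty_or_nonempty with rfl | hne
  · exact ⟨1, one_pos, by simp⟩
  obtain ⟨r, ⟨K, hr⟩, hrS, hrid⟩ := hS hne
  refine ⟨K + 1, by positivity, fun x hx y hy => ?_⟩
  set n := ⌈dist x y⌉₊ + 1 with hn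
  have hn0 : (0 : ℝ) < n := by positivity
  have hnd : dist x y ≤ n := (Nat.le_ceil _).trans (by rw [hn]; push_cast; linarith)
  refine ⟨n, fun i => r (x + ((i : ℝ) / n) • (y - x)), ?_, by simp [hrid x hx], ?_,
    fun i => hrS _, fun i => ?_⟩
  · have := Nat.ceil_lt_add_one (dist_nonneg (x := x) (y := y))
    rw [hn]; push_cast; linarith
  · simp [hrid y hy]
  · refine (hr.dist_le_mul _ _).trans_lt ?_
    have : dist (x + ((i : ℝ) / n) • (y - x)) (x + (((i + 1 : ℕ) : ℝ) / n) • (y - x)) ≤ 1 := by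
      rw [dist_add_left, dist_eq_norm, ← sub_smul, norm_smul]
      have : ((i : ℝ) / n - ((i + 1 : ℕ) : ℝ) / n) = -(1 / n) := by push_cast; ring
      rw [this, norm_neg, Real.norm_of_nonneg (by positivity), ← dist_eq_norm, dist_comm y x,
        div_mul_eq_mul_div, one_mul]
      exact (div_le_one hn0).2 hnd
    have := mul_le_mul_of_nonneg_left this K.coe_nonneg
    linarith

/-- Coarse maps on a Lipschitz retract are large-scale Lipschitz. -/
theorem CoarseOn.largeLipOn {S : Set V} (hS : IsLipRetract S) {f : V → B} (hf : CoarseOn f S) :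
    LargeLipOn f S := by
  obtain ⟨K, hK, hch⟩ := hS.exists_chain
  obtain ⟨R, hR, hfR⟩ := hf.1 K hK
  refine ⟨R, 2 * R, hR.le, by positivity, fun x hx y hy => ?_⟩
  obtain ⟨n, γ, hn, rfl, rfl, hγS, hγ⟩ := hch x hx y hy
  have := dist_le_of_chain (f := f ∘ γ) (R := R) n
    fun i _ => (hfR _ (hγS i) _ (hγS (i + 1)) (hγ i)).le
  refine this.trans ((mul_le_mul_of_nonneg_right hn hR.le).trans (by linarith))

/-- Coarse maps on a cylinder over a Lipschitz retract are large-scale Lipschitz: two points are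
joined by a chain which lies over a chain in the base, followed by a vertical chain. -/
theorem CoarseOn.largeLipOn_cylinder {S : Set V} (hS : IsLipRetract S) {p : V → ℝ}
    (hp : CoarseOn p S) (hp0 : ∀ y ∈ S, 0 ≤ p y) {f : V × ℝ → B}
    (hf : CoarseOn f (cylinder p S)) : LargeLipOn f (cylinder p S) := by
  obtain ⟨K, hK, hch⟩ := hS.exists_chain
  obtain ⟨P, hP, hpP⟩ := hp.1 K hK
  obtain ⟨R, hR, hfR⟩ := hf.1 (K + P + 2) (by positivity)
  refine ⟨2 * R, 4 * R, by positivity, by positivity, ?_⟩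
  rintro ⟨x, s⟩ ⟨hx, hs0, hs1⟩ ⟨y, t⟩ ⟨hy, ht0, ht1⟩
  simp only at hx hs0 hs1 hy ht0 ht1
  obtain ⟨n, γ, hn, rfl, rfl, hγS, hγ⟩ := hch x hx y hy
  have h1 := dist_le_of_chain (f := fun i => f (γ i, min s (p (γ i) + 1))) (R := R) n
    fun i _ => (hfR _ ⟨hγS i, le_min hs0 (by linarith [hp0 _ (hγS i)]), min_le_right _ _⟩ _
      ⟨hγS (i + 1), le_min hs0 (by linarith [hp0 _ (hγS (i + 1))]), min_le_right _ _⟩ (by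
        rw [Prod.dist_eq, max_lt_iff]
        refine ⟨(hγ i).trans (by linarith), ?_⟩
        have h2 := hpP _ (hγS i) _ (hγS (i + 1)) (hγ i)
        rw [Real.dist_eq] at h2 ⊢
        have := abs_min_sub_min_le_max s (p (γ i) + 1) s (p (γ (i + 1)) + 1)
        simp only [sub_self, abs_zero, add_sub_add_right_eq_sub] at this
        exact this.trans_lt (max_lt (by positivity) (by linarith)))).le
  simp only [min_eq_left hs1] at h1
  set u := min s (p (γ n) + 1) with hu
  have hu0 : 0 ≤ u := le_min hs0 (by linarith)
  have hu1 : u ≤ p (γ n) + 1 := min_le_right _ _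
  have hut : |u - t| ≤ dist s t := by
    have := abs_min_sub_min_le_max s (p (γ n) + 1) t (p (γ n) + 1)
    rwa [min_eq_left ht1, sub_self, abs_zero, max_eq_left (abs_nonneg _)] at this
  set m := ⌈|u - t|⌉₊ + 1 with hm
  have hm0 : (0 : ℝ) < m := by positivity
  have hmd : |u - t| ≤ m := (Nat.le_ceil _).trans (by rw [hm]; push_cast; linarith)
  have hm2 : (m : ℝ) ≤ |u - t| + 2 := by
    have := Nat.ceil_lt_add_one (abs_nonneg (u - t))
    rw [hm]; push_cast; linarith
  have h2 := dist_le_of_chain (f := fun i : ℕ => f (γ n, u + (min (i : ℝ) m / m) * (t - u)))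
    (R := R) m (by
    intro i hi
    have hmem : ∀ j : ℕ, (γ n, u + (min (j : ℝ) m / m) * (t - u)) ∈ cylinder p S := by
      intro j
      have h3 : min (j : ℝ) m / m ≤ 1 := (div_le_one hm0).2 (min_le_right _ _)
      have h4 : 0 ≤ min (j : ℝ) m / m := by positivity
      refine ⟨hy, ?_, ?_⟩
      · show 0 ≤ u + (min (j : ℝ) m / m) * (t - u)
        nlinarith
      · show u + (min (j : ℝ) m / m) * (t - u) ≤ p (γ n) + 1
        nlinarith
    refine (hfR _ (hmem i) _ (hmem (i + 1)) ?_).le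
    rw [Prod.dist_eq, dist_self, max_lt_iff]
    refine ⟨by positivity, ?_⟩
    have hi' : (i : ℝ) + 1 ≤ m := by exact_mod_cast hi
    rw [min_eq_left (by linarith : (i : ℝ) ≤ m), min_eq_left (by push_cast; exact hi'),
      Real.dist_eq]
    have : u + (i : ℝ) / m * (t - u) - (u + ((i + 1 : ℕ) : ℝ) / m * (t - u)) = (u - t) / m := by
      push_cast; field_simp; ring
    rw [this, abs_div, abs_of_pos hm0]
    exact ((div_le_one hm0).2 hmd).trans_lt (by linarith))
  simp only [Nat.cast_zero, min_self, div_self hm0.ne', one_mul, add_sub_cancel] at h2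
  rw [min_eq_left hm0.le, zero_div, zero_mul, add_zero] at h2
  have h3 := dist_triangle (f (γ 0, s)) (f (γ n, u)) (f (γ n, t))
  have h4 : dist (γ 0) (γ n) ≤ dist (γ 0, s) (γ n, t) := le_max_left _ _
  have h5 : dist s t ≤ dist (γ 0, s) (γ n, t) := le_max_right _ _
  have h6 := mul_le_mul_of_nonneg_right hn hR.le
  have h7 := mul_le_mul_of_nonneg_right hm2 hR.le
  have h8 := mul_le_mul_of_nonneg_right (hut.trans h5) hR.le
  have h9 := mul_le_mul_of_nonneg_right h4 hR.le
  linarith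

end Coarse

/-! ### Cones over finite complexes -/

section ConeGeometry

variable {E : Type*} [NormedAddCommGroup E] [InnerProductSpace ℝ E]

@[simp] theorem conePoint_snd (h : ℝ) (x : E) : (conePoint h x).snd = h := rfl

@[simp] theorem conePoint_fst (h : ℝ) (x : E) : (conePoint h x).fst = h • x := rfl

omit [NormedAddCommGroup E] [InnerProductSpace ℝ E] in
theorem ConeSpace.ext {z z' : ConeSpace E} (h₁ : z.fst = z'.fst) (h₂ : z.snd = z'.snd) :
    z = z' := by
  rcases z with ⟨⟨a, b⟩⟩
  rcases z' with ⟨⟨c, d⟩⟩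
  simp only [WithLp.toLp_fst, WithLp.toLp_snd] at h₁ h₂
  rw [h₁, h₂]

/-- The base coordinate as a linear map. -/
def fstₗ : ConeSpace E →ₗ[ℝ] E where
  toFun z := z.fst
  map_add' _ _ := rfl
  map_smul' _ _ := rfl

/-- The height as a linear map. -/
def sndₗ : ConeSpace E →ₗ[ℝ] ℝ where
  toFun z := z.snd
  map_add' _ _ := rfl
  map_smul' _ _ := rfl

theorem fst_sum {ι : Type*} (s : Finset ι) (f : ι → ConeSpace E) :
    (∑ i ∈ s, f i).fst = ∑ i ∈ s, (f i).fst :=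
  map_sum (fstₗ (E := E)) f s

theorem snd_sum {ι : Type*} (s : Finset ι) (f : ι → ConeSpace E) :
    (∑ i ∈ s, f i).snd = ∑ i ∈ s, (f i).snd :=
  map_sum (sndₗ (E := E)) f s

theorem conePoint_eq_smul (h : ℝ) (x : E) : conePoint h x = h • conePoint 1 x :=
  ConeSpace.ext (by simp) (by simp)

theorem conePoint_injective {h : ℝ} (hh : h ≠ 0) : Function.Injective (conePoint h : E → _) := by
  intro x y hxy
  have := congrArg (fun z : ConeSpace E => z.fst) hxy
  simpa [hh] using this

omit [InnerProductSpace ℝ E] in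
theorem abs_snd_le_norm (z : ConeSpace E) : |z.snd| ≤ ‖z‖ := by
  have h := WithLp.prod_norm_sq_eq_of_L2 z
  have h1 : |z.snd| ^ 2 ≤ ‖z‖ ^ 2 := by
    rw [h, ← Real.norm_eq_abs]
    nlinarith [sq_nonneg ‖z.fst‖]
  exact (abs_le_of_sq_le_sq' h1 (norm_nonneg _)).2

omit [InnerProductSpace ℝ E] in
theorem norm_fst_le_norm (z : ConeSpace E) : ‖z.fst‖ ≤ ‖z‖ := by
  have h := WithLp.prod_norm_sq_eq_of_L2 z
  have h1 : ‖z.fst‖ ^ 2 ≤ ‖z‖ ^ 2 := by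
    rw [h]
    nlinarith [sq_nonneg ‖z.snd‖]
  exact (abs_le_of_sq_le_sq' h1 (norm_nonneg _)).2

omit [InnerProductSpace ℝ E] in
theorem abs_snd_sub_le_dist (z z' : ConeSpace E) : |z.snd - z'.snd| ≤ dist z z' := by
  rw [dist_eq_norm]
  exact abs_snd_le_norm (z - z')

omit [InnerProductSpace ℝ E] in
theorem norm_fst_sub_le_dist (z z' : ConeSpace E) : ‖z.fst - z'.fst‖ ≤ dist z z' := by
  rw [dist_eq_norm]
  exact norm_fst_le_norm (z - z')

theorem norm_conePoint_le (h : ℝ) (x : E) : ‖conePoint h x‖ ≤ |h| * (‖x‖ + 1) := by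
  have h1 := WithLp.prod_norm_sq_eq_of_L2 (conePoint h x)
  have h2 : ‖conePoint h x‖ ^ 2 ≤ (|h| * (‖x‖ + 1)) ^ 2 := by
    rw [h1]
    change ‖h • x‖ ^ 2 + ‖h‖ ^ 2 ≤ _
    rw [norm_smul, Real.norm_eq_abs]
    nlinarith [sq_nonneg |h|, norm_nonneg x, mul_nonneg (sq_nonneg |h|) (norm_nonneg x)]
  exact (abs_le_of_sq_le_sq' h2 (by positivity)).2

theorem norm_conePoint_sub_le (h h' : ℝ) (x x' : E) :
    ‖conePoint h x - conePoint h' x'‖ ≤ |h| * ‖x - x'‖ + |h - h'| * (‖x'‖ + 1) := by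
  have h1 : conePoint h x - conePoint h' x'
      = WithLp.toLp 2 (h • (x - x'), (0 : ℝ)) + conePoint (h - h') x' :=
    ConeSpace.ext (by simp [smul_sub, sub_smul]) (by simp)
  have h2 : ‖(WithLp.toLp 2 (h • (x - x'), (0 : ℝ)) : ConeSpace E)‖ ≤ |h| * ‖x - x'‖ := by
    have h3 := WithLp.prod_norm_sq_eq_of_L2 (WithLp.toLp 2 (h • (x - x'), (0 : ℝ)))
    refine (abs_le_of_sq_le_sq' (h3.le.trans ?_) (by positivity)).2
    simp [norm_smul]
  rw [h1]
  exact (norm_add_le _ _).trans (add_le_add h2 (norm_conePoint_le _ _))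

theorem zero_mem_cone {Z : Set E} (h : Z.Nonempty) : (0 : ConeSpace E) ∈ cone Z := by
  obtain ⟨x, hx⟩ := h
  exact ⟨0, le_rfl, x, hx, ConeSpace.ext (by simp) (by simp)⟩

theorem cone_mono {Z Z' : Set E} (h : Z ⊆ Z') : cone Z ⊆ cone Z' := by
  rintro z ⟨t, ht, x, hx, rfl⟩
  exact ⟨t, ht, x, h hx, rfl⟩

theorem smul_mem_cone {Z : Set E} {z : ConeSpace E} (hz : z ∈ cone Z) {c : ℝ} (hc : 0 ≤ c) :
    c • z ∈ cone Z := by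
  obtain ⟨t, ht, x, hx, rfl⟩ := hz
  exact ⟨c * t, mul_nonneg hc ht, x, hx, ConeSpace.ext (by simp [mul_smul]) (by simp)⟩

theorem coneAbove_subset {R : ℝ} {Z : Set E} : coneAbove R Z ⊆ cone Z := fun _ h => h.1

theorem coneAbove_mono {R : ℝ} {Z Z' : Set E} (h : Z ⊆ Z') : coneAbove R Z ⊆ coneAbove R Z' :=
  fun _ hz => ⟨cone_mono h hz.1, hz.2⟩

theorem eq_conePoint_of_mem_cone {Z : Set E} {z : ConeSpace E} (hz : z ∈ cone Z)
    (h : 0 < z.snd) : z.snd⁻¹ • z.fst ∈ Z ∧ z = conePoint z.snd (z.snd⁻¹ • z.fst) := by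
  obtain ⟨t, ht, x, hx, rfl⟩ := hz
  have ht' : t ≠ 0 := h.ne'
  have : t⁻¹ • t • x = x := inv_smul_smul₀ ht' x
  simp only [conePoint_snd, conePoint_fst, this]
  exact ⟨hx, trivial⟩

/-- Elements of the cone over a simplex, in terms of non-negative weights of the vertices. -/
theorem mem_cone_convexHull_iff {σ : Finset E} (hσ : σ.Nonempty) {z : ConeSpace E} :
    z ∈ cone (convexHull ℝ (σ : Set E)) ↔ ∃ w : E → ℝ, (∀ v, 0 ≤ w v) ∧ (∀ v, v ∉ σ → w v = 0) ∧
      ∑ v ∈ σ, w v • conePoint 1 v = z := by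
  classical
  constructor
  · rintro ⟨h, hh, x, hx, rfl⟩
    obtain ⟨w, hw0, hw1, rfl⟩ := Finset.mem_convexHull'.1 hx
    refine ⟨fun v => if v ∈ σ then h * w v else 0, fun v => ?_, fun v hv => if_neg hv, ?_⟩
    · dsimp only
      split_ifs with hv
      · exact mul_nonneg hh (hw0 v hv)
      · exact le_rfl
    · have hif : ∀ v ∈ σ, (if v ∈ σ then h * w v else 0) • (conePoint 1 v : ConeSpace E)
          = (h * w v) • conePoint 1 v := fun v hv => by rw [if_pos hv]
      rw [Finset.sum_congr rfl hif]
      refine ConeSpace.ext ?_ ?_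
      · simp [fst_sum, Finset.smul_sum, mul_smul]
      · simp [snd_sum, ← Finset.mul_sum, hw1]
  · rintro ⟨w, hw0, hw1, rfl⟩
    rcases (Finset.sum_nonneg fun v (_ : v ∈ σ) => hw0 v).eq_or_lt with h | h
    · have : ∀ v ∈ σ, w v = 0 := (Finset.sum_eq_zero_iff_of_nonneg fun v _ => hw0 v).1 h.symm
      rw [Finset.sum_eq_zero fun v hv => by rw [this v hv, zero_smul]]
      exact zero_mem_cone (convexHull_nonempty_iff.2 hσ)
    · refine ⟨∑ v ∈ σ, w v, h.le, ∑ v ∈ σ, (w v / ∑ v ∈ σ, w v) • v,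
        Finset.mem_convexHull'.2 ⟨_, fun v _ => div_nonneg (hw0 v) h.le, ?_, rfl⟩, ?_⟩
      · rw [← Finset.sum_div, div_self h.ne']
      · refine ConeSpace.ext ?_ ?_
        · simp only [fst_sum, conePoint_fst, Finset.smul_sum, smul_smul, WithLp.smul_fst, one_smul]
          exact Finset.sum_congr rfl fun v _ => by rw [mul_div_cancel₀ _ h.ne']
        · simp [snd_sum]

variable {K : Geometry.SimplicialComplex ℝ E}

theorem mem_cone_space_iff {z : ConeSpace E} :
    z ∈ cone K.space ↔ ∃ σ ∈ K.faces, z ∈ cone (convexHull ℝ (σ : Set E)) := by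
  constructor
  · rintro ⟨h, hh, x, hx, rfl⟩
    obtain ⟨σ, hσ, hx⟩ := Geometry.SimplicialComplex.mem_space_iff.1 hx
    exact ⟨σ, hσ, h, hh, x, hx, rfl⟩
  · rintro ⟨σ, hσ, hz⟩
    exact cone_mono (Geometry.SimplicialComplex.convexHull_subset_space hσ) hz

theorem face_nonempty {σ : Finset E} (hσ : σ ∈ K.faces) : σ.Nonempty :=
  K.nonempty_of_mem_faces hσ

/-- Affine independence of the vertices of a simplex, in terms of weights. -/
theorem weights_eq_of_face {σ : Finset E} (hσ : σ ∈ K.faces) {w w' : E → ℝ}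
    (h₁ : ∑ v ∈ σ, w v = ∑ v ∈ σ, w' v) (h₂ : ∑ v ∈ σ, w v • v = ∑ v ∈ σ, w' v • v) :
    ∀ v ∈ σ, w v = w' v := by
  intro v hv
  have h := affineIndependent_iff.1 (K.indep hσ) Finset.univ (fun v => w v - w' v) ?_ ?_ ⟨v, hv⟩
    (Finset.mem_univ _)
  · exact sub_eq_zero.1 h
  · rw [Finset.sum_sub_distrib, Finset.sum_coe_sort σ w, Finset.sum_coe_sort σ w', h₁, sub_self]
  · simp only [sub_smul]
    rw [Finset.sum_sub_distrib, Finset.sum_coe_sort σ fun v => w v • v,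
      Finset.sum_coe_sort σ fun v => w' v • v, h₂, sub_self]

/-- The weights of a point of the cone are unique, also across different simplices. -/
theorem cone_weights_unique {σ τ : Finset E} (hσ : σ ∈ K.faces) (hτ : τ ∈ K.faces) {w w' : E → ℝ}
    (hw : ∀ v, 0 ≤ w v) (hw' : ∀ v, 0 ≤ w' v) (hwσ : ∀ v, v ∉ σ → w v = 0)
    (hwτ : ∀ v, v ∉ τ → w' v = 0)
    (h : ∑ v ∈ σ, w v • conePoint 1 v = ∑ v ∈ τ, w' v • conePoint 1 v) (v : E) : w v = w' v := by
  classical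
  have hs : ∑ v ∈ σ, w v = ∑ v ∈ τ, w' v := by
    have := congrArg (fun z : ConeSpace E => z.snd) h
    simpa [snd_sum] using this
  have hf : ∑ v ∈ σ, w v • v = ∑ v ∈ τ, w' v • v := by
    have := congrArg (fun z : ConeSpace E => z.fst) h
    simpa [fst_sum] using this
  rcases (Finset.sum_nonneg fun v (_ : v ∈ σ) => hw v).eq_or_lt with h0 | h0
  · have h1 := (Finset.sum_eq_zero_iff_of_nonneg fun v _ => hw v).1 h0.symm
    have h2 := (Finset.sum_eq_zero_iff_of_nonneg fun v _ => hw' v).1 (hs ▸ h0.symm)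
    by_cases hv : v ∈ σ <;> by_cases hv' : v ∈ τ <;> simp [*]
  set m := ∑ v ∈ σ, w v with hm
  have hmem : m⁻¹ • ∑ v ∈ σ, w v • v ∈ convexHull ℝ ((σ ∩ τ : Finset E) : Set E) := by
    rw [Finset.coe_inter]
    refine K.inter_subset_convexHull hσ hτ ⟨Finset.mem_convexHull'.2 ⟨fun v => m⁻¹ * w v,
      fun v _ => mul_nonneg (inv_nonneg.2 h0.le) (hw v), ?_, ?_⟩,
      Finset.mem_convexHull'.2 ⟨fun v => m⁻¹ * w' v,
      fun v _ => mul_nonneg (inv_nonneg.2 h0.le) (hw' v), ?_, ?_⟩⟩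
    · rw [← Finset.mul_sum, ← hm, inv_mul_cancel₀ h0.ne']
    · simp only [Finset.smul_sum, mul_smul]
    · rw [← Finset.mul_sum, ← hs, inv_mul_cancel₀ h0.ne']
    · simp only [hf, Finset.smul_sum, mul_smul]
  obtain ⟨u, hu0, hu1, hu2⟩ := Finset.mem_convexHull'.1 hmem
  let u' : E → ℝ := fun v => if v ∈ σ ∩ τ then m * u v else 0
  have hsum : ∀ ρ : Finset E, σ ∩ τ ⊆ ρ → ∑ v ∈ ρ, u' v = m ∧
      ∑ v ∈ ρ, u' v • v = ∑ v ∈ σ, w v • v := by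
    intro ρ hρ
    constructor
    · rw [← Finset.sum_subset hρ fun v _ hv => if_neg hv,
        Finset.sum_congr rfl fun v hv => if_pos hv, ← Finset.mul_sum, hu1, mul_one]
    · rw [← Finset.sum_subset hρ fun v _ hv => by simp only [u', if_neg hv, zero_smul],
        Finset.sum_congr rfl fun v hv => by rw [show u' v = m * u v from if_pos hv, mul_smul],
        ← Finset.smul_sum, hu2, smul_inv_smul₀ h0.ne']
  have e1 := weights_eq_of_face hσ (w := w) (w' := u')
    (hsum σ Finset.inter_subset_left).1.symm (hsum σ Finset.inter_subset_left).2.symm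
  have e2 := weights_eq_of_face hτ (w := w') (w' := u')
    (hs.symm.trans (hsum τ Finset.inter_subset_right).1.symm)
    (hf.symm.trans (hsum τ Finset.inter_subset_right).2.symm)
  have hu' : ∀ v, v ∉ σ ∩ τ → u' v = 0 := fun v hv => if_neg hv
  by_cases hv : v ∈ σ <;> by_cases hv' : v ∈ τ
  · rw [e1 v hv, e2 v hv']
  · rw [e1 v hv, hwτ v hv', hu' v (by simp [hv'])]
  · rw [hwσ v hv, e2 v hv', hu' v (by simp [hv])]
  · rw [hwσ v hv, hwτ v hv']

open Classical in
/-- The finite set of vertices of a finite complex. -/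
noncomputable def vertexFinset (hK : K.faces.Finite) : Finset E := hK.toFinset.biUnion id

theorem subset_vertexFinset (hK : K.faces.Finite) {σ : Finset E} (hσ : σ ∈ K.faces) :
    σ ⊆ vertexFinset hK := by
  classical
  exact Finset.subset_biUnion_of_mem id (hK.mem_toFinset.2 hσ)

/-- The weights of the points of the cone on a finite complex depend on the points in a Lipschitz
way. The difference of two systems of weights lies in one of finitely many closed cones, on which
the linear map from weights to points has trivial kernel; compactness of the unit sphere gives the
constant. -/
theorem exists_cone_weights_lipschitz (hK : K.faces.Finite) :
    ∃ C : ℝ, 0 ≤ C ∧ ∀ σ ∈ K.faces, ∀ τ ∈ K.faces, ∀ w w' : E → ℝ,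
      (∀ v, 0 ≤ w v) → (∀ v, 0 ≤ w' v) → (∀ v, v ∉ σ → w v = 0) → (∀ v, v ∉ τ → w' v = 0) →
      ∀ v, |w v - w' v| ≤
        C * dist (∑ v ∈ σ, w v • conePoint 1 v) (∑ v ∈ τ, w' v • conePoint 1 v) := by
  classical
  set V := vertexFinset hK with hV
  let T : (V → ℝ) → ConeSpace E := fun u => ∑ v : V, u v • conePoint 1 (v : E)
  have hT : Continuous T := by
    refine continuous_finsetSum _ fun v _ => ?_
    exact (continuous_apply v).smul continuous_const
  have hTsmul : ∀ (c : ℝ) u, T (c • u) = c • T u := fun c u => by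
    simp [T, Finset.smul_sum, mul_smul]
  -- the cone belonging to `σ` and `τ` consists of the vectors whose positive part is supported in
  -- `σ` and whose negative part is supported in `τ`
  let D : Set (V → ℝ) := ⋃ σ ∈ K.faces, ⋃ τ ∈ K.faces,
    {u | ∀ v : V, ((v : E) ∉ σ → u v ≤ 0) ∧ ((v : E) ∉ τ → 0 ≤ u v)}
  have hD : IsClosed D := by
    refine hK.isClosed_biUnion fun σ _ => hK.isClosed_biUnion fun τ _ => ?_
    simp only [ofPred_forall, ofPred_and]
    refine isClosed_iInter fun v => IsClosed.inter ?_ ?_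
    · exact isClosed_iInter fun _ => isClosed_le (continuous_apply v) continuous_const
    · exact isClosed_iInter fun _ => isClosed_le continuous_const (continuous_apply v)
  have hext : ∀ (σ : Finset E), σ ∈ K.faces → ∀ u : V → ℝ, (∀ v : V, (v : E) ∉ σ → u v = 0) →
      ∑ v ∈ σ, (if h : v ∈ V then u ⟨v, h⟩ else 0) • (conePoint 1 v : ConeSpace E) = T u := by
    intro σ hσ u hu
    have h1 : T u = ∑ v ∈ V, (if h : v ∈ V then u ⟨v, h⟩ else 0) • (conePoint 1 v) := by
      rw [← Finset.sum_coe_sort V]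
      exact Finset.sum_congr rfl fun v _ => by rw [dif_pos v.2]
    rw [h1]
    refine Finset.sum_subset (subset_vertexFinset hK hσ) fun v hv hvσ => ?_
    rw [dif_pos hv, hu ⟨v, hv⟩ hvσ, zero_smul]
  have hker : ∀ u ∈ D, T u = 0 → u = 0 := by
    intro u hu hTu
    simp only [D, mem_iUnion, mem_ofPred_eq] at hu
    obtain ⟨σ, hσ, τ, hτ, hu⟩ := hu
    have hpos : ∀ v : V, (v : E) ∉ σ → u⁺ v = 0 := fun v hv => by
      simpa using (hu v).1 hv
    have hneg : ∀ v : V, (v : E) ∉ τ → u⁻ v = 0 := fun v hv => by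
      simpa using (hu v).2 hv
    have hsub : T u⁺ = T u⁻ := by
      have : T u = T u⁺ - T u⁻ := by
        simp only [T, ← Finset.sum_sub_distrib, ← sub_smul]
        refine Finset.sum_congr rfl fun v _ => ?_
        rw [← Pi.sub_apply, posPart_sub_negPart]
      rwa [hTu, eq_comm, sub_eq_zero] at this
    rw [← hext σ hσ _ hpos, ← hext τ hτ _ hneg] at hsub
    have key := cone_weights_unique hσ hτ
      (w := fun v => if h : v ∈ V then u⁺ ⟨v, h⟩ else 0)
      (w' := fun v => if h : v ∈ V then u⁻ ⟨v, h⟩ else 0) (fun v => ?_) (fun v => ?_)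
      (fun v hv => ?_) (fun v hv => ?_) hsub
    · ext v
      have := key v
      simp only [v.2, dif_pos] at this
      rw [← posPart_sub_negPart u, Pi.sub_apply, this, sub_self, Pi.zero_apply]
    · split_ifs
      · exact posPart_nonneg u _
      · exact le_rfl
    · split_ifs
      · exact negPart_nonneg u _
      · exact le_rfl
    · split_ifs with h
      · exact hpos ⟨v, h⟩ hv
      · rfl
    · split_ifs with h
      · exact hneg ⟨v, h⟩ hv
      · rfl
  obtain ⟨C, hC, hCD⟩ : ∃ C : ℝ, 0 ≤ C ∧ ∀ u ∈ D, ‖u‖ ≤ C * ‖T u‖ := by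
    have hsm : ∀ u ∈ D, ∀ c : ℝ, 0 ≤ c → c • u ∈ D := by
      intro u hu c hc
      simp only [D, mem_iUnion, mem_ofPred_eq] at hu ⊢
      obtain ⟨σ, hσ, τ, hτ, hu⟩ := hu
      exact ⟨σ, hσ, τ, hτ, fun v => ⟨fun hv => mul_nonpos_of_nonneg_of_nonpos hc ((hu v).1 hv),
        fun hv => mul_nonneg hc ((hu v).2 hv)⟩⟩
    have hcomp : IsCompact (Metric.sphere (0 : V → ℝ) 1 ∩ D) :=
      (isCompact_sphere 0 1).inter_right hD
    rcases (Metric.sphere (0 : V → ℝ) 1 ∩ D).eq_empty_or_nonempty with he | hne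
    · refine ⟨0, le_rfl, fun u hu => ?_⟩
      by_contra hcon
      have hu0 : ‖u‖ ≠ 0 := fun h => hcon (by simp [h])
      have : ‖u‖⁻¹ • u ∈ Metric.sphere (0 : V → ℝ) 1 ∩ D :=
        ⟨by simp [norm_smul, hu0], hsm u hu _ (by positivity)⟩
      simp [he] at this
    · obtain ⟨u₀, ⟨hu₀, hu₀D⟩, hmin⟩ := hcomp.exists_isMinOn hne hT.norm.continuousOn
      have hpos : 0 < ‖T u₀‖ := by
        refine norm_pos_iff.2 fun h => ?_
        rw [hker u₀ hu₀D h] at hu₀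
        simp at hu₀
      refine ⟨‖T u₀‖⁻¹, by positivity, fun u hu => ?_⟩
      rcases eq_or_ne u 0 with rfl | hu0
      · simpa using by positivity
      have hu0' : ‖u‖ ≠ 0 := norm_ne_zero_iff.2 hu0
      have h1 : ‖T u₀‖ ≤ ‖T (‖u‖⁻¹ • u)‖ :=
        hmin ⟨by simp [norm_smul, hu0'], hsm u hu _ (by positivity)⟩
      rw [hTsmul, norm_smul, norm_inv, norm_norm] at h1
      rw [inv_mul_eq_div, le_div_iff₀ hpos]
      calc ‖u‖ * ‖T u₀‖ ≤ ‖u‖ * (‖u‖⁻¹ * ‖T u‖) := by gcongr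
        _ = ‖T u‖ := mul_inv_cancel_left₀ hu0' _
  refine ⟨C, hC, fun σ hσ τ hτ w w' hw hw' hwσ hwτ v => ?_⟩
  by_cases hv : v ∈ V
  swap
  · rw [hwσ v fun h => hv (subset_vertexFinset hK hσ h),
      hwτ v fun h => hv (subset_vertexFinset hK hτ h), sub_self, abs_zero]
    positivity
  have hTw : ∀ (ρ : Finset E), ρ ∈ K.faces → ∀ w : E → ℝ, (∀ v, v ∉ ρ → w v = 0) →
      ∑ v ∈ ρ, w v • conePoint 1 v = T fun v => w v := by
    intro ρ hρ w hw
    rw [← hext ρ hρ _ fun v hv => hw v hv]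
    exact Finset.sum_congr rfl fun v hv => by rw [dif_pos (subset_vertexFinset hK hρ hv)]
  have hmem : (fun v : V => w v - w' v) ∈ D := by
    simp only [D, mem_iUnion, mem_ofPred_eq]
    exact ⟨σ, hσ, τ, hτ, fun v => ⟨fun h => by rw [hwσ v h]; linarith [hw' v],
      fun h => by rw [hwτ v h]; linarith [hw v]⟩⟩
  have h1 := hCD _ hmem
  have h2 : T (fun v : V => w v - w' v) = T (fun v => w v) - T (fun v => w' v) := by
    simp only [T, ← Finset.sum_sub_distrib, ← sub_smul]
  rw [h2, ← dist_eq_norm, ← hTw σ hσ w hwσ, ← hTw τ hτ w' hwτ] at h1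
  exact (norm_le_pi_norm (fun v : V => w v - w' v) ⟨v, hv⟩).trans h1

/-- Cones over two simplices of a complex meet at a definite angle. -/
theorem exists_cone_regular (hK : K.faces.Finite) :
    ∃ C : ℝ, 0 ≤ C ∧ ∀ σ ∈ K.faces, ∀ τ ∈ K.faces,
      ∀ z ∈ cone (convexHull ℝ (σ : Set E)), ∀ z' ∈ cone (convexHull ℝ (τ : Set E)),
      ∃ y ∈ cone (convexHull ℝ (σ : Set E)) ∩ cone (convexHull ℝ (τ : Set E)),
        dist z y ≤ C * dist z z' := by
  classical
  obtain ⟨C, hC, hlip⟩ := exists_cone_weights_lipschitz hK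
  refine ⟨C * ∑ v ∈ vertexFinset hK, ‖(conePoint 1 v : ConeSpace E)‖, by positivity, ?_⟩
  intro σ hσ τ hτ z hz z' hz'
  have hσn := face_nonempty hσ
  have hτn := face_nonempty hτ
  obtain ⟨w, hw, hwσ, rfl⟩ := (mem_cone_convexHull_iff hσn).1 hz
  obtain ⟨w', hw', hwτ, rfl⟩ := (mem_cone_convexHull_iff hτn).1 hz'
  -- the point whose weights are the minima of the two systems of weights lies in both cones
  have hm0 : ∀ v, 0 ≤ min (w v) (w' v) := fun v => le_min (hw v) (hw' v)
  have hmσ : ∀ v, v ∉ σ → min (w v) (w' v) = 0 := fun v hv => by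
    rw [hwσ v hv, min_eq_left (hw' v)]
  have hmτ : ∀ v, v ∉ τ → min (w v) (w' v) = 0 := fun v hv => by
    rw [hwτ v hv, min_eq_right (hw v)]
  have hsum : ∑ v ∈ σ, min (w v) (w' v) • (conePoint 1 v : ConeSpace E)
      = ∑ v ∈ τ, min (w v) (w' v) • conePoint 1 v := by
    rw [Finset.sum_subset (Finset.subset_union_left (s₂ := τ)) fun v _ hv => by
        rw [hmσ v hv, zero_smul],
      Finset.sum_subset (Finset.subset_union_right (s₁ := σ) (s₂ := τ)) fun v _ hv => by
        rw [hmτ v hv, zero_smul]]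
  refine ⟨∑ v ∈ σ, min (w v) (w' v) • conePoint 1 v,
    ⟨(mem_cone_convexHull_iff hσn).2 ⟨_, hm0, hmσ, rfl⟩,
      (mem_cone_convexHull_iff hτn).2 ⟨_, hm0, hmτ, hsum.symm⟩⟩, ?_⟩
  set d := dist (∑ v ∈ σ, w v • (conePoint 1 v : ConeSpace E)) (∑ v ∈ τ, w' v • conePoint 1 v)
    with hd
  rw [dist_eq_norm, ← Finset.sum_sub_distrib, mul_right_comm, Finset.mul_sum]
  refine (norm_sum_le _ _).trans ((Finset.sum_le_sum fun v hv => ?_).trans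
    (Finset.sum_le_sum_of_subset_of_nonneg (subset_vertexFinset hK hσ) fun v _ _ => ?_))
  · rw [← sub_smul, norm_smul]
    refine mul_le_mul_of_nonneg_right ?_ (norm_nonneg _)
    refine le_trans ?_ (hlip σ hσ τ hτ w w' hw hw' hwσ hwτ v)
    have h1 := abs_min_sub_min_le_max (w v) (w v) (w v) (w' v)
    rw [min_self, sub_self, abs_zero, max_eq_right (abs_nonneg _)] at h1
    exact h1
  · positivity

/-- The cone on a finite complex is a Lipschitz retract. In terms of weights `a` of the vertices,
the retraction replaces `a v` by `max (a v - m) 0`, where `m` is the least non-negative threshold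
such that the vertices with weight above `m` lie in a simplex; `m` is a `1`-Lipschitz function
of `a`. -/
theorem isLipRetract_cone (hK : K.faces.Finite) : IsLipRetract (cone K.space) := by
  classical
  rintro ⟨z₀, hz₀⟩
  obtain ⟨σ₀, hσ₀, -⟩ := mem_cone_space_iff.1 hz₀
  obtain ⟨C, hC, hlip⟩ := exists_cone_weights_lipschitz hK
  set V := vertexFinset hK with hV
  have hcoord : ∀ z ∈ cone K.space, ∃ σ ∈ K.faces, ∃ w : E → ℝ, (∀ v, 0 ≤ w v) ∧
      (∀ v, v ∉ σ → w v = 0) ∧ ∑ v ∈ σ, w v • conePoint 1 v = z := by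
    intro z hz
    obtain ⟨σ, hσ, hz⟩ := mem_cone_space_iff.1 hz
    exact ⟨σ, hσ, (mem_cone_convexHull_iff (face_nonempty hσ)).1 hz⟩
  choose! s hs w hw0 hws hwz using hcoord
  have hwlip : LipschitzOnWith ⟨C, hC⟩ (fun z (v : V) => w z v) (cone K.space) := by
    refine LipschitzOnWith.of_dist_le_mul fun z hz z' hz' => ?_
    refine (dist_pi_le_iff (by positivity)).2 fun v => ?_
    have := hlip _ (hs z hz) _ (hs z' hz') (w z) (w z') (hw0 z hz) (hw0 z' hz') (hws z hz)
      (hws z' hz') v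
    rwa [hwz z hz, hwz z' hz'] at this
  obtain ⟨B, hB, hBw⟩ := hwlip.extend_pi
  let good : (V → ℝ) → Set ℝ := fun a => {c | 0 ≤ c ∧ ∃ σ ∈ K.faces, ∀ v : V, c < a v → (v : E) ∈ σ}
  have hbdd : ∀ a, BddBelow (good a) := fun a => ⟨0, fun c hc => hc.1⟩
  have hne : ∀ a, (good a).Nonempty := fun a =>
    ⟨‖a‖, norm_nonneg _, σ₀, hσ₀, fun v hv => absurd ((le_abs_self _).trans (norm_le_pi_norm a v))
      hv.not_ge⟩
  let m : (V → ℝ) → ℝ := fun a => sInf (good a)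
  have hm0 : ∀ a, 0 ≤ m a := fun a => Real.sInf_nonneg fun c hc => hc.1
  have hmlip : ∀ a b, m a ≤ m b + dist a b := by
    intro a b
    rw [← sub_le_iff_le_add]
    refine le_csInf (hne b) fun c ⟨hc, σ, hσ, hcσ⟩ => ?_
    rw [sub_le_iff_le_add]
    refine csInf_le (hbdd a) ⟨by positivity, σ, hσ, fun v hv => hcσ v ?_⟩
    have := (le_abs_self _).trans (dist_le_pi_dist a b v)
    linarith
  have hmatt : ∀ a, ∃ σ ∈ K.faces, ∀ v : V, m a < a v → (v : E) ∈ σ := by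
    intro a
    rcases (Finset.univ.filter fun v : V => m a < a v).eq_empty_or_nonempty with he | hne'
    · refine ⟨σ₀, hσ₀, fun v hv => ?_⟩
      have : v ∈ Finset.univ.filter fun v : V => m a < a v := by simpa using hv
      rw [he] at this
      exact absurd this (Finset.notMem_empty _)
    · obtain ⟨v₀, hv₀, hmin⟩ := Finset.exists_min_image _ a hne'
      simp only [Finset.mem_filter, Finset.mem_univ, true_and] at hv₀ hmin
      obtain ⟨c, ⟨-, σ, hσ, hcσ⟩, hc⟩ := exists_lt_of_csInf_lt (hne a) hv₀
      exact ⟨σ, hσ, fun v hv => hcσ v (hc.trans_le (hmin v hv))⟩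
  let ρ : (V → ℝ) → V → ℝ := fun a v => max (a v - m a) 0
  have hρlip : ∀ a b v, |ρ a v - ρ b v| ≤ 2 * dist a b := by
    intro a b v
    have h1 := abs_max_sub_max_le_max (a v - m a) 0 (b v - m b) 0
    rw [sub_self, abs_zero, max_eq_left (abs_nonneg (a v - m a - (b v - m b)))] at h1
    refine h1.trans ?_
    have h2 := dist_le_pi_dist a b v
    rw [Real.dist_eq, abs_le] at h2
    have h3 := hmlip a b
    have h4 := hmlip b a
    rw [dist_comm b a] at h4
    rw [abs_le]
    constructor <;> linarith [h2.1, h2.2]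
  let T : (V → ℝ) → ConeSpace E := fun u => ∑ v : V, u v • conePoint 1 (v : E)
  let M := ∑ v : V, ‖(conePoint 1 (v : E) : ConeSpace E)‖
  have hM : 0 ≤ M := by positivity
  have hext : ∀ (σ : Finset E), σ ∈ K.faces → ∀ u : E → ℝ, (∀ v, v ∉ σ → u v = 0) →
      T (fun v => u v) = ∑ v ∈ σ, u v • conePoint 1 v := by
    intro σ hσ u hu
    rw [Finset.sum_subset (subset_vertexFinset hK hσ) fun v _ hv => by rw [hu v hv, zero_smul]]
    exact Finset.sum_coe_sort V fun v => u v • (conePoint 1 v : ConeSpace E)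
  refine ⟨fun z => T (ρ (B z)), ⟨⟨M * (2 * C), by positivity⟩, ?_⟩, fun z => ?_, fun z hz => ?_⟩
  · refine LipschitzWith.of_dist_le_mul fun z z' => ?_
    have h1 := hB.dist_le_mul z z'
    change dist (B z) (B z') ≤ C * dist z z' at h1
    change dist (T _) (T _) ≤ M * (2 * C) * dist z z'
    rw [dist_eq_norm, ← Finset.sum_sub_distrib, mul_assoc, Finset.sum_mul]
    refine (norm_sum_le _ _).trans (Finset.sum_le_sum fun v _ => ?_)
    rw [← sub_smul, norm_smul, mul_comm]
    refine mul_le_mul_of_nonneg_left ((hρlip _ _ v).trans ?_) (norm_nonneg _)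
    linarith
  · obtain ⟨σ, hσ, hσm⟩ := hmatt (B z)
    have h0 : ∀ v : V, (v : E) ∉ σ → ρ (B z) v = 0 := fun v hv =>
      max_eq_right (by linarith [not_lt.1 fun h => hv (hσm v h)])
    let u : E → ℝ := fun v => if h : v ∈ V then ρ (B z) ⟨v, h⟩ else 0
    have hu : T (ρ (B z)) = T fun v => u v := by
      congr 1
      ext v
      simp [u]
    have hu0 : ∀ v, v ∉ σ → u v = 0 := fun v hv => by
      simp only [u]
      split_ifs with h
      · exact h0 ⟨v, h⟩ hv
      · rfl
    have hupos : ∀ v, 0 ≤ u v := fun v => by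
      simp only [u]
      split_ifs with h
      · exact le_max_right _ _
      · exact le_rfl
    change T (ρ (B z)) ∈ cone K.space
    rw [hu, hext σ hσ u hu0]
    exact mem_cone_space_iff.2 ⟨σ, hσ,
      (mem_cone_convexHull_iff (face_nonempty hσ)).2 ⟨u, hupos, hu0, rfl⟩⟩
  · have hBz : B z = fun v : V => w z v := (hBw hz).symm
    have hmz : m (B z) = 0 := by
      refine le_antisymm (csInf_le (hbdd _) ⟨le_rfl, s z, hs z hz, fun v hv => ?_⟩) (hm0 _)
      by_contra h
      rw [hBz] at hv
      exact absurd (hws z hz v h) hv.ne'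
    have hρz : ρ (B z) = fun v : V => w z v := by
      ext v
      change max (B z v - m (B z)) 0 = w z v
      rw [hmz, sub_zero, hBz]
      exact max_eq_left (hw0 z hz v)
    change T (ρ (B z)) = z
    rw [hρz, hext _ (hs z hz) _ (hws z hz), hwz z hz]

theorem IsLipRetract.isClosed {B : Type*} [MetricSpace B] {T : Set B} (h : IsLipRetract T) :
    IsClosed T := by
  rcases T.eq_empty_or_nonempty with rfl | hne
  · exact isClosed_empty
  obtain ⟨r, ⟨K, hr⟩, hrT, hrid⟩ := h hne
  have : T = {x | r x = x} := by
    ext x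
    exact ⟨fun hx => hrid x hx, fun hx => by rw [← show r x = x from hx]; exact hrT x⟩
  rw [this]
  exact isClosed_eq hr.continuous continuous_id

theorem isClosed_coneAbove (hK : K.faces.Finite) (L : ℝ) : IsClosed (coneAbove L K.space) := by
  have h : IsClosed {z : ConeSpace E | L ≤ z.snd} :=
    isClosed_le continuous_const (WithLp.continuous_snd 2 E ℝ)
  exact (isLipRetract_cone hK).isClosed.inter h

theorem exists_norm_bound (hK : K.faces.Finite) : ∃ R : ℝ, 0 ≤ R ∧ ∀ x ∈ K.space, ‖x‖ ≤ R := by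
  refine ⟨∑ v ∈ vertexFinset hK, ‖v‖, by positivity, fun x hx => ?_⟩
  obtain ⟨σ, hσ, hx⟩ := Geometry.SimplicialComplex.mem_space_iff.1 hx
  obtain ⟨w, hw0, hw1, rfl⟩ := Finset.mem_convexHull'.1 hx
  refine (norm_sum_le _ _).trans ((Finset.sum_le_sum fun v hv => ?_).trans
    (Finset.sum_le_sum_of_subset_of_nonneg (subset_vertexFinset hK hσ) fun _ _ _ => norm_nonneg _))
  have : w v ≤ 1 := hw1 ▸ Finset.single_le_sum hw0 hv
  rw [norm_smul, Real.norm_of_nonneg (hw0 v hv)]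
  exact mul_le_of_le_one_left (norm_nonneg _) this

theorem norm_le_of_mem_cone {Z : Set E} {R : ℝ} (hR : ∀ x ∈ Z, ‖x‖ ≤ R) {z : ConeSpace E}
    (hz : z ∈ cone Z) : ‖z‖ ≤ (R + 1) * z.snd := by
  obtain ⟨h, hh, x, hx, rfl⟩ := hz
  refine (norm_conePoint_le h x).trans ?_
  rw [abs_of_nonneg hh, conePoint_snd, mul_comm]
  exact mul_le_mul_of_nonneg_right (by linarith [hR x hx]) hh

/-- The version of `exists_cone_regular` for the part of the cone above a positive height. -/
theorem exists_coneAbove_regular (hK : K.faces.Finite) {L : ℝ} (hL : 0 < L) :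
    ∃ ε κ : ℝ, 0 < ε ∧ 0 ≤ κ ∧ ∀ σ ∈ K.faces, ∀ τ ∈ K.faces,
      ∀ z ∈ coneAbove L (convexHull ℝ (σ : Set E)), ∀ z' ∈ coneAbove L (convexHull ℝ (τ : Set E)),
      dist z z' < ε → ∃ y ∈ coneAbove L (convexHull ℝ (σ : Set E)) ∩
        coneAbove L (convexHull ℝ (τ : Set E)), dist z y ≤ κ * dist z z' := by
  obtain ⟨C, hC, hreg⟩ := exists_cone_regular hK
  obtain ⟨R, hR, hRK⟩ := exists_norm_bound hK
  refine ⟨L / (C + 1), C + (R + 1) * C, by positivity, by positivity, ?_⟩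
  intro σ hσ τ hτ z hz z' hz' hd
  obtain ⟨y, ⟨hyσ, hyτ⟩, hy⟩ := hreg σ hσ τ hτ z hz.1 z' hz'.1
  have hd0 : 0 ≤ dist z z' := dist_nonneg
  rcases le_or_gt L y.snd with hyL | hyL
  · refine ⟨y, ⟨⟨hyσ, hyL⟩, hyτ, hyL⟩, hy.trans (mul_le_mul_of_nonneg_right ?_ hd0)⟩
    have : 0 ≤ (R + 1) * C := by positivity
    linarith
  have hzL : L ≤ z.snd := hz.2
  have h1 : L - y.snd ≤ C * dist z z' := by
    have := (le_abs_self _).trans (abs_snd_sub_le_dist z y)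
    linarith
  have hy0 : 0 < y.snd := by
    rw [lt_div_iff₀ (by positivity)] at hd
    nlinarith
  have hnorm := norm_le_of_mem_cone (fun x hx => hRK x
    (Geometry.SimplicialComplex.convexHull_subset_space hσ hx)) hyσ
  have hc : (0 : ℝ) ≤ L / y.snd := by positivity
  have hsnd : L ≤ ((L / y.snd) • y).snd := by
    change L ≤ L / y.snd * y.snd
    rw [div_mul_cancel₀ _ hy0.ne']
  refine ⟨(L / y.snd) • y, ⟨⟨smul_mem_cone hyσ hc, hsnd⟩, smul_mem_cone hyτ hc, hsnd⟩, ?_⟩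
  have h2 : dist y ((L / y.snd) • y) ≤ (R + 1) * C * dist z z' := by
    rw [dist_comm, dist_eq_norm]
    have : (L / y.snd) • y - y = ((L - y.snd) / y.snd) • y := by
      rw [sub_div, div_self hy0.ne', sub_smul, one_smul]
    rw [this, norm_smul, Real.norm_of_nonneg (div_nonneg (by linarith) hy0.le)]
    calc (L - y.snd) / y.snd * ‖y‖ ≤ (L - y.snd) / y.snd * ((R + 1) * y.snd) := by
          refine mul_le_mul_of_nonneg_left hnorm (div_nonneg (by linarith) hy0.le)
      _ = (R + 1) * (L - y.snd) := by field_simp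
      _ ≤ (R + 1) * C * dist z z' := by
          rw [mul_assoc]; exact mul_le_mul_of_nonneg_left h1 (by positivity)
  have h3 := dist_triangle z y ((L / y.snd) • y)
  linarith

end ConeGeometry

/-! ### Step functions on the unit interval -/

section StepFunctions

open MeasureTheory Classical

/-- The indicator of a proposition, with values in `ℝ`. -/
noncomputable def ind (P : Prop) : ℝ := if P then 1 else 0

theorem ind_pos {P : Prop} (h : P) : ind P = 1 := if_pos h

theorem ind_neg {P : Prop} (h : ¬P) : ind P = 0 := if_neg h

@[simp] theorem ind_true : ind True = 1 := ind_pos trivial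

@[simp] theorem ind_false : ind False = 0 := ind_neg not_false

theorem ind_nonneg (P : Prop) : 0 ≤ ind P := by unfold ind; split_ifs <;> norm_num

theorem ind_le_one (P : Prop) : ind P ≤ 1 := by unfold ind; split_ifs <;> norm_num

variable {T T' : Type*} {W : Type*} [NormedAddCommGroup W]

theorem intervalIntegrable_step (g : SimpleFunc ℝ T) (φ : T → W) (a b : ℝ) :
    IntervalIntegrable (fun t => φ (g t)) volume a b := by
  rw [intervalIntegrable_iff]
  have : IsFiniteMeasure (volume.restrict (uIoc a b)) := ⟨by simp [uIoc]⟩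
  exact (g.map φ).integrable_of_isFiniteMeasure

theorem intervalIntegrable_step₂ (g : SimpleFunc ℝ T) (g' : SimpleFunc ℝ T') (φ : T → T' → W)
    (a b : ℝ) : IntervalIntegrable (fun t => φ (g t) (g' t)) volume a b :=
  intervalIntegrable_step (g.pair g') (fun p => φ p.1 p.2) a b

variable [NormedSpace ℝ W]

theorem integral_congr_Ioc {a b : ℝ} (hab : a ≤ b) {f f' : ℝ → W} (h : ∀ t ∈ Ioc a b, f t = f' t) :
    ∫ t in a..b, f t = ∫ t in a..b, f' t := by
  rw [intervalIntegral.integral_of_le hab, intervalIntegral.integral_of_le hab]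
  exact setIntegral_congr_fun measurableSet_Ioc h

/-- The measure of the set of parameters in `[0, 1]` at which `g` takes the value `p`. -/
noncomputable def law (g : SimpleFunc ℝ T) (p : T) : ℝ :=
  ∫ t in (0 : ℝ)..1, ind (g t = p)

theorem law_nonneg (g : SimpleFunc ℝ T) (p : T) : 0 ≤ law g p :=
  intervalIntegral.integral_nonneg zero_le_one fun _ _ => ind_nonneg _

theorem integral_step_eq_sum [CompleteSpace W] {g : SimpleFunc ℝ T} {s : Finset T}
    (hg : ∀ t, g t ∈ s) (φ : T → W) (a b : ℝ) :
    ∫ t in a..b, φ (g t) = ∑ p ∈ s, (∫ t in a..b, ind (g t = p)) • φ p := by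
  simp_rw [← intervalIntegral.integral_smul_const]
  rw [← intervalIntegral.integral_finsetSum fun p _ =>
    intervalIntegrable_step g (fun q => ind (q = p) • φ p) a b]
  congr 1
  ext t
  rw [Finset.sum_eq_single_of_mem (g t) (hg t) fun p _ hp => by rw [ind_neg hp.symm, zero_smul],
    ind_pos rfl, one_smul]

theorem integral_step_eq_sum_law [CompleteSpace W] {g : SimpleFunc ℝ T} {s : Finset T}
    (hg : ∀ t, g t ∈ s) (φ : T → W) : ∫ t in (0 : ℝ)..1, φ (g t) = ∑ p ∈ s, law g p • φ p :=
  integral_step_eq_sum hg φ 0 1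

theorem law_eq_zero {g : SimpleFunc ℝ T} {p : T} (h : ∀ t, g t ≠ p) : law g p = 0 := by
  simp [law, h]

theorem sum_law {g : SimpleFunc ℝ T} {s : Finset T} (hg : ∀ t, g t ∈ s) :
    ∑ p ∈ s, law g p = 1 := by
  have := integral_step_eq_sum_law hg fun _ => (1 : ℝ)
  simpa using this.symm

/-- The measure of the set of parameters in `[0, 1]` at which two step functions differ. -/
noncomputable def stepDist (g g' : SimpleFunc ℝ T) : ℝ :=
  ∫ t in (0 : ℝ)..1, ind (g t ≠ g' t)

theorem stepDist_nonneg (g g' : SimpleFunc ℝ T) : 0 ≤ stepDist g g' :=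
  intervalIntegral.integral_nonneg zero_le_one fun _ _ => ind_nonneg _

theorem stepDist_comm (g g' : SimpleFunc ℝ T) : stepDist g g' = stepDist g' g := by
  simp only [stepDist, ne_comm]

theorem stepDist_map_le (f : T → T') (g g' : SimpleFunc ℝ T) :
    stepDist (g.map f) (g'.map f) ≤ stepDist g g' := by
  refine intervalIntegral.integral_mono_on zero_le_one
    (intervalIntegrable_step₂ (g.map f) (g'.map f) (fun x y => ind (x ≠ y)) 0 1)
    (intervalIntegrable_step₂ g g' (fun x y => ind (x ≠ y)) 0 1) fun t _ => ?_
  by_cases h : g t = g' t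
  · simp [h]
  · rw [ind_pos h]
    exact ind_le_one _

theorem stepDist_pair_le (g g' : SimpleFunc ℝ T) (f f' : SimpleFunc ℝ T') :
    stepDist (g.pair f) (g'.pair f') ≤ stepDist g g' + stepDist f f' := by
  unfold stepDist
  rw [← intervalIntegral.integral_add
    (intervalIntegrable_step₂ g g' (fun x y => ind (x ≠ y)) 0 1)
    (intervalIntegrable_step₂ f f' (fun x y => ind (x ≠ y)) 0 1)]
  refine intervalIntegral.integral_mono_on zero_le_one
    (intervalIntegrable_step₂ (g.pair f) (g'.pair f')
      (fun x y => ind (x ≠ y)) 0 1)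
    ((intervalIntegrable_step₂ g g' (fun x y => ind (x ≠ y)) 0 1).add
    (intervalIntegrable_step₂ f f' (fun x y => ind (x ≠ y)) 0 1)) fun t _ => ?_
  by_cases h1 : g t = g' t <;> by_cases h2 : f t = f' t <;> simp [h1, h2]

/-- Integrals of functions of step functions depend in a Lipschitz way on both. -/
theorem norm_integral_step_sub_le (g g' : SimpleFunc ℝ T) {F F' : T → W} {R δ : ℝ}
    (hF : ∀ p, ‖F p‖ ≤ R) (hF' : ∀ p, ‖F' p‖ ≤ R) (hδ : ∀ p, ‖F p - F' p‖ ≤ δ) :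
    ‖(∫ t in (0 : ℝ)..1, F (g t)) - ∫ t in (0 : ℝ)..1, F' (g' t)‖ ≤
      δ + 2 * R * stepDist g g' := by
  rw [← intervalIntegral.integral_sub (intervalIntegrable_step g F 0 1)
    (intervalIntegrable_step g' F' 0 1)]
  have hi := intervalIntegrable_step₂ g g' (fun x y => δ + 2 * R * ind (x ≠ y)) 0 1
  have h1 : ∫ t in (0 : ℝ)..1, (δ + 2 * R * ind (g t ≠ g' t))
      = δ + 2 * R * stepDist g g' := by
    rw [intervalIntegral.integral_add (intervalIntegrable_step g (fun _ => δ) 0 1)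
      (intervalIntegrable_step₂ g g' (fun x y => 2 * R * ind (x ≠ y)) 0 1),
      intervalIntegral.integral_const_mul]
    simp [stepDist]
  rw [← h1]
  refine intervalIntegral.norm_integral_le_of_norm_le zero_le_one
    (Filter.Eventually.of_forall fun t _ => ?_) hi
  by_cases h : g t = g' t
  · rw [h, ind_neg (by simp)]
    simpa using hδ (g' t)
  · have h0 : 0 ≤ δ := (norm_nonneg _).trans (hδ (g t))
    have h2 := norm_sub_le (F (g t)) (F' (g' t))
    have h3 := hF (g t)
    have h4 := hF' (g' t)
    rw [ind_pos h]
    linarith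

theorem integral_eq_of_stepDist_eq_zero {g g' : SimpleFunc ℝ T} (h : stepDist g g' = 0)
    (φ : T → W) : ∫ t in (0 : ℝ)..1, φ (g t) = ∫ t in (0 : ℝ)..1, φ (g' t) := by
  -- only the finitely many values of `g` and `g'` matter, so `φ` may be taken to be bounded
  let S := g.range ∪ g'.range
  let ψ : T → W := fun p => if p ∈ S then φ p else 0
  have hψ : ∀ p, ‖ψ p‖ ≤ ∑ q ∈ S, ‖φ q‖ := fun p => by
    by_cases hp : p ∈ S
    · simp only [ψ, hp, if_true]
      exact Finset.single_le_sum (f := fun q => ‖φ q‖) (fun _ _ => norm_nonneg _) hp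
    · simp only [ψ, hp, if_false, norm_zero]
      positivity
  have h1 : ∀ t, ψ (g t) = φ (g t) := fun t =>
    if_pos (Finset.mem_union_left _ (g.mem_range_self t))
  have h2 : ∀ t, ψ (g' t) = φ (g' t) := fun t =>
    if_pos (Finset.mem_union_right _ (g'.mem_range_self t))
  have := norm_integral_step_sub_le g g' (δ := 0) hψ hψ (by simp)
  rw [h, mul_zero, add_zero, norm_le_zero_iff, sub_eq_zero] at this
  simpa only [h1, h2] using this

/-- The step function which is `true` exactly before `b`. -/
noncomputable def beforeStep (b : ℝ) : SimpleFunc ℝ Bool :=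
  (SimpleFunc.const ℝ true).piecewise (Iic b) measurableSet_Iic (SimpleFunc.const ℝ false)

theorem beforeStep_eq_true_iff {b t : ℝ} : beforeStep b t = true ↔ t ≤ b := by
  by_cases h : t ≤ b <;> simp [beforeStep, SimpleFunc.coe_piecewise, h, Set.piecewise]

theorem stepDist_beforeStep {b b' : ℝ} (h0 : 0 ≤ b) (h : b ≤ b') (h1 : b' ≤ 1) :
    stepDist (beforeStep b) (beforeStep b') = b' - b := by
  have key : ∀ t, ind (beforeStep b t ≠ beforeStep b' t)
      = (Ioc b b').indicator 1 t := by
    intro t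
    by_cases h1 : t ≤ b
    · have h2 : t ≤ b' := h1.trans h
      rw [beforeStep_eq_true_iff.2 h1, beforeStep_eq_true_iff.2 h2]
      simp [h1.not_gt]
    · have e1 : beforeStep b t = false := by
        rw [← Bool.not_eq_true, beforeStep_eq_true_iff]; exact h1
      by_cases h2 : t ≤ b'
      · rw [e1, beforeStep_eq_true_iff.2 h2]
        simp [h2, not_le.1 h1]
      · have e2 : beforeStep b' t = false := by
          rw [← Bool.not_eq_true, beforeStep_eq_true_iff]; exact h2
        rw [e1, e2]
        simp [h2]
  unfold stepDist
  simp_rw [key]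
  rw [intervalIntegral.integral_of_le zero_le_one, integral_indicator_one measurableSet_Ioc,
    measureReal_restrict_apply measurableSet_Ioc, Ioc_inter_Ioc, max_eq_left h0, min_eq_left h1]
  simp [h]

theorem stepDist_beforeStep_le {b b' : ℝ} (h0 : 0 ≤ b) (h1 : b ≤ 1) (h0' : 0 ≤ b') (h1' : b' ≤ 1) :
    stepDist (beforeStep b) (beforeStep b') ≤ |b - b'| := by
  rcases le_total b b' with h | h
  · rw [stepDist_beforeStep h0 h h1', abs_sub_comm]
    exact le_abs_self _
  · rw [stepDist_comm, stepDist_beforeStep h0' h h1]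
    exact le_abs_self _

theorem integral_beforeStep {b : ℝ} (h0 : 0 ≤ b) (h1 : b ≤ 1) :
    law (beforeStep b) true = b := by
  have h2 : ∀ t, ind (beforeStep b t = true) = (Iic b).indicator 1 t := by
    intro t
    simp [beforeStep_eq_true_iff, indicator_apply, ind]
  unfold law
  simp_rw [h2]
  rw [intervalIntegral.integral_of_le zero_le_one, integral_indicator_one measurableSet_Iic,
    measureReal_restrict_apply measurableSet_Iic, inter_comm, Ioc_inter_Iic, min_eq_right h1]
  simp [h0]

/-- Two initial segments of the interval differ in a set whose measure is the difference of their
measures. -/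
theorem integral_abs_sub_of_initial (g : SimpleFunc ℝ T) (g' : SimpleFunc ℝ T') {P : T → Prop}
    {P' : T' → Prop} (hP : ∀ t t', t ≤ t' → P (g t') → P (g t))
    (hP' : ∀ t t', t ≤ t' → P' (g' t') → P' (g' t)) :
    ∫ t in (0 : ℝ)..1, |ind (P (g t)) - ind (P' (g' t))| =
      |(∫ t in (0 : ℝ)..1, ind (P (g t))) -
        ∫ t in (0 : ℝ)..1, ind (P' (g' t))| := by
  have hi := intervalIntegrable_step g (fun p => ind (P p)) 0 1
  have hi' := intervalIntegrable_step g' (fun p => ind (P' p)) 0 1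
  rw [← intervalIntegral.integral_sub hi hi']
  by_cases h : ∀ t, P (g t) → P' (g' t)
  · have h1 : ∀ t, ind (P (g t)) - ind (P' (g' t)) ≤ 0 := by
      intro t
      by_cases h2 : P (g t)
      · simp [h2, h t h2]
      · rw [ind_neg h2, zero_sub, neg_nonpos]
        exact ind_nonneg _
    rw [abs_of_nonpos, ← intervalIntegral.integral_neg]
    · exact intervalIntegral.integral_congr fun t _ => abs_of_nonpos (h1 t)
    · have := intervalIntegral.integral_nonneg (μ := volume) zero_le_one
        fun t (_ : t ∈ Icc (0 : ℝ) 1) => neg_nonneg.2 (h1 t)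
      rw [intervalIntegral.integral_neg] at this
      linarith
  · push Not at h
    obtain ⟨t₀, ht₀, ht₀'⟩ := h
    have h1 : ∀ t, 0 ≤ ind (P (g t)) - ind (P' (g' t)) := by
      intro t
      by_cases h2 : P' (g' t)
      · have h3 : t ≤ t₀ := by
          by_contra hcon
          exact ht₀' (hP' _ _ (not_le.1 hcon).le h2)
        simp [h2, hP _ _ h3 ht₀]
      · rw [ind_neg h2, sub_zero]
        exact ind_nonneg _
    rw [abs_of_nonneg (intervalIntegral.integral_nonneg zero_le_one fun t _ => h1 t)]
    exact intervalIntegral.integral_congr fun t _ => abs_of_nonneg (h1 t)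

/-- Monotone step functions with values in chains are determined by their laws, in a quantitative
way. Where two of them differ, either the first one takes a value outside `s'`, or they are
separated by an initial segment of the chain `s'`; the preimages of an initial segment are two
initial segments of the line, and their symmetric difference is controlled by the laws. -/
theorem stepDist_le_of_monotone {le : T → T → Prop} {s s' V : Finset T} {g g' : SimpleFunc ℝ T}
    (hg : ∀ t, g t ∈ s) (hg' : ∀ t, g' t ∈ s') (hsV : s ⊆ V) (hsV' : s' ⊆ V)
    (hm : ∀ t t', t ≤ t' → le (g t) (g t')) (hm' : ∀ t t', t ≤ t' → le (g' t) (g' t'))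
    (htrans : ∀ u ∈ s ∪ s', ∀ v ∈ s ∪ s', ∀ w ∈ s ∪ s', le u v → le v w → le u w)
    (htot : ∀ u ∈ s', ∀ v ∈ s', le u v ∨ le v u)
    (hanti : ∀ u ∈ s', ∀ v ∈ s', le u v → le v u → u = v) :
    stepDist g g' ≤ (V.card + 1) * ∑ u ∈ V, |law g u - law g' u| := by
  set δ := ∑ u ∈ V, |law g u - law g' u| with hδ
  have hF : ∀ p ∈ s', ∫ t in (0 : ℝ)..1,
      |ind (le (g t) p) - ind (le (g' t) p)| ≤ δ := by
    intro p hp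
    have hp' := Finset.mem_union_right s hp
    rw [integral_abs_sub_of_initial g g' (P := fun u => le u p) (P' := fun u => le u p)
      (fun t t' htt h => htrans _ (Finset.mem_union_left _ (hg t)) _
        (Finset.mem_union_left _ (hg t')) _ hp' (hm t t' htt) h)
      (fun t t' htt h => htrans _ (Finset.mem_union_right _ (hg' t)) _
        (Finset.mem_union_right _ (hg' t')) _ hp' (hm' t t' htt) h),
      integral_step_eq_sum_law (fun t => hsV (hg t)) fun u => ind (le u p),
      integral_step_eq_sum_law (fun t => hsV' (hg' t)) fun u => ind (le u p),
      ← Finset.sum_sub_distrib]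
    refine (Finset.abs_sum_le_sum_abs _ _).trans (Finset.sum_le_sum fun u _ => ?_)
    unfold ind
    split_ifs <;> simp
  have hlaw : ∀ p ∈ s \ s', law g p ≤ |law g p - law g' p| := by
    intro p hp
    rw [law_eq_zero (g := g') (p := p) fun t h => (Finset.mem_sdiff.1 hp).2 (h ▸ hg' t), sub_zero]
    exact le_abs_self _
  have hi : ∀ p, IntervalIntegrable
      (fun t => |ind (le (g t) p) - ind (le (g' t) p)|)
      volume 0 1 := fun p => intervalIntegrable_step₂ g g'
      (fun x y => |ind (le x p) - ind (le y p)|) 0 1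
  have hj : ∀ p, IntervalIntegrable (fun t => ind (g t = p)) volume 0 1 :=
    fun p => intervalIntegrable_step g (fun x => ind (x = p)) 0 1
  have h1 : stepDist g g' ≤ ∫ t in (0 : ℝ)..1,
      ((∑ p ∈ s', |ind (le (g t) p) - ind (le (g' t) p)|) +
        ∑ p ∈ s \ s', ind (g t = p)) := by
    refine intervalIntegral.integral_mono_on zero_le_one
      (intervalIntegrable_step₂ g g' (fun x y => ind (x ≠ y)) 0 1)
      (intervalIntegrable_step₂ g g' (fun x y =>
        (∑ p ∈ s', |ind (le x p) - ind (le y p)|) +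
        ∑ p ∈ s \ s', ind (x = p)) 0 1) fun t _ => ?_
    have hn1 : 0 ≤ ∑ p ∈ s', |ind (le (g t) p) - ind (le (g' t) p)| :=
      Finset.sum_nonneg fun _ _ => abs_nonneg _
    have hn2 : (0 : ℝ) ≤ ∑ p ∈ s \ s', ind (g t = p) :=
      Finset.sum_nonneg fun _ _ => ind_nonneg _
    by_cases heq : g t = g' t
    · rw [ind_neg (not_not.2 heq)]
      exact add_nonneg hn1 hn2
    rw [ind_pos heq]
    by_cases hmem : g t ∈ s'
    · have : ∃ p ∈ s', 1 ≤ |ind (le (g t) p) - ind (le (g' t) p)| := by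
        have hr : le (g t) (g t) := hm t t le_rfl
        have hr' : le (g' t) (g' t) := hm' t t le_rfl
        rcases htot _ hmem _ (hg' t) with h | h
        · refine ⟨g t, hmem, ?_⟩
          rw [ind_pos hr, ind_neg fun h' => heq (hanti _ hmem _ (hg' t) h h')]
          simp
        · refine ⟨g' t, hg' t, ?_⟩
          rw [ind_pos hr', ind_neg fun h' => heq (hanti _ hmem _ (hg' t) h' h)]
          simp
      obtain ⟨p, hp, h1⟩ := this
      have := Finset.single_le_sum (f := fun p =>
        |ind (le (g t) p) - ind (le (g' t) p)|)
        (fun _ _ => abs_nonneg _) hp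
      linarith
    · have hp : g t ∈ s \ s' := Finset.mem_sdiff.2 ⟨hg t, hmem⟩
      have := Finset.single_le_sum (f := fun p => ind (g t = p))
        (fun _ _ => ind_nonneg _) hp
      rw [ind_pos rfl] at this
      linarith
  refine h1.trans ?_
  rw [intervalIntegral.integral_add
    (intervalIntegrable_step₂ g g' (fun x y =>
      ∑ p ∈ s', |ind (le x p) - ind (le y p)|) 0 1)
    (intervalIntegrable_step g (fun x => ∑ p ∈ s \ s', ind (x = p)) 0 1),
    intervalIntegral.integral_finsetSum fun p _ => hi p,
    intervalIntegral.integral_finsetSum fun p _ => hj p, add_mul, one_mul]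
  have hδ0 : 0 ≤ δ := Finset.sum_nonneg fun _ _ => abs_nonneg _
  refine add_le_add ((Finset.sum_le_sum hF).trans ?_) ((Finset.sum_le_sum hlaw).trans ?_)
  · rw [Finset.sum_const, nsmul_eq_mul]
    exact mul_le_mul_of_nonneg_right (by exact_mod_cast Finset.card_le_card hsV') hδ0
  · exact Finset.sum_le_sum_of_subset_of_nonneg (Finset.sdiff_subset.trans hsV)
      fun _ _ _ => abs_nonneg _

theorem exists_least {le : T → T → Prop} {s : Finset T} (hne : s.Nonempty)
    (htot : ∀ u ∈ s, ∀ v ∈ s, le u v ∨ le v u)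
    (htrans : ∀ u ∈ s, ∀ v ∈ s, ∀ w ∈ s, le u v → le v w → le u w) :
    ∃ v ∈ s, ∀ u ∈ s, le v u := by
  induction hne using Finset.Nonempty.cons_induction with
  | singleton a =>
    refine ⟨a, by simp, fun u hu => ?_⟩
    rw [Finset.mem_singleton.1 hu]
    simpa using htot a (by simp) a (by simp)
  | cons a s ha hs ih =>
    obtain ⟨v, hv, hvs⟩ := ih
      (fun u hu w hw => htot u (Finset.mem_cons_of_mem hu) w (Finset.mem_cons_of_mem hw))
      (fun u hu v hv w hw => htrans u (Finset.mem_cons_of_mem hu) v (Finset.mem_cons_of_mem hv) w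
        (Finset.mem_cons_of_mem hw))
    have ha' : a ∈ Finset.cons a s ha := Finset.mem_cons_self a s
    have hv' : v ∈ Finset.cons a s ha := Finset.mem_cons_of_mem hv
    rcases htot a ha' v hv' with h | h
    · refine ⟨a, ha', fun u hu => ?_⟩
      rcases Finset.mem_cons.1 hu with rfl | hu'
      · simpa using htot u ha' u ha'
      · exact htrans a ha' v hv' u hu h (hvs u hu')
    · refine ⟨v, hv', fun u hu => ?_⟩
      rcases Finset.mem_cons.1 hu with rfl | hu'
      · exact h
      · exact hvs u hu'

/-- The quantile function of a system of weights on a chain. -/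
theorem exists_quantile {le : T → T → Prop} (c : T → ℝ) (s : Finset T) (hne : s.Nonempty)
    (hc : ∀ p ∈ s, 0 ≤ c p) (htot : ∀ u ∈ s, ∀ v ∈ s, le u v ∨ le v u)
    (htrans : ∀ u ∈ s, ∀ v ∈ s, ∀ w ∈ s, le u v → le v w → le u w) :
    ∃ g : SimpleFunc ℝ T, (∀ t, g t ∈ s) ∧ (∀ t t', t ≤ t' → le (g t) (g t')) ∧
      ∀ p ∈ s, (∫ t in (0 : ℝ)..∑ p ∈ s, c p, ind (g t = p)) = c p := by
  induction hn : s.card generalizing s with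
  | zero => exact absurd (Finset.card_eq_zero.1 hn) hne.ne_empty
  | succ n ih =>
    obtain ⟨v, hv, hle⟩ := exists_least hne htot htrans
    rcases (s.erase v).eq_empty_or_nonempty with he | hne'
    · have hs : s = {v} := by
        rw [← Finset.insert_erase hv, he]
        rfl
      subst hs
      refine ⟨SimpleFunc.const ℝ v, by simp, fun t t' _ => ?_, ?_⟩
      · simpa using hle v hv
      · simp
    · have hsub := Finset.erase_subset v s
      obtain ⟨g, hgs, hgm, hgl⟩ := ih (s.erase v) hne' (fun p hp => hc p (hsub hp))
        (fun u hu w hw => htot u (hsub hu) w (hsub hw))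
        (fun u hu v hv w hw => htrans u (hsub hu) v (hsub hv) w (hsub hw))
        (by rw [Finset.card_erase_of_mem hv, hn]; rfl)
      have hcv := hc v hv
      set m := ∑ p ∈ s.erase v, c p with hm
      have hm0 : 0 ≤ m := Finset.sum_nonneg fun p hp => hc p (hsub hp)
      have hsum : ∑ p ∈ s, c p = c v + m := (Finset.add_sum_erase s c hv).symm
      let f : SimpleFunc ℝ T := (SimpleFunc.const ℝ v).piecewise (Iic (c v)) measurableSet_Iic
        (g.comp (fun t => t - c v) (by fun_prop))
      have hf1 : ∀ t, t ≤ c v → f t = v := fun t ht => by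
        simp [f, SimpleFunc.coe_piecewise, Set.piecewise, ht]
      have hf2 : ∀ t, c v < t → f t = g (t - c v) := fun t ht => by
        simp [f, SimpleFunc.coe_piecewise, Set.piecewise, not_le.2 ht]
      have hfs : ∀ t, f t ∈ s := fun t => by
        rcases le_or_gt t (c v) with h | h
        · rw [hf1 t h]; exact hv
        · rw [hf2 t h]; exact hsub (hgs _)
      refine ⟨f, hfs, fun t t' htt => ?_, fun p hp => ?_⟩
      · rcases le_or_gt t (c v) with h | h
        · rw [hf1 t h]; exact hle _ (hfs t')
        · rw [hf2 t h, hf2 t' (h.trans_le htt)]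
          exact hgm _ _ (by linarith)
      · rw [hsum, ← intervalIntegral.integral_add_adjacent_intervals
          (intervalIntegrable_step f (fun q => ind (q = p)) 0 (c v))
          (intervalIntegrable_step f (fun q => ind (q = p)) _ _),
          integral_congr_Ioc hcv (f' := fun _ => ind (v = p))
            fun t ht => by rw [hf1 t ht.2],
          integral_congr_Ioc (by linarith : c v ≤ c v + m)
            (f' := fun t => ind (g (t - c v) = p))
            fun t ht => by rw [hf2 t ht.1],
          intervalIntegral.integral_comp_sub_right (fun t => ind (g t = p)),
          sub_self, add_sub_cancel_left]
        rcases eq_or_ne v p with rfl | hvp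
        · have : ∀ t, g t ≠ v := fun t => (Finset.mem_erase.1 (hgs t)).1
          simp [this]
        · rw [hgl p (Finset.mem_erase.2 ⟨hvp.symm, hp⟩)]
          simp [hvp]

/-- The quantile function of a probability weight on a chain, with its law. -/
theorem exists_quantile_law {le : T → T → Prop} (c : T → ℝ) (s : Finset T)
    (hc : ∀ p ∈ s, 0 ≤ c p) (hc1 : ∑ p ∈ s, c p = 1) (htot : ∀ u ∈ s, ∀ v ∈ s, le u v ∨ le v u)
    (htrans : ∀ u ∈ s, ∀ v ∈ s, ∀ w ∈ s, le u v → le v w → le u w) :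
    ∃ g : SimpleFunc ℝ T, (∀ t, g t ∈ s) ∧ (∀ t t', t ≤ t' → le (g t) (g t')) ∧
      ∀ p ∈ s, law g p = c p := by
  have hne : s.Nonempty := by
    rw [Finset.nonempty_iff_ne_empty]
    rintro rfl
    simp at hc1
  obtain ⟨g, h1, h2, h3⟩ := exists_quantile c s hne hc htot htrans
  rw [hc1] at h3
  exact ⟨g, h1, h2, h3⟩

/-- The two branches of the inverse of the folding map `t ↦ |2 t - 1|`, applied to a step
function. Negative parameters, which play no role, are sent to the middle, so that folding
preserves monotonicity on the whole line. -/
noncomputable def foldPair (g : SimpleFunc ℝ T) : SimpleFunc ℝ (T × T) :=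
  (g.comp (fun s => (1 - max s 0) / 2) (by fun_prop)).pair
    (g.comp (fun s => (1 + max s 0) / 2) (by fun_prop))

theorem foldPair_apply (g : SimpleFunc ℝ T) (s : ℝ) :
    foldPair g s = (g ((1 - max s 0) / 2), g ((1 + max s 0) / 2)) := rfl

/-- Each of the two branches of the folding map covers one half of the unit interval. -/
theorem integral_foldPair (g : SimpleFunc ℝ T) (φ : T → W) :
    ∫ s in (0 : ℝ)..1, (φ (foldPair g s).1 + φ (foldPair g s).2) =
      (2 : ℝ) • ∫ t in (0 : ℝ)..1, φ (g t) := by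
  rw [intervalIntegral.integral_add (intervalIntegrable_step (foldPair g) (fun p => φ p.1) 0 1)
    (intervalIntegrable_step (foldPair g) (fun p => φ p.2) 0 1)]
  have h1 : ∫ s in (0 : ℝ)..1, φ (foldPair g s).1 = (2 : ℝ) • ∫ t in (0 : ℝ)..1 / 2, φ (g t) := by
    rw [integral_congr_Ioc zero_le_one (f' := fun s => φ (g (1 / 2 - s / 2))) fun t ht => by
      rw [foldPair_apply, max_eq_left ht.1.le, sub_div],
      intervalIntegral.integral_comp_sub_div (fun t => φ (g t)) two_ne_zero]
    norm_num
  have h2 : ∫ s in (0 : ℝ)..1, φ (foldPair g s).2 = (2 : ℝ) • ∫ t in (1 / 2 : ℝ)..1, φ (g t) := by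
    rw [integral_congr_Ioc zero_le_one (f' := fun s => φ (g (1 / 2 + s / 2))) fun t ht => by
      rw [foldPair_apply, max_eq_left ht.1.le, add_div],
      intervalIntegral.integral_comp_add_div (fun t => φ (g t)) two_ne_zero]
    norm_num
  rw [h1, h2, ← smul_add, intervalIntegral.integral_add_adjacent_intervals
    (intervalIntegrable_step g φ _ _) (intervalIntegrable_step g φ _ _)]

theorem stepDist_foldPair_le (g g' : SimpleFunc ℝ T) :
    stepDist (foldPair g) (foldPair g') ≤ 2 * stepDist g g' := by
  have h := integral_foldPair (g.pair g') fun p => ind (p.1 ≠ p.2)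
  rw [smul_eq_mul] at h
  unfold stepDist
  change _ ≤ 2 * ∫ t in (0 : ℝ)..1, ind (((g.pair g') t).1 ≠ ((g.pair g') t).2)
  rw [← h]
  refine intervalIntegral.integral_mono_on zero_le_one
    (intervalIntegrable_step₂ (foldPair g) (foldPair g')
      (fun x y => ind (x ≠ y)) 0 1)
    (intervalIntegrable_step (foldPair (g.pair g')) (fun p =>
      ind (p.1.1 ≠ p.1.2) + ind (p.2.1 ≠ p.2.2)) 0 1)
    fun t _ => ?_
  simp only [foldPair_apply, SimpleFunc.pair_apply]
  by_cases h1 : g ((1 - max t 0) / 2) = g' ((1 - max t 0) / 2) <;>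
    by_cases h2 : g ((1 + max t 0) / 2) = g' ((1 + max t 0) / 2) <;> simp [h1, h2]

end StepFunctions

/-! ### Standard subdivisions and folding -/

section Subdivision

open MeasureTheory

variable {E : Type*} [NormedAddCommGroup E] [InnerProductSpace ℝ E]

/-- The mean value of a step function over the unit interval. -/
noncomputable def mean (g : SimpleFunc ℝ E) : E := ∫ t in (0 : ℝ)..1, g t

/-- `g` is a monotone step function with values in the vertices of a simplex of the locally ordered
complex `K`. Such a function amounts to a weighted simplex, that is, to a point of `K`, namely to
its mean value. -/
structure IsMonoStep (K : Set (Finset E) × (E → E → Prop)) (g : SimpleFunc ℝ E) : Prop where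
  face : ∃ s ∈ K.1, ∀ t, g t ∈ s
  mono : ∀ t t', t ≤ t' → K.2 (g t) (g t')

/-- A locally ordered complex in which points determine weighted simplices. -/
structure IsTame (K : Set (Finset E) × (E → E → Prop)) : Prop where
  order : IsLocalOrder K.1 K.2
  unique : ∀ g g', IsMonoStep K g → IsMonoStep K g' → mean g = mean g' → stepDist g g' = 0

/-- The folded step function: the midpoint of the values at the two preimages under
`t ↦ |2 t - 1|`. -/
noncomputable def foldStep (g : SimpleFunc ℝ E) : SimpleFunc ℝ E :=
  (foldPair g).map fun p => midpoint ℝ p.1 p.2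

theorem foldStep_apply (g : SimpleFunc ℝ E) (s : ℝ) :
    foldStep g s = midpoint ℝ (foldPair g s).1 (foldPair g s).2 := rfl

theorem stepDist_foldStep_le (g g' : SimpleFunc ℝ E) :
    stepDist (foldStep g) (foldStep g') ≤ 2 * stepDist g g' :=
  (stepDist_map_le _ _ _).trans (stepDist_foldPair_le g g')

theorem stepDist_foldStep_iterate_le (g g' : SimpleFunc ℝ E) (n : ℕ) :
    stepDist (foldStep^[n] g) (foldStep^[n] g') ≤ 2 ^ n * stepDist g g' := by
  induction n with
  | zero => simp
  | succ n ih =>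
    rw [Function.iterate_succ_apply', Function.iterate_succ_apply', pow_succ']
    refine (stepDist_foldStep_le _ _).trans ?_
    linarith

theorem midpoint_eq (x y : E) : midpoint ℝ x y = (1 / 2 : ℝ) • (x + y) := by
  rw [midpoint_eq_smul_add, invOf_eq_inv, one_div]

theorem mean_foldStep (g : SimpleFunc ℝ E) : mean (foldStep g) = mean g := by
  unfold mean
  simp only [foldStep_apply, midpoint_eq]
  rw [intervalIntegral.integral_smul, integral_foldPair g fun x => x, smul_smul]
  norm_num

theorem mean_foldStep_iterate (g : SimpleFunc ℝ E) (n : ℕ) : mean (foldStep^[n] g) = mean g := by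
  induction n with
  | zero => rfl
  | succ n ih => rw [Function.iterate_succ_apply', mean_foldStep, ih]

theorem foldLeft_le_foldRight (s : ℝ) : (1 - max s 0) / 2 ≤ (1 + max s 0) / 2 := by
  have := le_max_right s 0
  linarith

theorem foldLeft_antitone {s s' : ℝ} (h : s ≤ s') : (1 - max s' 0) / 2 ≤ (1 - max s 0) / 2 := by
  have := max_le_max h (le_refl (0 : ℝ))
  linarith

theorem foldRight_monotone {s s' : ℝ} (h : s ≤ s') : (1 + max s 0) / 2 ≤ (1 + max s' 0) / 2 := by
  have := max_le_max h (le_refl (0 : ℝ))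
  linarith

variable {K : Set (Finset E) × (E → E → Prop)}

omit [NormedAddCommGroup E] [InnerProductSpace ℝ E] in
theorem IsMonoStep.foldPair_le {g : SimpleFunc ℝ E} (hg : IsMonoStep K g) (s : ℝ) :
    K.2 (foldPair g s).1 (foldPair g s).2 :=
  hg.mono _ _ (foldLeft_le_foldRight s)

omit [NormedAddCommGroup E] [InnerProductSpace ℝ E] in
theorem IsMonoStep.foldPair_nested {g : SimpleFunc ℝ E} (hg : IsMonoStep K g) {s s' : ℝ}
    (h : s ≤ s') : K.2 (foldPair g s').1 (foldPair g s).1 ∧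
      K.2 (foldPair g s).2 (foldPair g s').2 :=
  ⟨hg.mono _ _ (foldLeft_antitone h), hg.mono _ _ (foldRight_monotone h)⟩

theorem IsMonoStep.foldStep_mono {g : SimpleFunc ℝ E} (hg : IsMonoStep K g) {s s' : ℝ}
    (h : s ≤ s') : subdivLe K.1 K.2 (foldStep g s) (foldStep g s') := by
  obtain ⟨f, hf, hgf⟩ := hg.face
  exact ⟨_, _, _, _, ⟨f, hf, hgf _, hgf _⟩, ⟨f, hf, hgf _, hgf _⟩, (hg.foldPair_nested h).1,
    hg.foldPair_le s, (hg.foldPair_nested h).2, rfl, rfl⟩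

theorem IsMonoStep.foldStep {g : SimpleFunc ℝ E} (hg : IsMonoStep K g) :
    IsMonoStep (stdSubdiv K) (foldStep g) := by
  obtain ⟨f, hf, hgf⟩ := hg.face
  refine ⟨⟨(ConeApprox.foldStep g).range, ⟨⟨_, SimpleFunc.mem_range_self _ 0⟩, ⟨f, hf, ?_⟩, ?_⟩,
    fun t => SimpleFunc.mem_range_self _ t⟩, fun t t' h => hg.foldStep_mono h⟩
  · intro p hp
    obtain ⟨t, rfl⟩ := SimpleFunc.mem_range.1 hp
    exact ⟨_, hgf _, _, hgf _, hg.foldPair_le t, rfl⟩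
  · intro p hp q hq
    obtain ⟨t, rfl⟩ := SimpleFunc.mem_range.1 hp
    obtain ⟨t', rfl⟩ := SimpleFunc.mem_range.1 hq
    exact (le_total t t').imp hg.foldStep_mono hg.foldStep_mono

theorem IsMonoStep.foldStep_iterate {g : SimpleFunc ℝ E} (hg : IsMonoStep K g) (n : ℕ) :
    IsMonoStep (stdSubdiv^[n] K) (ConeApprox.foldStep^[n] g) := by
  induction n with
  | zero => exact hg
  | succ n ih =>
    rw [Function.iterate_succ_apply', Function.iterate_succ_apply']
    exact ih.foldStep

/-- The step function with value `x` on the first half of the interval and `y` on the second. -/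
noncomputable def twoStep (x y : E) : SimpleFunc ℝ E :=
  (SimpleFunc.const ℝ x).piecewise (Iic (1 / 2)) measurableSet_Iic (SimpleFunc.const ℝ y)

omit [NormedAddCommGroup E] [InnerProductSpace ℝ E] in
theorem twoStep_left {x y : E} {t : ℝ} (h : t ≤ 1 / 2) : twoStep x y t = x := by
  rw [one_div] at h
  simp [twoStep, SimpleFunc.coe_piecewise, Set.piecewise, h]

omit [NormedAddCommGroup E] [InnerProductSpace ℝ E] in
theorem twoStep_right {x y : E} {t : ℝ} (h : 1 / 2 < t) : twoStep x y t = y := by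
  rw [one_div] at h
  simp [twoStep, SimpleFunc.coe_piecewise, Set.piecewise, not_le.2 h]

theorem integral_eq_halves {W : Type*} [NormedAddCommGroup W] [NormedSpace ℝ W] [CompleteSpace W]
    {f : ℝ → W} {a b : W} (ha : ∀ t, t ≤ 1 / 2 → f t = a) (hb : ∀ t, 1 / 2 < t → f t = b) :
    ∫ t in (0 : ℝ)..1, f t = (1 / 2 : ℝ) • (a + b) := by
  have h1 : ∫ t in (0 : ℝ)..1 / 2, f t = (1 / 2 : ℝ) • a := by
    rw [integral_congr_Ioc (by norm_num) (f' := fun _ => a) fun t ht => ha t ht.2]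
    simp
  have h2 : ∫ t in (1 / 2 : ℝ)..1, f t = (1 / 2 : ℝ) • b := by
    rw [integral_congr_Ioc (by norm_num) (f' := fun _ => b) fun t ht => hb t ht.1]
    rw [intervalIntegral.integral_const]
    norm_num
  have hi : ∀ u v : ℝ, IntervalIntegrable f volume u v := by
    have : f = fun t => if beforeStep (1 / 2) t = true then a else b := by
      ext t
      rcases le_or_gt t (1 / 2) with h | h
      · rw [ha t h, if_pos (beforeStep_eq_true_iff.2 h)]
      · rw [hb t h, if_neg (by rw [beforeStep_eq_true_iff]; exact h.not_ge)]
    rw [this]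
    exact fun u v => intervalIntegrable_step (beforeStep (1 / 2))
      (fun c => if c = true then a else b) u v
  rw [← intervalIntegral.integral_add_adjacent_intervals (hi 0 (1 / 2)) (hi (1 / 2) 1), h1, h2,
    smul_add]

/-- In a tame complex the endpoints of an edge are determined by its midpoint. -/
theorem IsTame.midpoint_inj [CompleteSpace E] (hK : IsTame K) {s s' : Finset E} (hs : s ∈ K.1)
    (hs' : s' ∈ K.1) {i j i' j' : E} (hi : i ∈ s) (hj : j ∈ s) (hi' : i' ∈ s') (hj' : j' ∈ s')
    (hij : K.2 i j) (hij' : K.2 i' j') (h : midpoint ℝ i j = midpoint ℝ i' j') :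
    i = i' ∧ j = j' := by
  have hstep : ∀ s ∈ K.1, ∀ i ∈ s, ∀ j ∈ s, K.2 i j →
      IsMonoStep K (twoStep i j) ∧ mean (twoStep i j) = midpoint ℝ i j := by
    intro s hs i hi j hj hij
    refine ⟨⟨⟨s, hs, fun t => ?_⟩, fun t t' htt => ?_⟩, ?_⟩
    · rcases le_or_gt t (1 / 2) with ht | ht
      · rwa [twoStep_left ht]
      · rwa [twoStep_right ht]
    · rcases le_or_gt t' (1 / 2) with ht | ht
      · rw [twoStep_left ht, twoStep_left (htt.trans ht)]
        exact hK.order.refl s hs i hi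
      · rw [twoStep_right ht]
        rcases le_or_gt t (1 / 2) with ht | ht
        · rwa [twoStep_left ht]
        · rw [twoStep_right ht]
          exact hK.order.refl s hs j hj
    · rw [midpoint_eq]
      exact integral_eq_halves (fun t ht => twoStep_left ht) fun t ht => twoStep_right ht
  obtain ⟨h1, h2⟩ := hstep s hs i hi j hj hij
  obtain ⟨h1', h2'⟩ := hstep s' hs' i' hi' j' hj' hij'
  have h3 := hK.unique _ _ h1 h1' (by rw [h2, h2', h])
  unfold stepDist at h3
  rw [integral_eq_halves (a := ind (i ≠ i')) (b := ind (j ≠ j'))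
    (fun t ht => by rw [twoStep_left ht, twoStep_left ht])
    (fun t ht => by rw [twoStep_right ht, twoStep_right ht]), smul_eq_mul] at h3
  have h4 := ind_nonneg (i ≠ i')
  have h5 := ind_nonneg (j ≠ j')
  constructor
  · by_contra hne
    have := ind_pos hne
    linarith
  · by_contra hne
    have := ind_pos hne
    linarith

/-- The order of the standard subdivision is well defined and antisymmetric because the midpoint of
two comparable vertices determines both of them. -/
theorem IsTame.isLocalOrder_stdSubdiv [CompleteSpace E] (hK : IsTame K) :
    IsLocalOrder (stdSubdiv K).1 (stdSubdiv K).2 := by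
  have hle : ∀ {p q : E}, subdivLe K.1 K.2 p q → ∃ s ∈ K.1, ∃ t ∈ K.1, ∃ i ∈ s, ∃ j ∈ s,
      ∃ k ∈ t, ∃ l ∈ t, K.2 k i ∧ K.2 i j ∧ K.2 j l ∧ K.2 k l ∧
        p = midpoint ℝ i j ∧ q = midpoint ℝ k l := by
    rintro p q ⟨i, j, k, l, ⟨s, hs, hi, hj⟩, ⟨t, ht, hk, hl⟩, h1, h2, h3, h4, h5⟩
    exact ⟨s, hs, t, ht, i, hi, j, hj, k, hk, l, hl, h1, h2, h3,
      hK.order.trans t ht s hs t ht k hk j hj l hl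
        (hK.order.trans t ht s hs s hs k hk i hi j hj h1 h2) h3, h4, h5⟩
  constructor
  · rintro t ⟨-, ⟨s, hs, hts⟩, -⟩ v hv
    obtain ⟨i, hi, j, hj, hij, rfl⟩ := hts v hv
    exact ⟨i, j, i, j, ⟨s, hs, hi, hj⟩, ⟨s, hs, hi, hj⟩, hK.order.refl s hs i hi, hij,
      hK.order.refl s hs j hj, rfl, rfl⟩
  · rintro - - - - v - w - hvw hwv
    obtain ⟨s, hs, t, ht, i, hi, j, hj, k, hk, l, hl, h1, h2, h3, h4, rfl, rfl⟩ := hle hvw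
    obtain ⟨s', hs', t', ht', i', hi', j', hj', k', hk', l', hl', h1', h2', h3', h4', e1, e2⟩ :=
      hle hwv
    obtain ⟨rfl, rfl⟩ := hK.midpoint_inj ht hs' hk hl hi' hj' h4 h2' e1
    obtain ⟨rfl, rfl⟩ := hK.midpoint_inj hs ht' hi hj hk' hl' h2 h4' e2
    rw [hK.order.antisymm s hs t ht i hi k hk h1' h1, hK.order.antisymm s hs t ht j hj l hl h3 h3']
  · rintro - - - - - - u - v - w - huv hvw
    obtain ⟨s, hs, t, ht, i, hi, j, hj, k, hk, l, hl, h1, h2, h3, h4, rfl, rfl⟩ := hle huv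
    obtain ⟨s', hs', t', ht', i', hi', j', hj', k', hk', l', hl', h1', h2', h3', h4', e1, rfl⟩ :=
      hle hvw
    obtain ⟨rfl, rfl⟩ := hK.midpoint_inj ht hs' hk hl hi' hj' h4 h2' e1
    exact ⟨i, j, k', l', ⟨s, hs, hi, hj⟩, ⟨t', ht', hk', hl'⟩,
      hK.order.trans t' ht' t ht s hs _ hk' _ hk _ hi h1' h1, h2,
      hK.order.trans s hs t ht t' ht' _ hj _ hl _ hl' h3 h3', rfl, rfl⟩
  · rintro t ⟨-, -, ht⟩ v hv w hw
    exact ht v hv w hw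

/-- A monotone step function in the standard subdivision is, almost everywhere, the folding of a
monotone step function: on the first half of the interval the unfolded function runs backwards
through the lower ends of the edges of which the values are the midpoints, and on the second half
it runs through the upper ends. -/
theorem IsTame.exists_unfold [CompleteSpace E] (hK : IsTame K) {γ : SimpleFunc ℝ E}
    (hγ : IsMonoStep (stdSubdiv K) γ) : ∃ g, IsMonoStep K g ∧ ∀ t, 0 < t → foldStep g t = γ t := by
  obtain ⟨f, ⟨-, ⟨s, hs, hfs⟩, -⟩, hγf⟩ := hγ.face
  choose! i hi j hj hij hmid using hfs
  have hle : ∀ t t', t ≤ t' → K.2 (i (γ t')) (i (γ t)) ∧ K.2 (j (γ t)) (j (γ t')) := by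
    intro t t' htt
    obtain ⟨i', j', k', l', ⟨s', hs', hi', hj'⟩, ⟨t₁, ht₁, hk', hl'⟩, h1, h2, h3, h4, h5⟩ :=
      hγ.mono t t' htt
    have hkl : K.2 k' l' := hK.order.trans t₁ ht₁ s' hs' t₁ ht₁ _ hk' _ hj' _ hl'
      (hK.order.trans t₁ ht₁ s' hs' s' hs' _ hk' _ hi' _ hj' h1 h2) h3
    obtain ⟨e1, e2⟩ := hK.midpoint_inj hs hs' (hi _ (hγf t)) (hj _ (hγf t)) hi' hj'
      (hij _ (hγf t)) h2 ((hmid _ (hγf t)).symm.trans h4)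
    obtain ⟨e3, e4⟩ := hK.midpoint_inj hs ht₁ (hi _ (hγf t')) (hj _ (hγf t')) hk' hl'
      (hij _ (hγf t')) hkl ((hmid _ (hγf t')).symm.trans h5)
    rw [e1, e2, e3, e4]
    exact ⟨h1, h3⟩
  have htr := fun u hu v hv w hw => hK.order.trans s hs s hs s hs u hu v hv w hw
  let g : SimpleFunc ℝ E := ((γ.map i).comp (fun t => 1 - 2 * t) (by fun_prop)).piecewise
    (Iic (1 / 2)) measurableSet_Iic ((γ.map j).comp (fun t => 2 * t - 1) (by fun_prop))
  have hg1 : ∀ t, t ≤ 1 / 2 → g t = i (γ (1 - 2 * t)) := fun t ht => by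
    rw [one_div] at ht
    simp [g, SimpleFunc.coe_piecewise, Set.piecewise, ht]
  have hg2 : ∀ t, 1 / 2 < t → g t = j (γ (2 * t - 1)) := fun t ht => by
    rw [one_div] at ht
    simp [g, SimpleFunc.coe_piecewise, Set.piecewise, not_le.2 ht]
  refine ⟨g, ⟨⟨s, hs, fun t => ?_⟩, fun t t' htt => ?_⟩, fun t ht => ?_⟩
  · rcases le_or_gt t (1 / 2) with h | h
    · rw [hg1 t h]; exact hi _ (hγf _)
    · rw [hg2 t h]; exact hj _ (hγf _)
  · rcases le_or_gt t' (1 / 2) with h | h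
    · rw [hg1 t' h, hg1 t (htt.trans h)]
      exact (hle _ _ (by linarith)).1
    · rw [hg2 t' h]
      rcases le_or_gt t (1 / 2) with h' | h'
      · rw [hg1 t h']
        rcases le_total (1 - 2 * t) (2 * t' - 1) with h'' | h''
        · exact htr _ (hi _ (hγf _)) _ (hj _ (hγf _)) _ (hj _ (hγf _)) (hij _ (hγf _))
            (hle _ _ h'').2
        · exact htr _ (hi _ (hγf _)) _ (hi _ (hγf _)) _ (hj _ (hγf _)) (hle _ _ h'').1
            (hij _ (hγf _))
      · rw [hg2 t h']
        exact (hle _ _ (by linarith)).2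
  · rw [foldStep_apply, foldPair_apply, max_eq_left ht.le]
    simp only
    rw [hg1 _ (by linarith), hg2 _ (by linarith)]
    have e1 : 1 - 2 * ((1 - t) / 2) = t := by ring
    have e2 : 2 * ((1 + t) / 2) - 1 = t := by ring
    rw [e1, e2]
    exact (hmid _ (hγf t)).symm

/-- Uniqueness of the representing monotone step function passes to the standard subdivision: every
monotone step function there is obtained by folding one for the given complex, and folding
preserves the mean value. -/
theorem IsTame.stdSubdiv [CompleteSpace E] (hK : IsTame K) : IsTame (stdSubdiv K) := by
  refine ⟨hK.isLocalOrder_stdSubdiv, fun γ γ' hγ hγ' hmean => ?_⟩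
  obtain ⟨g, hg, hfg⟩ := hK.exists_unfold hγ
  obtain ⟨g', hg', hfg'⟩ := hK.exists_unfold hγ'
  have e1 : mean (ConeApprox.foldStep g) = mean γ :=
    integral_congr_Ioc zero_le_one fun t ht => hfg t ht.1
  have e2 : mean (ConeApprox.foldStep g') = mean γ' :=
    integral_congr_Ioc zero_le_one fun t ht => hfg' t ht.1
  rw [mean_foldStep] at e1 e2
  have h0 := hK.unique g g' hg hg' (by rw [e1, e2, hmean])
  have h1 : stepDist γ γ' = stepDist (ConeApprox.foldStep g) (ConeApprox.foldStep g') :=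
    integral_congr_Ioc zero_le_one fun t ht => by rw [hfg t ht.1, hfg' t ht.1]
  refine le_antisymm ?_ (stepDist_nonneg _ _)
  rw [h1]
  have := stepDist_foldStep_le g g'
  rwa [h0, mul_zero] at this

theorem IsTame.stdSubdiv_iterate [CompleteSpace E] (hK : IsTame K) (n : ℕ) :
    IsTame (ConeApprox.stdSubdiv^[n] K) := by
  induction n with
  | zero => exact hK
  | succ n ih =>
    rw [Function.iterate_succ_apply']
    exact ih.stdSubdiv

/-- Iterated subdivision refines the given complex. -/
theorem exists_face_of_stdSubdiv_iterate {F : Set (Finset E)} {le : E → E → Prop} (n : ℕ) :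
    ∀ s ∈ (stdSubdiv^[n] (F, le)).1, ∃ σ ∈ F, (s : Set E) ⊆ convexHull ℝ (σ : Set E) := by
  induction n with
  | zero => exact fun s hs => ⟨s, hs, subset_convexHull ℝ _⟩
  | succ n ih =>
    rw [Function.iterate_succ_apply']
    rintro t ⟨-, ⟨s, hs, hts⟩, -⟩
    obtain ⟨σ, hσ, hsσ⟩ := ih s hs
    refine ⟨σ, hσ, fun p hp => ?_⟩
    obtain ⟨i, hi, j, hj, -, rfl⟩ := hts p hp
    exact (convex_convexHull ℝ _).midpoint_mem (hsσ hi) (hsσ hj)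

theorem foldStep_iterate_mem {C : Set E} (hC : Convex ℝ C) {g : SimpleFunc ℝ E}
    (hg : ∀ t, g t ∈ C) (n : ℕ) (t : ℝ) : foldStep^[n] g t ∈ C := by
  induction n generalizing t with
  | zero => exact hg t
  | succ n ih =>
    rw [Function.iterate_succ_apply']
    exact hC.midpoint_mem (ih _) (ih _)

/-- The variation of `g` along the parameter is at most `c`, as witnessed by a monotone
function. -/
def VariationLE (g : SimpleFunc ℝ E) (c : ℝ) : Prop :=
  ∃ ν : ℝ → ℝ, Monotone ν ∧ (∀ t t', t ≤ t' → ‖g t - g t'‖ ≤ ν t' - ν t) ∧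
    ∀ t t', t ≤ t' → ν t' - ν t ≤ c

/-- Folding halves the variation, since averaging the two branches halves the increments and the
two branches run through the parameter interval only once altogether. -/
theorem VariationLE.foldStep {g : SimpleFunc ℝ E} {c : ℝ} (h : VariationLE g c) :
    VariationLE (foldStep g) (c / 2) := by
  obtain ⟨ν, hν, hgν, hc⟩ := h
  refine ⟨fun s => (ν ((1 + max s 0) / 2) - ν ((1 - max s 0) / 2)) / 2, fun s s' h => ?_,
    fun s s' h => ?_, fun s s' h => ?_⟩
  · have h1 := hν (foldLeft_antitone h)
    have h2 := hν (foldRight_monotone h)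
    simp only
    linarith
  · have h1 := hgν _ _ (foldLeft_antitone h)
    have h2 := hgν _ _ (foldRight_monotone h)
    rw [foldStep_apply, foldStep_apply, midpoint_eq, midpoint_eq, ← smul_sub, norm_smul,
      foldPair_apply, foldPair_apply, Real.norm_of_nonneg (by norm_num), add_sub_add_comm]
    have h3 := norm_add_le (g ((1 - max s 0) / 2) - g ((1 - max s' 0) / 2))
      (g ((1 + max s 0) / 2) - g ((1 + max s' 0) / 2))
    rw [norm_sub_rev (g ((1 - max s 0) / 2))] at h3
    simp only
    linarith
  · have h1 := hν (foldLeft_le_foldRight s)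
    have h2 := hc _ _ (foldLeft_le_foldRight s')
    simp only
    linarith

theorem VariationLE.foldStep_iterate {g : SimpleFunc ℝ E} {c : ℝ} (h : VariationLE g c) (n : ℕ) :
    VariationLE (ConeApprox.foldStep^[n] g) (c / 2 ^ n) := by
  induction n with
  | zero => simpa using h
  | succ n ih =>
    rw [Function.iterate_succ_apply', pow_succ, ← div_div]
    exact ih.foldStep

omit [InnerProductSpace ℝ E] in
theorem VariationLE.norm_sub_le {g : SimpleFunc ℝ E} {c : ℝ} (h : VariationLE g c) (t t' : ℝ) :
    ‖g t - g t'‖ ≤ c := by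
  obtain ⟨ν, -, hg, hc⟩ := h
  rcases le_total t t' with h | h
  · exact (hg t t' h).trans (hc t t' h)
  · rw [norm_sub_rev]
    exact (hg t' t h).trans (hc t' t h)

theorem VariationLE.norm_sub_mean_le [CompleteSpace E] {g : SimpleFunc ℝ E} {c : ℝ}
    (h : VariationLE g c) (t : ℝ) : ‖g t - mean g‖ ≤ c := by
  have h1 : g t - mean g = ∫ s in (0 : ℝ)..1, (g t - g s) := by
    rw [intervalIntegral.integral_sub (intervalIntegrable_step g (fun _ => g t) 0 1)
      (intervalIntegrable_step g (fun x => x) 0 1)]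
    simp [mean]
  rw [h1]
  refine (intervalIntegral.norm_integral_le_of_norm_le_const fun s _ => h.norm_sub_le t s).trans ?_
  simp

variable {X : Geometry.SimplicialComplex ℝ E} {le : E → E → Prop}

/-- Every point of a simplex is the mean value of a monotone step function in this simplex. -/
theorem exists_isMonoStep [CompleteSpace E] (hle : IsLocalOrder X.faces le) {σ : Finset E}
    (hσ : σ ∈ X.faces) {x : E} (hx : x ∈ convexHull ℝ (σ : Set E)) :
    ∃ g, IsMonoStep (X.faces, le) g ∧ (∀ t, g t ∈ σ) ∧ mean g = x := by
  obtain ⟨w, hw0, hw1, rfl⟩ := Finset.mem_convexHull'.1 hx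
  obtain ⟨g, hg, hm, hl⟩ := exists_quantile_law (le := le) w σ hw0 hw1 (hle.total σ hσ)
    fun u hu v hv w hw => hle.trans σ hσ σ hσ σ hσ u hu v hv w hw
  refine ⟨g, ⟨⟨σ, hσ, hg⟩, hm⟩, hg, ?_⟩
  refine (integral_step_eq_sum_law hg fun x => x).trans (Finset.sum_congr rfl fun v hv => ?_)
  rw [hl v hv]

/-- The representing monotone step function depends on the point in a Lipschitz way, since its law,
the barycentric coordinates, does. -/
theorem exists_stepDist_le [CompleteSpace E] (hX : X.faces.Finite)
    (hle : IsLocalOrder X.faces le) :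
    ∃ C : ℝ, 0 ≤ C ∧ ∀ g g', IsMonoStep (X.faces, le) g → IsMonoStep (X.faces, le) g' →
      stepDist g g' ≤ C * ‖mean g - mean g'‖ := by
  classical
  obtain ⟨C, hC, hlip⟩ := exists_cone_weights_lipschitz hX
  set V := vertexFinset hX
  refine ⟨(V.card + 1) * (V.card * C), by positivity, fun g g' hg hg' => ?_⟩
  obtain ⟨σ, hσ, hgσ⟩ := hg.face
  obtain ⟨τ, hτ, hgτ⟩ := hg'.face
  have hmem : ∀ u ∈ σ ∪ τ, ∃ ρ ∈ X.faces, u ∈ ρ := fun u hu =>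
    (Finset.mem_union.1 hu).elim (fun h => ⟨σ, hσ, h⟩) fun h => ⟨τ, hτ, h⟩
  refine (stepDist_le_of_monotone (le := le) hgσ hgτ (subset_vertexFinset hX hσ)
    (subset_vertexFinset hX hτ) hg.mono hg'.mono ?_ (hle.total τ hτ)
    (fun u hu v hv => hle.antisymm τ hτ τ hτ u hu v hv)).trans ?_
  · intro u hu v hv w hw
    obtain ⟨r, hr, hu⟩ := hmem u hu
    obtain ⟨s, hs, hv⟩ := hmem v hv
    obtain ⟨t, ht, hw⟩ := hmem w hw
    exact hle.trans r hr s hs t ht u hu v hv w hw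
  · rw [mul_assoc]
    refine mul_le_mul_of_nonneg_left ?_ (by positivity)
    have hpt : ∀ g : SimpleFunc ℝ E, ∀ σ : Finset E, (∀ t, g t ∈ σ) →
        ∑ v ∈ σ, law g v • (conePoint 1 v : ConeSpace E) = conePoint 1 (mean g) := by
      intro g σ hgσ
      refine ConeSpace.ext ?_ ?_
      · simp only [fst_sum, WithLp.smul_fst, conePoint_fst, one_smul]
        exact (integral_step_eq_sum_law hgσ fun x => x).symm
      · simpa [snd_sum] using sum_law hgσ
    have hterm : ∀ v ∈ V, |law g v - law g' v| ≤ C * ‖mean g - mean g'‖ := by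
      intro v _
      refine (hlip σ hσ τ hτ (law g) (law g') (law_nonneg g) (law_nonneg g')
        (fun v hv => law_eq_zero fun t h => hv (h ▸ hgσ t))
        (fun v hv => law_eq_zero fun t h => hv (h ▸ hgτ t)) v).trans ?_
      rw [hpt g σ hgσ, hpt g' τ hgτ, dist_eq_norm]
      refine mul_le_mul_of_nonneg_left ((norm_conePoint_sub_le _ _ _ _).trans ?_) hC
      simp
    refine (Finset.sum_le_sum hterm).trans ?_
    rw [Finset.sum_const, nsmul_eq_mul, mul_assoc]

theorem isTame_simplicialComplex [CompleteSpace E] (hX : X.faces.Finite)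
    (hle : IsLocalOrder X.faces le) : IsTame (X.faces, le) := by
  refine ⟨hle, fun g g' hg hg' h => le_antisymm ?_ (stepDist_nonneg g g')⟩
  obtain ⟨C, -, hC⟩ := exists_stepDist_le hX hle
  simpa [h] using hC g g' hg hg'

/-- A monotone step function with values in a simplex jumps at most as often as the simplex has
vertices, which bounds its variation; the jumps are counted by the size of the initial segments
of the simplex below its values. -/
theorem exists_variationLE (hX : X.faces.Finite) (hle : IsLocalOrder X.faces le) :
    ∃ c : ℝ, 0 ≤ c ∧ ∀ g, IsMonoStep (X.faces, le) g → VariationLE g c := by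
  classical
  set V := vertexFinset hX
  set R := ∑ v ∈ V, ‖v‖
  have hR : 0 ≤ R := by positivity
  refine ⟨2 * R * V.card, by positivity, fun g hg => ?_⟩
  obtain ⟨σ, hσ, hgσ⟩ := hg.face
  have hVσ := subset_vertexFinset hX hσ
  have hbound : ∀ t, ‖g t‖ ≤ R := fun t =>
    Finset.single_le_sum (f := fun v : E => ‖v‖) (fun _ _ => norm_nonneg _) (hVσ (hgσ t))
  let N : ℝ → Finset E := fun t => σ.filter fun p => le p (g t)
  have hN : ∀ t t', t ≤ t' → N t ⊆ N t' := fun t t' h p hp => by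
    simp only [N, Finset.mem_filter] at hp ⊢
    exact ⟨hp.1, hle.trans σ hσ σ hσ σ hσ p hp.1 _ (hgσ t) _ (hgσ t') hp.2 (hg.mono t t' h)⟩
  refine ⟨fun t => 2 * R * (N t).card, fun t t' h => ?_, fun t t' h => ?_, fun t t' h => ?_⟩
  · exact mul_le_mul_of_nonneg_left (by exact_mod_cast Finset.card_le_card (hN t t' h))
      (by positivity)
  · rw [← mul_sub]
    by_cases heq : g t = g t'
    · have : ((N t).card : ℝ) ≤ (N t').card := by exact_mod_cast Finset.card_le_card (hN t t' h)
      rw [heq, sub_self, norm_zero]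
      exact mul_nonneg (by positivity) (by linarith)
    · have hss : N t ⊂ N t' := by
        refine Finset.ssubset_iff_subset_ne.2 ⟨hN t t' h, fun hne => heq ?_⟩
        have h1 : g t' ∈ N t' := Finset.mem_filter.2 ⟨hgσ t', hle.refl σ hσ _ (hgσ t')⟩
        rw [← hne] at h1
        exact hle.antisymm σ hσ σ hσ _ (hgσ t) _ (hgσ t') (hg.mono t t' h)
          (Finset.mem_filter.1 h1).2
      have : ((N t).card : ℝ) + 1 ≤ (N t').card := by exact_mod_cast Finset.card_lt_card hss
      have h2 := norm_sub_le (g t) (g t')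
      have h3 := hbound t
      have h4 := hbound t'
      nlinarith
  · have h1 : ((N t').card : ℝ) ≤ V.card := by
      exact_mod_cast Finset.card_le_card ((Finset.filter_subset _ _).trans hVσ)
    have h2 : (0 : ℝ) ≤ (N t).card := by positivity
    simp only
    nlinarith

end Subdivision

/-! ### The weights of a point in a slab of the cone -/

section Slab

open MeasureTheory

variable {E : Type*} [NormedAddCommGroup E] [InnerProductSpace ℝ E]
variable {W : Type*} [NormedAddCommGroup W] [NormedSpace ℝ W]

/-- The proportion of the base of a point at height `h` which is carried by the vertices at
height `k`. -/
noncomputable def slabBreak (k : ℕ) (h : ℝ) : ℝ := k * (k + 1 - h) / h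

/-- The value of a function on vertices at one parameter of a point of the slab: a pair `(x, y)` in
the lower part stands for the vertices over `x` and `y` at height `k`, and in the upper part for
the vertex over the midpoint at height `k + 1`. -/
noncomputable def slabEval (k : ℕ) (h : ℝ) (φ : ConeSpace E → W) (x : Bool × (E × E)) : W :=
  if x.1 = true then
    (h / k) • (1 / 2 : ℝ) • (φ (conePoint k x.2.1) + φ (conePoint k x.2.2))
  else (h / (k + 1)) • φ (conePoint (k + 1) (midpoint ℝ x.2.1 x.2.2))

open Classical in
/-- The vertices which matter for `slabEval`. -/
noncomputable def slabPts (k : ℕ) (x : Bool × (E × E)) : Finset (ConeSpace E) :=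
  if x.1 = true then {conePoint k x.2.1, conePoint k x.2.2}
  else {conePoint (k + 1) (midpoint ℝ x.2.1 x.2.2)}

/-- A step function with values in pairs, together with the cut between the lower and the upper
part. -/
noncomputable def slabStep (k : ℕ) (h : ℝ) (Γ : SimpleFunc ℝ (E × E)) :
    SimpleFunc ℝ (Bool × (E × E)) :=
  (beforeStep (slabBreak k h)).pair Γ

/-- The integral of a function on vertices with respect to the weights which a step function with
values in pairs defines at height `h` of the `k`-th slab. -/
noncomputable def slabLaw (k : ℕ) (h : ℝ) (Γ : SimpleFunc ℝ (E × E)) (φ : ConeSpace E → W) : W :=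
  ∫ t in (0 : ℝ)..1, slabEval k h φ (slabStep k h Γ t)

omit [NormedAddCommGroup E] [InnerProductSpace ℝ E] in
theorem slabStep_apply (k : ℕ) (h : ℝ) (Γ : SimpleFunc ℝ (E × E)) (t : ℝ) :
    slabStep k h Γ t = (beforeStep (slabBreak k h) t, Γ t) := rfl

theorem slabBreak_mem {k : ℕ} (hk : 1 ≤ k) {h : ℝ} (h0 : k ≤ h) (h1 : h ≤ k + 1) :
    0 ≤ slabBreak k h ∧ slabBreak k h ≤ 1 := by
  have hk' : (1 : ℝ) ≤ k := by exact_mod_cast hk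
  have hh : 0 < h := by linarith
  refine ⟨div_nonneg (mul_nonneg (by linarith) (by linarith)) hh.le, ?_⟩
  unfold slabBreak
  rw [div_le_one hh]
  nlinarith

theorem abs_slabBreak_sub_le {k : ℕ} (hk : 1 ≤ k) {h h' : ℝ} (h0 : k ≤ h) (h0' : k ≤ h') :
    |slabBreak k h - slabBreak k h'| ≤ 2 * |h - h'| := by
  have hk' : (1 : ℝ) ≤ k := by exact_mod_cast hk
  have hh : 0 < h := by linarith
  have hh' : 0 < h' := by linarith
  have e : slabBreak k h - slabBreak k h' = k * (k + 1) / (h * h') * (h' - h) := by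
    unfold slabBreak
    field_simp
    ring
  rw [e, abs_mul, abs_of_nonneg (by positivity), abs_sub_comm h' h]
  refine mul_le_mul_of_nonneg_right ?_ (abs_nonneg _)
  rw [div_le_iff₀ (by positivity)]
  have h1 : (k : ℝ) * k ≤ h * h' := mul_le_mul h0 h0' (by linarith) hh.le
  nlinarith

open Classical in
theorem slabEval_eq_sum {k : ℕ} {h : ℝ} {x : Bool × (E × E)} {t : Finset (ConeSpace E)}
    (hx : slabPts k x ⊆ t) (φ : ConeSpace E → W) :
    slabEval k h φ x = ∑ p ∈ t, slabEval k h (fun q => ind (q = p)) x • φ p := by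
  have key : ∀ q ∈ t, φ q = ∑ p ∈ t, ind (q = p) • φ p := fun q hq => by
    rw [Finset.sum_eq_single_of_mem q hq fun p _ hp => by rw [ind_neg hp.symm, zero_smul],
      ind_pos rfl, one_smul]
  obtain ⟨b, x, y⟩ := x
  cases b
  · simp only [slabPts, slabEval, Bool.false_eq_true, if_false, Finset.singleton_subset_iff,
      smul_eq_mul, mul_smul] at hx ⊢
    rw [← Finset.smul_sum, ← key _ hx]
  · simp only [slabPts, slabEval, if_true, Finset.insert_subset_iff,
      Finset.singleton_subset_iff, smul_eq_mul, mul_smul, add_smul] at hx ⊢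
    rw [← Finset.smul_sum, ← Finset.smul_sum, Finset.sum_add_distrib, ← key _ hx.1,
      ← key _ hx.2]

theorem slabEval_nonneg {k : ℕ} {h : ℝ} (hh : 0 ≤ h) {φ : ConeSpace E → ℝ} (hφ : ∀ p, 0 ≤ φ p)
    (x : Bool × (E × E)) : 0 ≤ slabEval k h φ x := by
  unfold slabEval
  split_ifs
  · have h1 := hφ (conePoint k x.2.1)
    have h2 := hφ (conePoint k x.2.2)
    simp only [smul_eq_mul]
    positivity
  · have h1 := hφ (conePoint (k + 1) (midpoint ℝ x.2.1 x.2.2))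
    simp only [smul_eq_mul]
    positivity

theorem slabLaw_eq_sum [CompleteSpace W] {k : ℕ} {h : ℝ} {Γ : SimpleFunc ℝ (E × E)}
    {t : Finset (ConeSpace E)} (ht : ∀ u, slabPts k (slabStep k h Γ u) ⊆ t)
    (φ : ConeSpace E → W) :
    slabLaw k h Γ φ = ∑ p ∈ t, slabLaw k h Γ (fun q => ind (q = p)) • φ p := by
  unfold slabLaw
  simp_rw [← intervalIntegral.integral_smul_const]
  rw [← intervalIntegral.integral_finsetSum fun p _ => intervalIntegrable_step (slabStep k h Γ)
    (fun x => slabEval k h (fun q => ind (q = p)) x • φ p) 0 1]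
  congr 1
  ext u
  exact slabEval_eq_sum (ht u) φ

theorem slabLaw_nonneg {k : ℕ} {h : ℝ} (hh : 0 ≤ h) (Γ : SimpleFunc ℝ (E × E))
    {φ : ConeSpace E → ℝ} (hφ : ∀ p, 0 ≤ φ p) : 0 ≤ slabLaw k h Γ φ :=
  intervalIntegral.integral_nonneg zero_le_one fun _ _ => slabEval_nonneg hh hφ _

theorem slabLaw_one {k : ℕ} (hk : 1 ≤ k) {h : ℝ} (h0 : k ≤ h) (h1 : h ≤ k + 1)
    (Γ : SimpleFunc ℝ (E × E)) : slabLaw k h Γ (fun _ => (1 : ℝ)) = 1 := by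
  have hk' : (1 : ℝ) ≤ k := by exact_mod_cast hk
  have hh : 0 < h := by linarith
  have e : ∀ t, slabEval k h (fun _ => (1 : ℝ)) (slabStep k h Γ t) =
      (h / k - h / (k + 1)) * ind (beforeStep (slabBreak k h) t = true) + h / (k + 1) := by
    intro t
    by_cases hb : beforeStep (slabBreak k h) t = true
    · simp only [slabEval, slabStep_apply, hb, if_true, ind_true, smul_eq_mul]
      ring
    · simp [slabEval, slabStep_apply, hb]
  unfold slabLaw
  simp_rw [e]
  rw [intervalIntegral.integral_add (intervalIntegrable_step (beforeStep (slabBreak k h))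
      (fun b => (h / k - h / (k + 1)) * ind (b = true)) 0 1)
    (intervalIntegrable_step (beforeStep (slabBreak k h)) (fun _ => h / ((k : ℝ) + 1)) 0 1),
    intervalIntegral.integral_const_mul]
  change (h / k - h / (k + 1)) * law (beforeStep (slabBreak k h)) true + _ = 1
  obtain ⟨hb0, hb1⟩ := slabBreak_mem hk h0 h1
  rw [integral_beforeStep hb0 hb1, intervalIntegral.integral_const, slabBreak, sub_zero, one_smul]
  field_simp
  ring

theorem norm_slabEval_le {k : ℕ} (hk : 1 ≤ k) {h : ℝ} (h0 : k ≤ h) (h1 : h ≤ k + 1)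
    {φ : ConeSpace E → W} {R : ℝ} (hφ : ∀ p, ‖φ p‖ ≤ R) (x : Bool × (E × E)) :
    ‖slabEval k h φ x‖ ≤ 2 * R := by
  have hk' : (1 : ℝ) ≤ k := by exact_mod_cast hk
  have hR : 0 ≤ R := (norm_nonneg _).trans (hφ 0)
  unfold slabEval
  split_ifs
  · rw [norm_smul, norm_smul, Real.norm_of_nonneg (by positivity : (0 : ℝ) ≤ 1 / 2),
      Real.norm_of_nonneg (div_nonneg (by linarith) (by linarith))]
    have h2 : h / k ≤ 2 := by rw [div_le_iff₀ (by linarith)]; linarith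
    have h3 : 1 / 2 * ‖φ (conePoint k x.2.1) + φ (conePoint k x.2.2)‖ ≤ R := by
      have := norm_add_le (φ (conePoint k x.2.1)) (φ (conePoint k x.2.2))
      linarith [hφ (conePoint k x.2.1), hφ (conePoint k x.2.2)]
    exact mul_le_mul h2 h3 (by positivity) (by norm_num)
  · rw [norm_smul, Real.norm_of_nonneg (div_nonneg (by linarith) (by linarith))]
    have h2 : h / (k + 1) ≤ 2 := by rw [div_le_iff₀ (by linarith)]; linarith
    exact mul_le_mul h2 (hφ _) (norm_nonneg _) (by norm_num)

theorem norm_slabEval_sub_le {k : ℕ} (hk : 1 ≤ k) (h h' : ℝ) {φ : ConeSpace E → W} {R : ℝ}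
    (hφ : ∀ p, ‖φ p‖ ≤ R) (x : Bool × (E × E)) :
    ‖slabEval k h φ x - slabEval k h' φ x‖ ≤ |h - h'| * R := by
  have hk' : (1 : ℝ) ≤ k := by exact_mod_cast hk
  have hR : 0 ≤ R := (norm_nonneg _).trans (hφ 0)
  unfold slabEval
  split_ifs
  · rw [← sub_smul, norm_smul, norm_smul, Real.norm_of_nonneg (by positivity : (0 : ℝ) ≤ 1 / 2),
      ← sub_div, Real.norm_eq_abs, abs_div, abs_of_nonneg (by linarith : (0 : ℝ) ≤ k)]
    have h2 : |h - h'| / k ≤ |h - h'| := div_le_self (abs_nonneg _) hk'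
    have h3 : 1 / 2 * ‖φ (conePoint k x.2.1) + φ (conePoint k x.2.2)‖ ≤ R := by
      have := norm_add_le (φ (conePoint k x.2.1)) (φ (conePoint k x.2.2))
      linarith [hφ (conePoint k x.2.1), hφ (conePoint k x.2.2)]
    exact mul_le_mul h2 h3 (by positivity) (abs_nonneg _)
  · rw [← sub_smul, norm_smul, ← sub_div, Real.norm_eq_abs, abs_div,
      abs_of_nonneg (by linarith : (0 : ℝ) ≤ k + 1)]
    have h2 : |h - h'| / (k + 1) ≤ |h - h'| := div_le_self (abs_nonneg _) (by linarith)
    exact mul_le_mul h2 (hφ _) (norm_nonneg _) (abs_nonneg _)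

theorem norm_slabLaw_sub_le {k : ℕ} (hk : 1 ≤ k) {h h' : ℝ} (h0 : k ≤ h) (h1 : h ≤ k + 1)
    (h0' : k ≤ h') (h1' : h' ≤ k + 1) (Γ Γ' : SimpleFunc ℝ (E × E)) {φ : ConeSpace E → W} {R : ℝ}
    (hφ : ∀ p, ‖φ p‖ ≤ R) :
    ‖slabLaw k h Γ φ - slabLaw k h' Γ' φ‖ ≤ R * (9 * |h - h'| + 4 * stepDist Γ Γ') := by
  have hR : 0 ≤ R := (norm_nonneg _).trans (hφ 0)
  obtain ⟨hb0, hb1⟩ := slabBreak_mem hk h0 h1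
  obtain ⟨hb0', hb1'⟩ := slabBreak_mem hk h0' h1'
  have e1 := norm_integral_step_sub_le (slabStep k h Γ) (slabStep k h' Γ')
    (norm_slabEval_le hk h0 h1 hφ) (norm_slabEval_le hk h0' h1' hφ)
    (norm_slabEval_sub_le hk h h' hφ)
  have e2 : stepDist (slabStep k h Γ) (slabStep k h' Γ') ≤ 2 * |h - h'| + stepDist Γ Γ' :=
    (stepDist_pair_le _ _ _ _).trans (add_le_add
      ((stepDist_beforeStep_le hb0 hb1 hb0' hb1').trans (abs_slabBreak_sub_le hk h0 h0')) le_rfl)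
  have e3 := mul_le_mul_of_nonneg_left e2 hR
  refine e1.trans ?_
  linarith

/-- The step function with values in pairs which describes, in the `k`-th slab, the point of the
base given by `g`: in a slab with a product triangulation the pairs are degenerate, and in a slab
in which the base is subdivided they come from folding once more. -/
noncomputable def slabPair (k : ℕ) (g : SimpleFunc ℝ E) : SimpleFunc ℝ (E × E) :=
  if Nat.log 2 (k + 1) = Nat.log 2 k then (foldStep^[Nat.log 2 k] g).map fun x => (x, x)
  else foldPair (foldStep^[Nat.log 2 k] g)

theorem stepDist_slabPair_le (k : ℕ) (g g' : SimpleFunc ℝ E) :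
    stepDist (slabPair k g) (slabPair k g') ≤ 2 * 2 ^ Nat.log 2 k * stepDist g g' := by
  have h1 := stepDist_foldStep_iterate_le g g' (Nat.log 2 k)
  have h2 := stepDist_nonneg (foldStep^[Nat.log 2 k] g) (foldStep^[Nat.log 2 k] g')
  unfold slabPair
  split_ifs
  · have := stepDist_map_le (fun x : E => (x, x)) (foldStep^[Nat.log 2 k] g)
      (foldStep^[Nat.log 2 k] g')
    linarith
  · have := stepDist_foldPair_le (foldStep^[Nat.log 2 k] g) (foldStep^[Nat.log 2 k] g')
    linarith

theorem slabLaw_congr {k : ℕ} {h : ℝ} {g g' : SimpleFunc ℝ E} (hg : stepDist g g' = 0)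
    (φ : ConeSpace E → W) : slabLaw k h (slabPair k g) φ = slabLaw k h (slabPair k g') φ := by
  refine integral_eq_of_stepDist_eq_zero (le_antisymm ?_ (stepDist_nonneg _ _)) _
  refine (stepDist_pair_le _ _ _ _).trans ?_
  have h1 := stepDist_slabPair_le k g g'
  have h2 : stepDist (beforeStep (slabBreak k h)) (beforeStep (slabBreak k h)) = 0 := by
    simp [stepDist]
  rw [hg, mul_zero] at h1
  linarith

theorem log_succ_of_ne {k : ℕ} (h : Nat.log 2 (k + 1) ≠ Nat.log 2 k) :
    Nat.log 2 (k + 1) = Nat.log 2 k + 1 := by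
  have h1 : Nat.log 2 k ≤ Nat.log 2 (k + 1) := Nat.log_mono_right (Nat.le_succ k)
  have h2 : k + 1 ≤ 2 ^ (Nat.log 2 k + 1) := Nat.lt_pow_succ_log_self (by norm_num) k
  have h3 : Nat.log 2 (k + 1) ≤ Nat.log 2 (2 ^ (Nat.log 2 k + 1)) := Nat.log_mono_right h2
  rw [Nat.log_pow (by norm_num)] at h3
  omega

/-- The weights at the top of a slab. -/
theorem slabLaw_top (k : ℕ) (g : SimpleFunc ℝ E) (φ : ConeSpace E → W) :
    slabLaw k (k + 1 : ℕ) (slabPair k g) φ =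
      ∫ t in (0 : ℝ)..1, φ (conePoint (k + 1 : ℕ) (foldStep^[Nat.log 2 (k + 1)] g t)) := by
  have hb : slabBreak k (k + 1 : ℕ) = 0 := by simp [slabBreak]
  have hk' : ((k + 1 : ℕ) : ℝ) ≠ 0 := by positivity
  refine integral_congr_Ioc zero_le_one fun t ht => ?_
  have hbt : beforeStep (slabBreak k (k + 1 : ℕ)) t ≠ true := by
    rw [hb, ne_eq, beforeStep_eq_true_iff]
    exact ht.1.not_ge
  have hmid : midpoint ℝ (slabPair k g t).1 (slabPair k g t).2
      = foldStep^[Nat.log 2 (k + 1)] g t := by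
    unfold slabPair
    split_ifs with hlog
    · rw [hlog]
      exact midpoint_self ℝ _
    · rw [log_succ_of_ne hlog, Function.iterate_succ_apply']
      rfl
  rw [slabStep_apply, slabEval, if_neg hbt, hmid, ← Nat.cast_succ, div_self hk', one_smul]

/-- The weights at the bottom of a slab. -/
theorem slabLaw_bottom (k : ℕ) (hk : 1 ≤ k) (g : SimpleFunc ℝ E) (φ : ConeSpace E → W) :
    slabLaw k k (slabPair k g) φ =
      ∫ t in (0 : ℝ)..1, φ (conePoint k (foldStep^[Nat.log 2 k] g t)) := by
  have hk' : (k : ℝ) ≠ 0 := by positivity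
  have hb : slabBreak k k = 1 := by
    unfold slabBreak
    field_simp
    ring
  have key : slabLaw k k (slabPair k g) φ = ∫ t in (0 : ℝ)..1, (1 / 2 : ℝ) •
      (φ (conePoint k (slabPair k g t).1) + φ (conePoint k (slabPair k g t).2)) := by
    refine integral_congr_Ioc zero_le_one fun t ht => ?_
    have hbt : beforeStep (slabBreak k k) t = true := by
      rw [hb, beforeStep_eq_true_iff]
      exact ht.2
    rw [slabStep_apply, slabEval, if_pos hbt, div_self hk', one_smul]
  rw [key, intervalIntegral.integral_smul]
  unfold slabPair
  split_ifs with hlog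
  · rw [← intervalIntegral.integral_smul]
    congr 1
    ext t
    simp only [SimpleFunc.map_apply]
    rw [← two_smul ℝ, smul_smul]
    norm_num
  · rw [integral_foldPair (foldStep^[Nat.log 2 k] g) fun x => φ (conePoint k x), smul_smul]
    norm_num

/-- The weights of adjacent slabs agree on their intersection. -/
theorem slabLaw_top_eq_bottom (k : ℕ) (g : SimpleFunc ℝ E) (φ : ConeSpace E → W) :
    slabLaw k (k + 1 : ℕ) (slabPair k g) φ =
      slabLaw (k + 1) (k + 1 : ℕ) (slabPair (k + 1) g) φ := by
  rw [slabLaw_top k, slabLaw_bottom (k + 1) (by omega)]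

theorem productSlab_subset_hereditary {k : ℕ} {K : Set (Finset E) × (E → E → Prop)}
    {t t' : Finset (ConeSpace E)} (ht : t ∈ productSlab k K) (h : t' ⊆ t) (hne : t'.Nonempty) :
    t' ∈ productSlab k K := by
  obtain ⟨-, s, hs, h1, h2⟩ := ht
  exact ⟨hne, s, hs, fun p hp => h1 p (h hp), fun v hv w hw hv' hw' =>
    h2 v hv w hw (h hv') (h hw')⟩

theorem slabFaces_subset_hereditary {k : ℕ} {F : Set (Finset E)} {le : E → E → Prop}
    {t t' : Finset (ConeSpace E)} (ht : t ∈ slabFaces F le k) (h : t' ⊆ t) (hne : t'.Nonempty) :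
    t' ∈ slabFaces F le k := by
  rcases ht with ⟨hlog, ht⟩ | ⟨hlog, -, s, hs, h1, h2, h3⟩
  · exact Or.inl ⟨hlog, productSlab_subset_hereditary ht h hne⟩
  · exact Or.inr ⟨hlog, hne, s, hs, fun p hp => h1 p (h hp),
      fun x y hx hy => h2 x y (h hx) (h hy),
      fun v hv u hu w hw huw hv' huw' => h3 v hv u hu w hw huw (h hv') (h huw')⟩

open Classical in
/-- The vertices of positive weight of a point lie in a simplex of the slab. -/
theorem exists_slabFace [CompleteSpace E] {F : Set (Finset E)} {le : E → E → Prop} {k : ℕ}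
    (hk : 1 ≤ k) (hF : IsTame (F, le)) {g : SimpleFunc ℝ E} (hg : IsMonoStep (F, le) g) (h : ℝ) :
    (slabStep k h (slabPair k g)).range.biUnion (slabPts k) ∈ slabFaces F le k := by
  have hk0 : (k : ℝ) ≠ 0 := by positivity
  have hk1 : (k : ℝ) + 1 ≠ 0 := by positivity
  have hne : ((slabStep k h (slabPair k g)).range.biUnion (slabPts k)).Nonempty := by
    refine Finset.Nonempty.biUnion ⟨_, SimpleFunc.mem_range_self _ 0⟩ fun x _ => ?_
    unfold slabPts
    split_ifs <;> simp
  have hlow : ∀ (v : E), conePoint k v ∈ (slabStep k h (slabPair k g)).range.biUnion (slabPts k) →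
      ∃ u, u ≤ slabBreak k h ∧ (v = (slabPair k g u).1 ∨ v = (slabPair k g u).2) := by
    intro v hv
    obtain ⟨x, hx, hv⟩ := Finset.mem_biUnion.1 hv
    obtain ⟨u, rfl⟩ := SimpleFunc.mem_range.1 hx
    refine ⟨u, ?_⟩
    unfold slabPts at hv
    split_ifs at hv with hb
    · refine ⟨beforeStep_eq_true_iff.1 hb, ?_⟩
      rw [Finset.mem_insert, Finset.mem_singleton] at hv
      exact hv.imp (fun h => conePoint_injective hk0 h) fun h => conePoint_injective hk0 h
    · rw [Finset.mem_singleton] at hv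
      have := congrArg (fun z : ConeSpace E => z.snd) hv
      simp at this
  have hupp : ∀ (v : E), conePoint ((k : ℝ) + 1) v ∈
      (slabStep k h (slabPair k g)).range.biUnion (slabPts k) →
      ∃ u, slabBreak k h < u ∧ v = midpoint ℝ (slabPair k g u).1 (slabPair k g u).2 := by
    intro v hv
    obtain ⟨x, hx, hv⟩ := Finset.mem_biUnion.1 hv
    obtain ⟨u, rfl⟩ := SimpleFunc.mem_range.1 hx
    refine ⟨u, ?_⟩
    unfold slabPts at hv
    split_ifs at hv with hb
    · rw [Finset.mem_insert, Finset.mem_singleton] at hv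
      rcases hv with hv | hv <;>
      · have := congrArg (fun z : ConeSpace E => z.snd) hv
        simp at this
    · rw [Finset.mem_singleton] at hv
      exact ⟨not_le.1 fun h' => hb (beforeStep_eq_true_iff.2 h'), conePoint_injective hk1 hv⟩
  have hform : ∀ p ∈ (slabStep k h (slabPair k g)).range.biUnion (slabPts k), ∃ u,
      (p = conePoint k (slabPair k g u).1 ∨ p = conePoint k (slabPair k g u).2) ∨
      p = conePoint (k + 1) (midpoint ℝ (slabPair k g u).1 (slabPair k g u).2) := by
    intro p hp
    obtain ⟨x, hx, hp⟩ := Finset.mem_biUnion.1 hp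
    obtain ⟨u, rfl⟩ := SimpleFunc.mem_range.1 hx
    refine ⟨u, ?_⟩
    unfold slabPts at hp
    split_ifs at hp
    · rw [Finset.mem_insert, Finset.mem_singleton] at hp
      exact Or.inl hp
    · exact Or.inr (Finset.mem_singleton.1 hp)
  have hG := hg.foldStep_iterate (Nat.log 2 k)
  have hK := hF.stdSubdiv_iterate (Nat.log 2 k)
  obtain ⟨s, hs, hGs⟩ := hG.face
  by_cases hlog : Nat.log 2 (k + 1) = Nat.log 2 k
  · refine Or.inl ⟨hlog, hne, s, hs, fun p hp => ?_, fun v _ w _ hv' hw' => ?_⟩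
    · obtain ⟨u, hu⟩ := hform p hp
      simp only [slabPair, hlog, if_true, SimpleFunc.map_apply, midpoint_self, or_self] at hu
      exact ⟨_, hGs u, hu⟩
    · obtain ⟨u, hu, hv'⟩ := hlow v hv'
      obtain ⟨u', hu', hw'⟩ := hupp w hw'
      simp only [slabPair, hlog, if_true, SimpleFunc.map_apply, midpoint_self, or_self] at hv' hw'
      rw [hv', hw']
      exact hG.mono u u' (hu.trans hu'.le)
  · refine Or.inr ⟨hlog, hne, s, hs, fun p hp => ?_, fun x y hx hy => ?_,
      fun v hv a ha b hb hab hv' hab' => ?_⟩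
    · obtain ⟨u, hu⟩ := hform p hp
      simp only [slabPair, hlog, if_false] at hu
      rcases hu with (hu | hu) | hu
      · exact Or.inl ⟨_, hGs _, hu⟩
      · exact Or.inl ⟨_, hGs _, hu⟩
      · exact Or.inr ⟨_, hGs _, _, hGs _, hG.foldPair_le u, hu⟩
    · obtain ⟨u, -, hx⟩ := hupp x hx
      obtain ⟨u', -, hy⟩ := hupp y hy
      simp only [slabPair, hlog, if_false] at hx hy
      rw [hx, hy]
      exact (le_total u u').imp hG.foldStep_mono hG.foldStep_mono
    · obtain ⟨u, hu, hv'⟩ := hlow v hv'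
      obtain ⟨u', hu', hab'⟩ := hupp _ hab'
      simp only [slabPair, hlog, if_false] at hv' hab'
      obtain ⟨rfl, rfl⟩ := hK.midpoint_inj hs hs ha hb (hGs _) (hGs _) hab (hG.foldPair_le u') hab'
      have hn := hG.foldPair_nested (hu.trans hu'.le)
      have h1 := hG.foldPair_le u
      have htr := fun x hx y hy z hz => hK.order.trans s hs s hs s hs x hx y hy z hz
      rcases hv' with rfl | rfl
      · exact ⟨hn.1, htr _ (hGs _) _ (hGs _) _ (hGs _) h1 hn.2⟩
      · exact ⟨htr _ (hGs _) _ (hGs _) _ (hGs _) hn.1 h1, hn.2⟩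

theorem exists_slabFace_support [CompleteSpace E] {X : Geometry.SimplicialComplex ℝ E}
    {le : E → E → Prop} {k : ℕ} (hk : 1 ≤ k) (hF : IsTame (X.faces, le)) {g : SimpleFunc ℝ E}
    (hg : IsMonoStep (X.faces, le) g) {σ : Finset E} (hgσ : ∀ t, g t ∈ σ) {c : ℝ}
    (hc : VariationLE g c) {h : ℝ} (h0 : k ≤ h) (h1 : h ≤ k + 1) :
    ∃ t ∈ slabFaces X.faces le k, (∀ u, slabPts k (slabStep k h (slabPair k g) u) ⊆ t) ∧
      ∀ p ∈ t, p ∈ cone (convexHull ℝ (σ : Set E)) ∧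
        dist p (conePoint h (mean g)) ≤ 2 * c + (‖mean g‖ + 1) := by
  classical
  refine ⟨_, exists_slabFace hk hF hg h, fun u => ?_, ?_⟩
  · exact Finset.subset_biUnion_of_mem (slabPts k) (SimpleFunc.mem_range_self _ u)
  have hk' : (1 : ℝ) ≤ k := by exact_mod_cast hk
  set n := Nat.log 2 k with hn
  have hc0 : 0 ≤ c := (norm_nonneg _).trans (hc.norm_sub_le 0 0)
  have hkn : (k : ℝ) + 1 ≤ 2 * 2 ^ n := by
    have : k + 1 ≤ 2 ^ (n + 1) := Nat.lt_pow_succ_log_self (by norm_num) k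
    rw [← pow_succ']
    exact_mod_cast this
  have hball : ∀ u, foldStep^[n] g u ∈
      convexHull ℝ (σ : Set E) ∩ Metric.closedBall (mean g) (c / 2 ^ n) := by
    refine fun u => ⟨foldStep_iterate_mem (convex_convexHull ℝ _)
      (fun t => subset_convexHull ℝ _ (hgσ t)) n u, ?_⟩
    rw [Metric.mem_closedBall, dist_eq_norm, ← mean_foldStep_iterate g n]
    exact (hc.foldStep_iterate n).norm_sub_mean_le u
  have hconv : Convex ℝ (convexHull ℝ (σ : Set E) ∩ Metric.closedBall (mean g) (c / 2 ^ n)) :=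
    (convex_convexHull ℝ _).inter (convex_closedBall _ _)
  have hpair : ∀ u, (slabPair k g u).1 ∈
        convexHull ℝ (σ : Set E) ∩ Metric.closedBall (mean g) (c / 2 ^ n) ∧
      (slabPair k g u).2 ∈
        convexHull ℝ (σ : Set E) ∩ Metric.closedBall (mean g) (c / 2 ^ n) := by
    intro u
    unfold slabPair
    split_ifs
    · exact ⟨hball u, hball u⟩
    · exact ⟨hball _, hball _⟩
  have hpt : ∀ (l : ℝ), 0 ≤ l → l ≤ k + 1 → |l - h| ≤ 1 →
      ∀ y ∈ convexHull ℝ (σ : Set E) ∩ Metric.closedBall (mean g) (c / 2 ^ n),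
      conePoint l y ∈ cone (convexHull ℝ (σ : Set E)) ∧
        dist (conePoint l y) (conePoint h (mean g)) ≤ 2 * c + (‖mean g‖ + 1) := by
    intro l hl0 hl1 hlh y hy
    refine ⟨⟨l, hl0, y, hy.1, rfl⟩, ?_⟩
    rw [dist_eq_norm]
    refine (norm_conePoint_sub_le _ _ _ _).trans (add_le_add ?_ ?_)
    · have h2 : ‖y - mean g‖ ≤ c / 2 ^ n := by
        have := hy.2
        rwa [Metric.mem_closedBall, dist_eq_norm] at this
      rw [abs_of_nonneg hl0]
      calc l * ‖y - mean g‖ ≤ (2 * 2 ^ n) * (c / 2 ^ n) :=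
            mul_le_mul (hl1.trans hkn) h2 (norm_nonneg _) (by positivity)
        _ = 2 * c := by field_simp
    · exact mul_le_of_le_one_left (by positivity) hlh
  intro p hp
  obtain ⟨x, hx, hp⟩ := Finset.mem_biUnion.1 hp
  obtain ⟨u, rfl⟩ := SimpleFunc.mem_range.1 hx
  have hlow := hpt k (by linarith) (by linarith) (abs_le.2 ⟨by linarith, by linarith⟩)
  have hupp := hpt (k + 1) (by linarith) (by linarith) (abs_le.2 ⟨by linarith, by linarith⟩)
  unfold slabPts at hp
  split_ifs at hp
  · rw [Finset.mem_insert, Finset.mem_singleton] at hp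
    rcases hp with rfl | rfl
    · exact hlow _ (hpair u).1
    · exact hlow _ (hpair u).2
  · rw [Finset.mem_singleton.1 hp]
    exact hupp _ (hconv.midpoint_mem (hpair u).1 (hpair u).2)

end Slab

/-! ### Uniqueness of the weights in a slab -/

section Uniqueness

open MeasureTheory

variable {E : Type*} [NormedAddCommGroup E] [InnerProductSpace ℝ E] [CompleteSpace E]
variable {W : Type*} [NormedAddCommGroup W] [NormedSpace ℝ W] [CompleteSpace W]

omit [CompleteSpace E] in
theorem conePoint_base {h : ℝ} (hh : h ≠ 0) (v : E) :
    (conePoint h v).snd⁻¹ • (conePoint h v).fst = v := by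
  simp [inv_smul_smul₀ hh]

/-- The weights given by a slab with a product triangulation are the barycentric coordinates. The
vertices of a simplex of the slab form a chain, with the lower vertices first; the quantile
function of the given weights, multiplied by the heights, projects to a monotone step function in
the base, which is unique. -/
theorem slabLaw_product {K : Set (Finset E) × (E → E → Prop)} (hK : IsTame K) {k : ℕ} (hk : 1 ≤ k)
    {t : Finset (ConeSpace E)} (ht : t ∈ productSlab k K) {c : ConeSpace E → ℝ}
    (hc : ∀ p ∈ t, 0 ≤ c p) (hc1 : ∑ p ∈ t, c p = 1) {G : SimpleFunc ℝ E} (hG : IsMonoStep K G)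
    {h : ℝ} (hh : ∑ p ∈ t, c p * p.snd = h) (hmean : mean G = h⁻¹ • ∑ p ∈ t, c p • p.fst)
    (φ : ConeSpace E → W) : slabLaw k h (G.map fun x => (x, x)) φ = ∑ p ∈ t, c p • φ p := by
  classical
  obtain ⟨hne, s, hs, hform, hord⟩ := ht
  have hk' : (1 : ℝ) ≤ k := by exact_mod_cast hk
  have hk0 : (k : ℝ) ≠ 0 := by positivity
  have hk1 : (k : ℝ) + 1 ≠ 0 := by positivity
  let π : ConeSpace E → E := fun p => p.snd⁻¹ • p.fst
  have hheight : ∀ p ∈ t, p.snd = k ∨ p.snd = k + 1 := fun p hp => by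
    obtain ⟨v, -, rfl | rfl⟩ := hform p hp <;> simp
  have hpos : ∀ p ∈ t, 0 < p.snd := fun p hp => by
    rcases hheight p hp with h | h <;> rw [h] <;> linarith
  have hπs : ∀ p ∈ t, π p ∈ s := fun p hp => by
    obtain ⟨v, hv, rfl | rfl⟩ := hform p hp
    · simpa only [π, conePoint_base hk0] using hv
    · simpa only [π, conePoint_base hk1] using hv
  have hπ : ∀ p ∈ t, conePoint p.snd (π p) = p := fun p hp =>
    ConeSpace.ext (by simp [π, smul_inv_smul₀ (hpos p hp).ne']) (by simp)
  have hlo : (k : ℝ) ≤ h := by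
    have h1 : ∑ p ∈ t, c p * (k : ℝ) ≤ ∑ p ∈ t, c p * p.snd :=
      Finset.sum_le_sum fun p hp => mul_le_mul_of_nonneg_left
        (by rcases hheight p hp with h | h <;> linarith) (hc p hp)
    rwa [← Finset.sum_mul, hc1, one_mul, hh] at h1
  have hhi : h ≤ k + 1 := by
    have h1 : ∑ p ∈ t, c p * p.snd ≤ ∑ p ∈ t, c p * ((k : ℝ) + 1) :=
      Finset.sum_le_sum fun p hp => mul_le_mul_of_nonneg_left
        (by rcases hheight p hp with h | h <;> linarith) (hc p hp)
    rwa [← Finset.sum_mul, hc1, one_mul, hh] at h1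
  have hh0 : 0 < h := by linarith
  let le' : ConeSpace E → ConeSpace E → Prop := fun p q => p.snd ≤ q.snd ∧ K.2 (π p) (π q)
  have htot : ∀ p ∈ t, ∀ q ∈ t, le' p q ∨ le' q p := by
    intro p hp q hq
    rcases hheight p hp with h1 | h1 <;> rcases hheight q hq with h2 | h2
    · exact (hK.order.total s hs _ (hπs p hp) _ (hπs q hq)).imp
        (fun h => ⟨by rw [h1, h2], h⟩) fun h => ⟨by rw [h1, h2], h⟩
    · exact Or.inl ⟨by rw [h1, h2]; linarith, hord _ (hπs p hp) _ (hπs q hq)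
        (by rw [← h1, hπ p hp]; exact hp) (by rw [← h2, hπ q hq]; exact hq)⟩
    · exact Or.inr ⟨by rw [h1, h2]; linarith, hord _ (hπs q hq) _ (hπs p hp)
        (by rw [← h2, hπ q hq]; exact hq) (by rw [← h1, hπ p hp]; exact hp)⟩
    · exact (hK.order.total s hs _ (hπs p hp) _ (hπs q hq)).imp
        (fun h => ⟨by rw [h1, h2], h⟩) fun h => ⟨by rw [h1, h2], h⟩
  have htrans : ∀ p ∈ t, ∀ q ∈ t, ∀ r ∈ t, le' p q → le' q r → le' p r := by
    intro p hp q hq r hr h1 h2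
    exact ⟨h1.1.trans h2.1, hK.order.trans s hs s hs s hs _ (hπs p hp) _ (hπs q hq) _ (hπs r hr)
      h1.2 h2.2⟩
  obtain ⟨Q, hQt, hQm, hQl⟩ := exists_quantile_law (fun p => c p * p.snd / h) t
    (fun p hp => div_nonneg (mul_nonneg (hc p hp) (hpos p hp).le) hh0.le)
    (by rw [← Finset.sum_div, hh, div_self hh0.ne']) htot htrans
  have hg : IsMonoStep K (Q.map π) :=
    ⟨⟨s, hs, fun u => hπs _ (hQt u)⟩, fun u u' huu => (hQm u u' huu).2⟩
  have hgmean : mean (Q.map π) = mean G := by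
    rw [hmean]
    refine (integral_step_eq_sum_law hQt π).trans ?_
    rw [Finset.smul_sum]
    refine Finset.sum_congr rfl fun p hp => ?_
    rw [hQl p hp, smul_smul, smul_smul]
    congr 1
    field_simp [(hpos p hp).ne']
  have hd := hK.unique _ _ hG hg hgmean.symm
  let low : ConeSpace E → Bool := fun p => decide (p.snd ≤ k)
  obtain ⟨hb0, hb1⟩ := slabBreak_mem hk hlo hhi
  -- almost everywhere, the quantile function takes lower vertices exactly below the cut
  have hdb : stepDist (beforeStep (slabBreak k h)) (Q.map low) = 0 := by
    have h1 := integral_abs_sub_of_initial (beforeStep (slabBreak k h)) Q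
      (P := fun b => b = true) (P' := fun p => low p = true)
      (fun u u' huu hu' => by
        rw [beforeStep_eq_true_iff] at hu' ⊢
        exact huu.trans hu')
      (fun u u' huu hu' => by
        simp only [low, decide_eq_true_eq] at hu' ⊢
        exact (hQm u u' huu).1.trans hu')
    have h2 : ∫ u in (0 : ℝ)..1, ind (low (Q u) = true) = slabBreak k h := by
      rw [integral_step_eq_sum_law hQt fun p => ind (low p = true)]
      have h3 : ∀ p ∈ t, law Q p • ind (low p = true) = (k / h) * (c p * (k + 1) - c p * p.snd) := by
        intro p hp
        rw [hQl p hp, smul_eq_mul]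
        rcases hheight p hp with h4 | h4
        · rw [ind_pos (by simp [low, h4]), h4]
          ring
        · rw [ind_neg (by simp [low, h4]), h4]
          ring
      rw [Finset.sum_congr rfl h3, ← Finset.mul_sum, Finset.sum_sub_distrib, hh, ← Finset.sum_mul,
        hc1, slabBreak]
      ring
    have h4 := integral_beforeStep hb0 hb1
    unfold law at h4
    rw [h2, h4, sub_self, abs_zero] at h1
    rw [← h1]
    unfold stepDist
    congr 1
    ext u
    simp only [SimpleFunc.map_apply]
    cases beforeStep (slabBreak k h) u <;> cases low (Q u) <;> simp
  have hstep : stepDist (slabStep k h (G.map fun x => (x, x)))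
      ((Q.map low).pair ((Q.map π).map fun x => (x, x))) = 0 := by
    refine le_antisymm ((stepDist_pair_le _ _ _ _).trans ?_) (stepDist_nonneg _ _)
    have := stepDist_map_le (fun x : E => (x, x)) G (Q.map π)
    rw [hdb]
    linarith
  refine (integral_eq_of_stepDist_eq_zero hstep (slabEval k h φ)).trans
    ((integral_step_eq_sum_law hQt fun p => slabEval k h φ (low p, (π p, π p))).trans
      (Finset.sum_congr rfl fun p hp => ?_))
  have hval : slabEval k h φ (low p, (π p, π p)) = (h / p.snd) • φ p := by
    rcases hheight p hp with h1 | h1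
    · rw [slabEval, if_pos (by simp [low, h1]), ← h1]
      simp only [hπ p hp]
      rw [← two_smul ℝ (φ p), smul_smul (1 / 2 : ℝ)]
      norm_num
    · rw [slabEval, if_neg (by simp [low, h1]), ← h1]
      simp only [midpoint_self, hπ p hp]
  rw [hval, hQl p hp, smul_smul]
  congr 1
  have := (hpos p hp).ne'
  field_simp

omit [CompleteSpace E] [CompleteSpace W] in
theorem integral_foldStep_eq (q : SimpleFunc ℝ E) (ψ ψ' : E → W)
    (h : ∀ t, ψ' (foldStep q t) =
      (1 / 2 : ℝ) • (ψ (foldPair q t).1 + ψ (foldPair q t).2)) :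
    ∫ t in (0 : ℝ)..1, ψ' (foldStep q t) = ∫ t in (0 : ℝ)..1, ψ (q t) := by
  simp_rw [h]
  rw [intervalIntegral.integral_smul, integral_foldPair q ψ, smul_smul]
  norm_num

/-- A weighted chain of vertices can be replaced by a weighted chain of vertices of the standard
subdivision without changing its barycenter. -/
theorem exists_fold_weights {K : Set (Finset E) × (E → E → Prop)} (hK : IsTame K) {s V : Finset E}
    (hs : s ∈ K.1) (hV : V ⊆ s) {a : E → ℝ} (ha : ∀ v ∈ V, 0 ≤ a v) (ψ ψ' : E → W)
    (hψ : ∀ i ∈ V, ∀ j ∈ V, K.2 i j → ψ' (midpoint ℝ i j) = (1 / 2 : ℝ) • (ψ i + ψ j)) :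
    ∃ (V' : Finset E) (a' : E → ℝ),
      (∀ m ∈ V', ∃ i ∈ V, ∃ j ∈ V, K.2 i j ∧ m = midpoint ℝ i j) ∧
      (∀ m ∈ V', ∀ m' ∈ V', subdivLe K.1 K.2 m m' ∨ subdivLe K.1 K.2 m' m) ∧
      (∀ m ∈ V', 0 ≤ a' m) ∧ ∑ m ∈ V', a' m = ∑ v ∈ V, a v ∧
      ∑ m ∈ V', a' m • m = ∑ v ∈ V, a v • v ∧ ∑ m ∈ V', a' m • ψ' m = ∑ v ∈ V, a v • ψ v := by
  rcases (Finset.sum_nonneg ha).eq_or_lt with h0 | h0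
  · have ha0 := (Finset.sum_eq_zero_iff_of_nonneg ha).1 h0.symm
    refine ⟨∅, a, by simp, by simp, by simp, by simpa using h0, ?_, ?_⟩
    · rw [Finset.sum_empty, Finset.sum_eq_zero fun v hv => by rw [ha0 v hv, zero_smul]]
    · rw [Finset.sum_empty, Finset.sum_eq_zero fun v hv => by rw [ha0 v hv, zero_smul]]
  set A := ∑ v ∈ V, a v with hA
  obtain ⟨q, hqV, hqm, hql⟩ := exists_quantile_law (le := K.2) (fun v => a v / A) V
    (fun v hv => div_nonneg (ha v hv) h0.le) (by rw [← Finset.sum_div, div_self h0.ne'])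
    (fun u hu v hv => hK.order.total s hs u (hV hu) v (hV hv))
    fun u hu v hv w hw => hK.order.trans s hs s hs s hs u (hV hu) v (hV hv) w (hV hw)
  have hq : IsMonoStep K q := ⟨⟨s, hs, fun t => hV (hqV t)⟩, hqm⟩
  have hr : ∀ t, foldStep q t ∈ (foldStep q).range := SimpleFunc.mem_range_self _
  refine ⟨(foldStep q).range, fun m => A * law (foldStep q) m, fun m hm => ?_, fun m hm m' hm' => ?_,
    fun m _ => mul_nonneg h0.le (law_nonneg _ _), ?_, ?_, ?_⟩
  · obtain ⟨t, rfl⟩ := SimpleFunc.mem_range.1 hm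
    exact ⟨_, hqV _, _, hqV _, hq.foldPair_le t, rfl⟩
  · obtain ⟨t, rfl⟩ := SimpleFunc.mem_range.1 hm
    obtain ⟨t', rfl⟩ := SimpleFunc.mem_range.1 hm'
    exact (le_total t t').imp hq.foldStep_mono hq.foldStep_mono
  · rw [← Finset.mul_sum, sum_law hr, mul_one]
  · have h1 := integral_foldStep_eq q (fun x => x) (fun x => x) fun t => midpoint_eq _ _
    rw [integral_step_eq_sum_law hqV fun x => x, integral_step_eq_sum_law hr fun x => x] at h1
    simp_rw [mul_smul]
    rw [← Finset.smul_sum, h1, Finset.smul_sum]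
    refine Finset.sum_congr rfl fun v hv => ?_
    rw [hql v hv, smul_smul, mul_div_cancel₀ _ h0.ne']
  · have h1 := integral_foldStep_eq q ψ ψ' fun t => hψ _ (hqV _) _ (hqV _) (hq.foldPair_le t)
    rw [integral_step_eq_sum_law hqV ψ, integral_step_eq_sum_law hr ψ'] at h1
    simp_rw [mul_smul]
    rw [← Finset.smul_sum, h1, Finset.smul_sum]
    refine Finset.sum_congr rfl fun v hv => ?_
    rw [hql v hv, smul_smul, mul_div_cancel₀ _ h0.ne']

open Classical in
omit [CompleteSpace E] in
theorem sum_lower_upper {Z : Type*} [AddCommMonoid Z] {h : ℝ} (hh : h ≠ 0) (V : Finset E)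
    {U : Finset (ConeSpace E)} (hU : ∀ p ∈ U, p.snd ≠ h) (f : ConeSpace E → Z) :
    ∑ p ∈ V.image (conePoint h) ∪ U, f p = ∑ v ∈ V, f (conePoint h v) + ∑ p ∈ U, f p := by
  rw [Finset.sum_union, Finset.sum_image fun x _ y _ hxy => conePoint_injective hh hxy]
  rw [Finset.disjoint_left]
  rintro p hp hpU
  obtain ⟨m, -, rfl⟩ := Finset.mem_image.1 hp
  exact hU _ hpU rfl

/-- The weights given by a slab in which the base is subdivided are the barycentric coordinates.
After folding the lower part of the given weighted simplex once, it becomes a simplex of the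
product slab over the subdivided base. -/
theorem slabLaw_subdiv {K : Set (Finset E) × (E → E → Prop)} (hK : IsTame K) {k : ℕ} (hk : 1 ≤ k)
    {t : Finset (ConeSpace E)} (ht : t ∈ subdivSlab k K) {c : ConeSpace E → ℝ}
    (hc : ∀ p ∈ t, 0 ≤ c p) (hc1 : ∑ p ∈ t, c p = 1) {G : SimpleFunc ℝ E} (hG : IsMonoStep K G)
    {h : ℝ} (hh : ∑ p ∈ t, c p * p.snd = h) (hmean : mean G = h⁻¹ • ∑ p ∈ t, c p • p.fst)
    (φ : ConeSpace E → W) : slabLaw k h (foldPair G) φ = ∑ p ∈ t, c p • φ p := by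
  classical
  obtain ⟨hne, s, hs, hform, hchain, hord⟩ := ht
  have hk0 : (k : ℝ) ≠ 0 := by positivity
  have hk1 : (k : ℝ) + 1 ≠ 0 := by positivity
  -- the average of `φ` over the endpoints of an edge, as a function of the midpoint
  have havg : ∀ m : E, ∃ y : W, ∀ s ∈ K.1, ∀ i ∈ s, ∀ j ∈ s, K.2 i j → m = midpoint ℝ i j →
      y = (1 / 2 : ℝ) • (φ (conePoint k i) + φ (conePoint k j)) := by
    intro m
    by_cases hm : ∃ s ∈ K.1, ∃ i ∈ s, ∃ j ∈ s, K.2 i j ∧ m = midpoint ℝ i j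
    · obtain ⟨s, hs, i, hi, j, hj, hij, hm⟩ := hm
      refine ⟨(1 / 2 : ℝ) • (φ (conePoint k i) + φ (conePoint k j)),
        fun s' hs' i' hi' j' hj' hij' hm' => ?_⟩
      obtain ⟨rfl, rfl⟩ := hK.midpoint_inj hs hs' hi hj hi' hj' hij hij' (hm.symm.trans hm')
      rfl
    · exact ⟨0, fun s' hs' i' hi' j' hj' hij' hm' =>
        absurd ⟨s', hs', i', hi', j', hj', hij', hm'⟩ hm⟩
  choose avg havg using havg
  let φ' : ConeSpace E → W := fun p => if p.snd = k then avg (p.snd⁻¹ • p.fst) else φ p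
  have hφ'low : ∀ m : E, φ' (conePoint k m) = avg m := fun m => by
    simp only [φ', conePoint_snd, if_true, conePoint_fst, inv_smul_smul₀ hk0]
  have hφ'up : ∀ m : E, φ' (conePoint (k + 1) m) = φ (conePoint (k + 1) m) := fun m =>
    if_neg (by simp)
  have hLaw : slabLaw k h (foldPair G) φ = slabLaw k h ((foldStep G).map fun x => (x, x)) φ' := by
    obtain ⟨f, hf, hGf⟩ := hG.face
    unfold slabLaw
    congr 1
    ext u
    rw [slabStep_apply, slabStep_apply, SimpleFunc.map_apply]
    cases beforeStep (slabBreak k h) u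
    · simp only [slabEval, Bool.false_eq_true, if_false, midpoint_self, hφ'up]
      rfl
    · simp only [slabEval, if_true, hφ'low]
      rw [← two_smul ℝ (avg _), smul_smul (1 / 2 : ℝ),
        havg _ f hf _ (hGf _) _ (hGf _) (hG.foldPair_le u) (foldStep_apply G u)]
      norm_num
      rfl
  let V := s.filter fun v => conePoint k v ∈ t
  have hVs : V ⊆ s := Finset.filter_subset _ _
  have hVt : ∀ v ∈ V, conePoint k v ∈ t := fun v hv => (Finset.mem_filter.1 hv).2
  let U := t.filter fun p => ¬p.snd = (k : ℝ)
  have hUt : U ⊆ t := Finset.filter_subset _ _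
  have hU : ∀ p ∈ U, ∃ u ∈ s, ∃ w ∈ s, K.2 u w ∧ p = conePoint (k + 1) (midpoint ℝ u w) := by
    intro p hp
    obtain ⟨hpt, hpk⟩ := Finset.mem_filter.1 hp
    rcases hform p hpt with ⟨v, hv, rfl⟩ | h
    · exact absurd (conePoint_snd _ _) hpk
    · exact h
  have hsnd : ∀ p ∈ U, p.snd ≠ (k : ℝ) := fun p hp => (Finset.mem_filter.1 hp).2
  have ht_eq : t = V.image (conePoint (k : ℝ)) ∪ U := by
    ext p
    simp only [V, U, Finset.mem_union, Finset.mem_filter, Finset.mem_image]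
    constructor
    · intro hpt
      by_cases hpk : p.snd = (k : ℝ)
      · rcases hform p hpt with ⟨v, hv, rfl⟩ | ⟨u, -, w, -, -, rfl⟩
        · exact Or.inl ⟨v, ⟨hv, hpt⟩, rfl⟩
        · simp at hpk
      · exact Or.inr ⟨hpt, hpk⟩
    · rintro (⟨v, ⟨-, hvt⟩, rfl⟩ | ⟨hpt, -⟩)
      · exact hvt
      · exact hpt
  obtain ⟨V', a', hV', hchain', ha', hsum1, hsum2, hsum3⟩ := exists_fold_weights hK hs hVs
    (a := fun v => c (conePoint k v)) (fun v hv => hc _ (hVt v hv))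
    (fun v => φ (conePoint k v)) avg
    fun i hi j hj hij => havg _ s hs i (hVs hi) j (hVs hj) hij rfl
  let t' := V'.image (conePoint (k : ℝ)) ∪ U
  let c' : ConeSpace E → ℝ := fun p => if p.snd = k then a' (p.snd⁻¹ • p.fst) else c p
  have hc'low : ∀ m : E, c' (conePoint k m) = a' m := fun m => by
    simp only [c', conePoint_snd, if_true, conePoint_fst, inv_smul_smul₀ hk0]
  have hc'up : ∀ p ∈ U, c' p = c p := fun p hp => if_neg (Finset.mem_filter.1 hp).2
  have hS1 : ∑ p ∈ t', c' p = 1 := by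
    rw [sum_lower_upper hk0 V' hsnd, Finset.sum_congr rfl fun m _ => hc'low m, hsum1,
      Finset.sum_congr rfl hc'up, ← sum_lower_upper hk0 V hsnd c, ← ht_eq, hc1]
  have hS2 : ∑ p ∈ t', c' p * p.snd = h := by
    rw [← hh, sum_lower_upper hk0 V' hsnd, ht_eq, sum_lower_upper hk0 V hsnd]
    congr 1
    · simp only [hc'low, conePoint_snd]
      rw [← Finset.sum_mul, ← Finset.sum_mul, hsum1]
    · exact Finset.sum_congr rfl fun p hp => by rw [hc'up p hp]
  have hS3 : ∑ p ∈ t', c' p • p.fst = ∑ p ∈ t, c p • p.fst := by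
    rw [sum_lower_upper hk0 V' hsnd, ht_eq, sum_lower_upper hk0 V hsnd]
    congr 1
    · simp only [hc'low, conePoint_fst]
      simp_rw [smul_comm _ (k : ℝ)]
      rw [← Finset.smul_sum, ← Finset.smul_sum, hsum2]
    · exact Finset.sum_congr rfl fun p hp => by rw [hc'up p hp]
  have hS4 : ∑ p ∈ t', c' p • φ' p = ∑ p ∈ t, c p • φ p := by
    rw [sum_lower_upper hk0 V' hsnd, ht_eq, sum_lower_upper hk0 V hsnd]
    congr 1
    · simp only [hc'low, hφ'low]
      exact hsum3
    · exact Finset.sum_congr rfl fun p hp => by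
        rw [hc'up p hp, show φ' p = φ p from if_neg (hsnd p hp)]
  have hc'0 : ∀ p ∈ t', 0 ≤ c' p := by
    intro p hp
    rcases Finset.mem_union.1 hp with hp | hp
    · obtain ⟨m, hm, rfl⟩ := Finset.mem_image.1 hp
      rw [hc'low]
      exact ha' m hm
    · rw [hc'up p hp]
      exact hc p (hUt hp)
  have hmixed : ∀ m ∈ V', ∀ x : E, conePoint ((k : ℝ) + 1) x ∈ U → subdivLe K.1 K.2 m x := by
    intro m hm x hx
    obtain ⟨i, hi, j, hj, hij, rfl⟩ := hV' m hm
    obtain ⟨u, hu, w, hw, huw, hx'⟩ := hU _ hx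
    obtain rfl := conePoint_injective hk1 hx'
    exact ⟨i, j, u, w, ⟨s, hs, hVs hi, hVs hj⟩, ⟨s, hs, hu, hw⟩,
      (hord i (hVs hi) u hu w hw huw (hVt i hi) (hUt hx)).1, hij,
      (hord j (hVs hj) u hu w hw huw (hVt j hj) (hUt hx)).2, rfl, rfl⟩
  have hlow' : ∀ v : E, conePoint (k : ℝ) v ∈ t' → v ∈ V' := by
    intro v hv
    rcases Finset.mem_union.1 hv with hv | hv
    · obtain ⟨m, hm, hmv⟩ := Finset.mem_image.1 hv
      rwa [← conePoint_injective hk0 hmv]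
    · exact absurd rfl (Finset.mem_filter.1 hv).2
  have hup' : ∀ v : E, conePoint ((k : ℝ) + 1) v ∈ t' → conePoint ((k : ℝ) + 1) v ∈ U := by
    intro v hv
    rcases Finset.mem_union.1 hv with hv | hv
    · obtain ⟨m, -, hmv⟩ := Finset.mem_image.1 hv
      have := congrArg (fun z : ConeSpace E => z.snd) hmv
      simp at this
    · exact hv
  have hform' : ∀ p ∈ t', (∃ m ∈ V', p = conePoint k m) ∨ ∃ x, p = conePoint ((k : ℝ) + 1) x ∧
      conePoint ((k : ℝ) + 1) x ∈ U := by
    intro p hp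
    rcases Finset.mem_union.1 hp with hp | hp
    · obtain ⟨m, hm, rfl⟩ := Finset.mem_image.1 hp
      exact Or.inl ⟨m, hm, rfl⟩
    · obtain ⟨u, -, w, -, -, rfl⟩ := hU p hp
      exact Or.inr ⟨_, rfl, hp⟩
  have ht'ne : t'.Nonempty := by
    rw [Finset.nonempty_iff_ne_empty]
    intro h0
    rw [h0] at hS1
    simp at hS1
  have ht' : t' ∈ productSlab k (stdSubdiv K) := by
    refine ⟨ht'ne, t'.image fun p => p.snd⁻¹ • p.fst, ⟨ht'ne.image _, ⟨s, hs, ?_⟩, ?_⟩, ?_, ?_⟩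
    · intro x hx
      obtain ⟨p, hp, rfl⟩ := Finset.mem_image.1 hx
      rcases hform' p hp with ⟨m, hm, rfl⟩ | ⟨x, rfl, hxU⟩
      · rw [conePoint_base hk0]
        obtain ⟨i, hi, j, hj, hij, rfl⟩ := hV' m hm
        exact ⟨i, hVs hi, j, hVs hj, hij, rfl⟩
      · rw [conePoint_base hk1]
        obtain ⟨u, hu, w, hw, huw, hx'⟩ := hU _ hxU
        exact ⟨u, hu, w, hw, huw, conePoint_injective hk1 hx'⟩
    · intro x hx y hy
      obtain ⟨p, hp, rfl⟩ := Finset.mem_image.1 hx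
      obtain ⟨q, hq, rfl⟩ := Finset.mem_image.1 hy
      rcases hform' p hp with ⟨m, hm, rfl⟩ | ⟨x, rfl, hxU⟩ <;>
        rcases hform' q hq with ⟨m', hm', rfl⟩ | ⟨y, rfl, hyU⟩
      · simp only [conePoint_base hk0]
        exact hchain' m hm m' hm'
      · simp only [conePoint_base hk0, conePoint_base hk1]
        exact Or.inl (hmixed m hm y hyU)
      · simp only [conePoint_base hk0, conePoint_base hk1]
        exact Or.inr (hmixed m' hm' x hxU)
      · simp only [conePoint_base hk1]
        exact hchain x y (hUt hxU) (hUt hyU)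
    · intro p hp
      refine ⟨_, Finset.mem_image_of_mem _ hp, ?_⟩
      rcases hform' p hp with ⟨m, hm, rfl⟩ | ⟨x, rfl, hx⟩
      · rw [conePoint_base hk0]
        exact Or.inl rfl
      · rw [conePoint_base hk1]
        exact Or.inr rfl
    · intro v _ w _ hv hw
      exact hmixed v (hlow' v hv) w (hup' w hw)
  rw [hLaw, ← hS4]
  exact slabLaw_product hK.stdSubdiv hk ht' hc'0 hS1 hG.foldStep hS2
    (by rw [mean_foldStep, hmean, hS3]) φ'

/-- On every simplex of a slab the weights are the barycentric coordinates. -/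
theorem slabLaw_slabFaces {F : Set (Finset E)} {le : E → E → Prop} (hF : IsTame (F, le)) {k : ℕ}
    (hk : 1 ≤ k) {t : Finset (ConeSpace E)} (ht : t ∈ slabFaces F le k) {c : ConeSpace E → ℝ}
    (hc : ∀ p ∈ t, 0 ≤ c p) (hc1 : ∑ p ∈ t, c p = 1) {g : SimpleFunc ℝ E}
    (hg : IsMonoStep (F, le) g) {h : ℝ} (hh : ∑ p ∈ t, c p * p.snd = h)
    (hmean : mean g = h⁻¹ • ∑ p ∈ t, c p • p.fst) (φ : ConeSpace E → W) :
    slabLaw k h (slabPair k g) φ = ∑ p ∈ t, c p • φ p := by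
  have hK := hF.stdSubdiv_iterate (Nat.log 2 k)
  have hG := hg.foldStep_iterate (Nat.log 2 k)
  have hm : mean (foldStep^[Nat.log 2 k] g) = h⁻¹ • ∑ p ∈ t, c p • p.fst := by
    rw [mean_foldStep_iterate, hmean]
  rcases ht with ⟨hlog, ht⟩ | ⟨hlog, ht⟩
  · rw [slabPair, if_pos hlog]
    exact slabLaw_product hK hk ht hc hc1 hG hh hm φ
  · rw [slabPair, if_neg hlog]
    exact slabLaw_subdiv hK hk ht hc hc1 hG hh hm φ

end Uniqueness

/-! ### Barycentric coordinates in the standard triangulation -/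

section Weights

open MeasureTheory

variable {E : Type*} [NormedAddCommGroup E] [InnerProductSpace ℝ E]

theorem convex_cone_convexHull (σ : Finset E) : Convex ℝ (cone (convexHull ℝ (σ : Set E))) := by
  rcases σ.eq_empty_or_nonempty with rfl | hσ
  · rintro z ⟨h, -, x, hx, -⟩
    simp at hx
  intro z hz z' hz' a b ha hb _
  rw [mem_cone_convexHull_iff hσ] at hz hz' ⊢
  obtain ⟨w, hw, hwσ, rfl⟩ := hz
  obtain ⟨w', hw', hwσ', rfl⟩ := hz'
  refine ⟨fun v => a * w v + b * w' v,
    fun v => add_nonneg (mul_nonneg ha (hw v)) (mul_nonneg hb (hw' v)),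
    fun v hv => by simp [hwσ v hv, hwσ' v hv], ?_⟩
  simp only [add_smul, mul_smul, Finset.sum_add_distrib, Finset.smul_sum]

theorem slabFaces_snd {F : Set (Finset E)} {le : E → E → Prop} {k : ℕ} {t : Finset (ConeSpace E)}
    (ht : t ∈ slabFaces F le k) {p : ConeSpace E} (hp : p ∈ t) : p.snd = k ∨ p.snd = k + 1 := by
  rcases ht with ⟨-, -, s, -, h, -⟩ | ⟨-, -, s, -, h, -⟩
  · obtain ⟨v, -, rfl | rfl⟩ := h p hp <;> simp
  · rcases h p hp with ⟨v, -, rfl⟩ | ⟨u, -, w, -, -, rfl⟩ <;> simp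

theorem slabFaces_nonempty {F : Set (Finset E)} {le : E → E → Prop} {k : ℕ}
    {t : Finset (ConeSpace E)} (ht : t ∈ slabFaces F le k) : t.Nonempty := by
  rcases ht with ⟨-, h, -⟩ | ⟨-, h, -⟩ <;> exact h

/-- A simplex of the standard triangulation lies in the cone on a simplex of the base. -/
theorem slabFaces_mem_cone {F : Set (Finset E)} {le : E → E → Prop} {k : ℕ}
    {t : Finset (ConeSpace E)} (ht : t ∈ slabFaces F le k) :
    ∃ σ ∈ F, ∀ p ∈ t, p ∈ cone (convexHull ℝ (σ : Set E)) := by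
  have hk : (0 : ℝ) ≤ k := k.cast_nonneg
  rcases ht with ⟨-, -, s, hs, h, -⟩ | ⟨-, -, s, hs, h, -⟩
  all_goals
    obtain ⟨σ, hσ, hsσ⟩ := exists_face_of_stdSubdiv_iterate _ s hs
    refine ⟨σ, hσ, fun p hp => ?_⟩
  · obtain ⟨v, hv, rfl | rfl⟩ := h p hp
    · exact ⟨_, hk, v, hsσ hv, rfl⟩
    · exact ⟨_, by positivity, v, hsσ hv, rfl⟩
  · rcases h p hp with ⟨v, hv, rfl⟩ | ⟨u, hu, w, hw, -, rfl⟩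
    · exact ⟨_, hk, v, hsσ hv, rfl⟩
    · exact ⟨_, by positivity, _, (convex_convexHull ℝ _).midpoint_mem (hsσ hu) (hsσ hw), rfl⟩

variable [CompleteSpace E] {X : Geometry.SimplicialComplex ℝ E} {le : E → E → Prop}

/-- Barycentric coordinates `lam z p` of the points `z` of height at least `1` of the cone on `X`
with respect to the standard triangulation, together with the simplices `s z` spanned by the
vertices of positive weight. The diameter of the simplices is controlled by `D`, and the variation
of the coordinates by `Q`. -/
structure ConeWeights (X : Geometry.SimplicialComplex ℝ E) (le : E → E → Prop) (D Q : ℝ)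
    (s : ConeSpace E → Finset (ConeSpace E)) (lam : ConeSpace E → ConeSpace E → ℝ) : Prop where
  face : ∀ z ∈ coneAbove 1 X.space, ∃ k, 1 ≤ k ∧ s z ∈ slabFaces X.faces le k
  nonneg : ∀ z ∈ coneAbove 1 X.space, ∀ p, 0 ≤ lam z p
  mem_iff : ∀ z ∈ coneAbove 1 X.space, ∀ p, p ∈ s z ↔ lam z p ≠ 0
  sum_eq_one : ∀ z ∈ coneAbove 1 X.space, ∑ p ∈ s z, lam z p = 1
  mem_cone : ∀ z ∈ coneAbove 1 X.space, ∀ σ ∈ X.faces, z ∈ cone (convexHull ℝ (σ : Set E)) →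
    ∀ p ∈ s z, p ∈ cone (convexHull ℝ (σ : Set E))
  dist_le : ∀ z ∈ coneAbove 1 X.space, ∀ p ∈ s z, dist p z ≤ D
  affine : ∀ k, 1 ≤ k → ∀ t ∈ slabFaces X.faces le k, ∀ c : ConeSpace E → ℝ, (∀ p ∈ t, 0 ≤ c p) →
    ∑ p ∈ t, c p = 1 → ∑ p ∈ t, c p • p ∈ coneAbove 1 X.space ∧
      (∀ q ∈ t, lam (∑ p ∈ t, c p • p) q = c q) ∧ ∀ q, q ∉ t → lam (∑ p ∈ t, c p • p) q = 0
  lipschitz : ∀ z ∈ coneAbove 1 X.space, ∀ z' ∈ coneAbove 1 X.space, dist z z' ≤ 1 →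
    ∀ u : Finset (ConeSpace E), ∑ p ∈ u, |lam z p - lam z' p| ≤ Q * dist z z'

/-- The point of the base of the cone which lies below a given point. -/
noncomputable def basePoint (z : ConeSpace E) : E := z.snd⁻¹ • z.fst

/-- The weights at a point are supported on a simplex of its slab which lies near the point, and
in the cone over any simplex of the base whose cone contains the point. -/
theorem exists_slabLaw_support (hX : X.faces.Finite) (hle : IsLocalOrder X.faces le) {c R : ℝ}
    (hc : ∀ g, IsMonoStep (X.faces, le) g → VariationLE g c) (hR : ∀ x ∈ X.space, ‖x‖ ≤ R)
    {k : ℕ} (hk : 1 ≤ k) {z : ConeSpace E} (h0 : k ≤ z.snd) (h1 : z.snd ≤ k + 1) {σ : Finset E}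
    (hσ : σ ∈ X.faces) (hz : z ∈ cone (convexHull ℝ (σ : Set E))) {g : SimpleFunc ℝ E}
    (hg : IsMonoStep (X.faces, le) g) (hgm : mean g = basePoint z) :
    ∃ t ∈ slabFaces X.faces le k,
      (∀ p ∈ t, p ∈ cone (convexHull ℝ (σ : Set E)) ∧ dist p z ≤ 2 * c + (R + 1)) ∧
      ∀ T, t ⊆ T → ∀ φ : ConeSpace E → ℝ, slabLaw k z.snd (slabPair k g) φ =
        ∑ p ∈ T, slabLaw k z.snd (slabPair k g) (fun q => ind (q = p)) * φ p := by
  have hk' : (1 : ℝ) ≤ k := by exact_mod_cast hk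
  have hF := isTame_simplicialComplex hX hle
  obtain ⟨hx, hz'⟩ := eq_conePoint_of_mem_cone hz (by linarith)
  obtain ⟨g', hg', hgσ, hgm'⟩ := exists_isMonoStep hle hσ hx
  have hd := hF.unique g g' hg hg' (by rw [hgm, hgm']; rfl)
  obtain ⟨t, ht, htt, htp⟩ := exists_slabFace_support hk hF hg' hgσ (hc g' hg') h0 h1
  refine ⟨t, ht, fun p hp => ⟨(htp p hp).1, ?_⟩, fun T hT φ => ?_⟩
  · have h2 := (htp p hp).2
    rw [hgm', ← hz'] at h2
    have h3 := hR _ (Geometry.SimplicialComplex.convexHull_subset_space hσ hx)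
    linarith
  · rw [slabLaw_congr hd φ, slabLaw_eq_sum (fun u => (htt u).trans hT) φ]
    refine Finset.sum_congr rfl fun p _ => ?_
    rw [slabLaw_congr hd, smul_eq_mul]

omit [CompleteSpace E] in
/-- The projection to the base contracts distances at height `h` by a factor of order `1 / h`. -/
theorem snd_mul_norm_basePoint_sub_le {R : ℝ} {z z' : ConeSpace E} (hz : 0 < z.snd)
    (hz' : 0 < z'.snd) (hR : ‖basePoint z'‖ ≤ R) :
    z.snd * ‖basePoint z - basePoint z'‖ ≤ (1 + R) * dist z z' := by
  have e : z.snd • (basePoint z - basePoint z') =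
      (z.fst - z'.fst) + (z'.snd - z.snd) • basePoint z' := by
    rw [smul_sub, sub_smul]
    simp only [basePoint]
    rw [smul_inv_smul₀ hz.ne', smul_inv_smul₀ hz'.ne']
    abel
  have h1 := norm_fst_sub_le_dist z z'
  have h2 := abs_snd_sub_le_dist z z'
  calc z.snd * ‖basePoint z - basePoint z'‖ = ‖z.snd • (basePoint z - basePoint z')‖ := by
        rw [norm_smul, Real.norm_of_nonneg hz.le]
    _ ≤ ‖z.fst - z'.fst‖ + |z'.snd - z.snd| * ‖basePoint z'‖ := by
        rw [e, ← Real.norm_eq_abs, ← norm_smul]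
        exact norm_add_le _ _
    _ ≤ dist z z' + dist z z' * R := by
        rw [abs_sub_comm]
        exact add_le_add h1 (mul_le_mul h2 hR (norm_nonneg _) dist_nonneg)
    _ = (1 + R) * dist z z' := by ring

omit [CompleteSpace E] in
/-- Within a slab, the weights are Lipschitz with a constant independent of the slab: the `n`-fold
subdivision contributes a factor `2 ^ n`, which is compensated by the contraction of the projection
to the base at heights of at least `2 ^ n`. -/
theorem abs_slabLaw_sub_le {C R : ℝ} (hC0 : 0 ≤ C)
    (hC : ∀ g g', IsMonoStep (X.faces, le) g → IsMonoStep (X.faces, le) g' →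
      stepDist g g' ≤ C * ‖mean g - mean g'‖) {k : ℕ} (hk : 1 ≤ k) {z z' : ConeSpace E}
    (h0 : k ≤ z.snd) (h1 : z.snd ≤ k + 1) (h0' : k ≤ z'.snd) (h1' : z'.snd ≤ k + 1)
    (hR : ‖basePoint z'‖ ≤ R) {g g' : SimpleFunc ℝ E} (hg : IsMonoStep (X.faces, le) g)
    (hg' : IsMonoStep (X.faces, le) g') (hgm : mean g = basePoint z)
    (hgm' : mean g' = basePoint z') {φ : ConeSpace E → ℝ} (hφ : ∀ p, |φ p| ≤ 1) :
    |slabLaw k z.snd (slabPair k g) φ - slabLaw k z'.snd (slabPair k g') φ| ≤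
      (9 + 8 * C * (1 + R)) * dist z z' := by
  have hk' : (1 : ℝ) ≤ k := by exact_mod_cast hk
  have e1 := norm_slabLaw_sub_le hk h0 h1 h0' h1' (slabPair k g) (slabPair k g')
    (φ := φ) (R := 1) fun p => by rw [Real.norm_eq_abs]; exact hφ p
  have e2 := stepDist_slabPair_le k g g'
  have e3 := hC g g' hg hg'
  have e4 : (2 : ℝ) ^ Nat.log 2 k ≤ z.snd := le_trans (by
    exact_mod_cast Nat.pow_log_le_self 2 (by omega : k ≠ 0)) h0
  have e5 := snd_mul_norm_basePoint_sub_le (by linarith : 0 < z.snd) (by linarith) hR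
  have e6 := abs_snd_sub_le_dist z z'
  rw [hgm, hgm'] at e3
  have e7 : (2 : ℝ) ^ Nat.log 2 k * stepDist g g' ≤ C * ((1 + R) * dist z z') :=
    calc (2 : ℝ) ^ Nat.log 2 k * stepDist g g'
        ≤ z.snd * (C * ‖basePoint z - basePoint z'‖) :=
          mul_le_mul e4 e3 (stepDist_nonneg _ _) (by linarith)
      _ = C * (z.snd * ‖basePoint z - basePoint z'‖) := by ring
      _ ≤ C * ((1 + R) * dist z z') := mul_le_mul_of_nonneg_left e5 hC0
  rw [Real.norm_eq_abs] at e1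
  linarith

/-- Existence of barycentric coordinates. -/
theorem exists_coneWeights (hX : X.faces.Finite) (hle : IsLocalOrder X.faces le) :
    ∃ (D Q : ℝ) (s : ConeSpace E → Finset (ConeSpace E)) (lam : ConeSpace E → ConeSpace E → ℝ),
      0 ≤ D ∧ 0 ≤ Q ∧ ConeWeights X le D Q s lam := by
  classical
  obtain ⟨c, hc0, hc⟩ := exists_variationLE hX hle
  obtain ⟨C, hC0, hC⟩ := exists_stepDist_le hX hle
  obtain ⟨R, hR0, hR⟩ := exists_norm_bound hX
  have hF := isTame_simplicialComplex hX hle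
  have hrep : ∀ x : E, ∃ g : SimpleFunc ℝ E, x ∈ X.space →
      IsMonoStep (X.faces, le) g ∧ mean g = x := by
    intro x
    by_cases hx : x ∈ X.space
    · obtain ⟨σ, hσ, hxσ⟩ := Geometry.SimplicialComplex.mem_space_iff.1 hx
      obtain ⟨g, hg, -, hgm⟩ := exists_isMonoStep hle hσ hxσ
      exact ⟨g, fun _ => ⟨hg, hgm⟩⟩
    · exact ⟨0, fun h => absurd h hx⟩
  choose rep hrep using hrep
  let Λ : ℕ → ConeSpace E → (ConeSpace E → ℝ) → ℝ := fun k z φ =>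
    slabLaw k z.snd (slabPair k (rep (basePoint z))) φ
  let lam : ConeSpace E → ConeSpace E → ℝ := fun z p => Λ ⌊z.snd⌋₊ z fun q => ind (q = p)
  have hbase : ∀ z ∈ cone X.space, 0 < z.snd → basePoint z ∈ X.space := fun z hz h =>
    (eq_conePoint_of_mem_cone hz h).1
  have hfl : ∀ z ∈ coneAbove 1 X.space,
      1 ≤ ⌊z.snd⌋₊ ∧ (⌊z.snd⌋₊ : ℝ) ≤ z.snd ∧ z.snd ≤ ⌊z.snd⌋₊ + 1 := fun z hz =>
    ⟨Nat.le_floor (by simpa using hz.2), Nat.floor_le (by linarith [hz.2]),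
      (Nat.lt_floor_add_one _).le⟩
  have hsupp : ∀ z ∈ coneAbove 1 X.space, ∀ σ ∈ X.faces, z ∈ cone (convexHull ℝ (σ : Set E)) →
      ∃ t ∈ slabFaces X.faces le ⌊z.snd⌋₊,
        (∀ p ∈ t, p ∈ cone (convexHull ℝ (σ : Set E)) ∧ dist p z ≤ 2 * c + (R + 1)) ∧
        ∀ T, t ⊆ T → ∀ φ : ConeSpace E → ℝ, Λ ⌊z.snd⌋₊ z φ = ∑ p ∈ T, lam z p * φ p := by
    intro z hz σ hσ hzσ
    obtain ⟨h1, h2, h3⟩ := hfl z hz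
    obtain ⟨hg, hgm⟩ := hrep _ (hbase z hz.1 (by linarith [hz.2]))
    exact exists_slabLaw_support hX hle hc hR h1 h2 h3 hσ hzσ hg hgm
  have hsupp' : ∀ z, ∃ t : Finset (ConeSpace E), z ∈ coneAbove 1 X.space →
      t ∈ slabFaces X.faces le ⌊z.snd⌋₊ ∧ (∀ p ∈ t, dist p z ≤ 2 * c + (R + 1)) ∧
        ∀ T, t ⊆ T → ∀ φ : ConeSpace E → ℝ, Λ ⌊z.snd⌋₊ z φ = ∑ p ∈ T, lam z p * φ p := by
    intro z
    by_cases hz : z ∈ coneAbove 1 X.space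
    · obtain ⟨σ, hσ, hzσ⟩ := mem_cone_space_iff.1 hz.1
      obtain ⟨t, h1, h2, h3⟩ := hsupp z hz σ hσ hzσ
      exact ⟨t, fun _ => ⟨h1, fun p hp => (h2 p hp).2, h3⟩⟩
    · exact ⟨∅, fun h => absurd h hz⟩
  choose S hS using hsupp'
  have hout : ∀ z ∈ coneAbove 1 X.space, ∀ t : Finset (ConeSpace E),
      (∀ T, t ⊆ T → ∀ φ : ConeSpace E → ℝ, Λ ⌊z.snd⌋₊ z φ = ∑ p ∈ T, lam z p * φ p) →
      ∀ p, p ∉ t → lam z p = 0 := by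
    intro z hz t ht p hp
    refine (ht t subset_rfl fun q => ind (q = p)).trans (Finset.sum_eq_zero fun q hq => ?_)
    rw [ind_neg (by rintro rfl; exact hp hq), mul_zero]
  have hone : ∀ z ∈ coneAbove 1 X.space, ∑ p ∈ S z, lam z p = 1 := by
    intro z hz
    obtain ⟨h1, h2, h3⟩ := hfl z hz
    have := (hS z hz).2.2 _ subset_rfl fun _ => 1
    simp only [mul_one] at this
    rw [← this]
    exact slabLaw_one h1 h2 h3 _
  have hnn : ∀ z ∈ coneAbove 1 X.space, ∀ p, 0 ≤ lam z p := fun z hz p =>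
    slabLaw_nonneg (by linarith [hz.2]) _ fun _ => ind_nonneg _
  let s : ConeSpace E → Finset (ConeSpace E) := fun z => (S z).filter fun p => lam z p ≠ 0
  have hmem : ∀ z ∈ coneAbove 1 X.space, ∀ p, p ∈ s z ↔ lam z p ≠ 0 := by
    intro z hz p
    refine ⟨fun h => (Finset.mem_filter.1 h).2, fun h => Finset.mem_filter.2 ⟨?_, h⟩⟩
    by_contra hp
    exact h (hout z hz _ (hS z hz).2.2 p hp)
  have hsum : ∀ z ∈ coneAbove 1 X.space, ∑ p ∈ s z, lam z p = 1 := fun z hz => by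
    rw [Finset.sum_filter_ne_zero, hone z hz]
  -- two points which may be described in the same slab
  have hslab : ∀ k : ℕ, 1 ≤ k → ∀ z ∈ cone X.space, ∀ z' ∈ cone X.space, k ≤ z.snd → z.snd ≤ k + 1 →
      k ≤ z'.snd → z'.snd ≤ k + 1 → ∀ φ : ConeSpace E → ℝ, (∀ p, |φ p| ≤ 1) →
      |Λ k z φ - Λ k z' φ| ≤ (9 + 8 * C * (1 + R)) * dist z z' := by
    intro k hk z hz z' hz' h0 h1 h0' h1' φ hφ
    have hk' : (1 : ℝ) ≤ k := by exact_mod_cast hk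
    have hb := hbase z hz (by linarith)
    have hb' := hbase z' hz' (by linarith)
    exact abs_slabLaw_sub_le hC0 hC hk h0 h1 h0' h1' (hR _ hb') (hrep _ hb).1 (hrep _ hb').1
      (hrep _ hb).2 (hrep _ hb').2 hφ
  have hQ0 : 0 ≤ 9 + 8 * C * (1 + R) := by positivity
  have hadj : ∀ z ∈ coneAbove 1 X.space, ∀ z' ∈ coneAbove 1 X.space, dist z z' ≤ 1 →
      z.snd ≤ z'.snd → ∀ φ : ConeSpace E → ℝ, (∀ p, |φ p| ≤ 1) →
      |Λ ⌊z.snd⌋₊ z φ - Λ ⌊z'.snd⌋₊ z' φ| ≤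
        (9 + 8 * C * (1 + R)) * (2 * R + 3) * dist z z' := by
    intro z hz z' hz' hzz hsn φ hφ
    obtain ⟨h1, h2, h3⟩ := hfl z hz
    obtain ⟨h1', h2', h3'⟩ := hfl z' hz'
    have hd := abs_snd_sub_le_dist z z'
    have hz0 : 0 < z.snd := by linarith [hz.2]
    have hlt := Nat.lt_floor_add_one z.snd
    set k := ⌊z.snd⌋₊ with hk
    have hle1 : ⌊z'.snd⌋₊ ≤ k + 1 := by
      rw [hk, ← Nat.floor_add_one hz0.le]
      exact Nat.floor_le_floor (by linarith [(abs_le.1 hd).1])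
    have hle2 : k ≤ ⌊z'.snd⌋₊ := Nat.floor_le_floor hsn
    have hkk : ⌊z'.snd⌋₊ = k ∨ ⌊z'.snd⌋₊ = k + 1 := by omega
    rcases hkk with h | h
    · rw [h] at h2' h3' ⊢
      refine (hslab k h1 z hz.1 z' hz'.1 h2 h3 h2' h3' φ hφ).trans
        (mul_le_mul_of_nonneg_right (le_mul_of_one_le_right hQ0 (by linarith)) dist_nonneg)
    · rw [h] at h2' h3' ⊢
      rw [Nat.cast_succ] at h2' h3'
      -- pass through a point at the height where the two slabs meet
      have ha : 0 < ((k : ℝ) + 1) / z.snd := by positivity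
      set z'' : ConeSpace E := (((k : ℝ) + 1) / z.snd) • z with hz''
      have hs : z''.snd = k + 1 := by
        rw [hz'', WithLp.smul_snd, smul_eq_mul, div_mul_cancel₀ _ hz0.ne']
      have hc'' : z'' ∈ cone X.space := smul_mem_cone hz.1 ha.le
      have hmeet : Λ k z'' φ = Λ (k + 1) z'' φ := by
        have := slabLaw_top_eq_bottom k (rep (basePoint z'')) φ
        simp only [Λ, hs]
        rw [Nat.cast_succ] at this
        exact this
      have hd' : dist z z'' ≤ (R + 1) * dist z z' := by
        have e1 : z - z'' = (1 - ((k : ℝ) + 1) / z.snd) • z := by rw [sub_smul, one_smul]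
        have e2 := norm_le_of_mem_cone hR hz.1
        have e3 : |1 - ((k : ℝ) + 1) / z.snd| * z.snd = k + 1 - z.snd := by
          rw [abs_of_nonpos (by rw [sub_nonpos, one_le_div hz0]; exact h3)]
          field_simp
          ring
        have e4 : (k : ℝ) + 1 - z.snd ≤ dist z z' := by linarith [(abs_le.1 hd).1]
        rw [dist_eq_norm, e1, norm_smul, Real.norm_eq_abs]
        calc |1 - ((k : ℝ) + 1) / z.snd| * ‖z‖
            ≤ |1 - ((k : ℝ) + 1) / z.snd| * ((R + 1) * z.snd) :=
              mul_le_mul_of_nonneg_left e2 (abs_nonneg _)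
          _ = (R + 1) * (|1 - ((k : ℝ) + 1) / z.snd| * z.snd) := by ring
          _ ≤ (R + 1) * dist z z' := by
              rw [e3]
              exact mul_le_mul_of_nonneg_left e4 (by linarith)
      have hd'' : dist z'' z' ≤ (R + 2) * dist z z' := by
        have := dist_triangle z'' z z'
        rw [dist_comm z'' z] at this
        linarith
      have b1 := hslab k h1 z hz.1 z'' hc'' h2 h3 (by rw [hs]; linarith) hs.le φ hφ
      have b2 := hslab (k + 1) (by omega) z'' hc'' z' hz'.1 (by rw [hs]; push_cast; rfl)
        (by rw [hs]; push_cast; linarith) (by push_cast; exact h2') (by push_cast; exact h3') φ hφ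
      rw [← hmeet] at b2
      calc |Λ k z φ - Λ (k + 1) z' φ|
          ≤ |Λ k z φ - Λ k z'' φ| + |Λ k z'' φ - Λ (k + 1) z' φ| := abs_sub_le _ _ _
        _ ≤ (9 + 8 * C * (1 + R)) * ((R + 1) * dist z z') +
            (9 + 8 * C * (1 + R)) * ((R + 2) * dist z z') :=
          add_le_add (b1.trans (mul_le_mul_of_nonneg_left hd' hQ0))
            (b2.trans (mul_le_mul_of_nonneg_left hd'' hQ0))
        _ = _ := by ring
  have hlip : ∀ z ∈ coneAbove 1 X.space, ∀ z' ∈ coneAbove 1 X.space, dist z z' ≤ 1 →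
      ∀ φ : ConeSpace E → ℝ, (∀ p, |φ p| ≤ 1) →
      |Λ ⌊z.snd⌋₊ z φ - Λ ⌊z'.snd⌋₊ z' φ| ≤
        (9 + 8 * C * (1 + R)) * (2 * R + 3) * dist z z' := by
    intro z hz z' hz' hzz φ hφ
    rcases le_total z.snd z'.snd with h | h
    · exact hadj z hz z' hz' hzz h φ hφ
    · rw [abs_sub_comm, dist_comm]
      exact hadj z' hz' z hz (by rwa [dist_comm]) h φ hφ
  refine ⟨2 * c + (R + 1), (9 + 8 * C * (1 + R)) * (2 * R + 3), s, lam, by positivity,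
    by positivity, ?_, hnn, hmem, hsum, ?_, fun z hz p hp =>
      (hS z hz).2.1 p (Finset.mem_filter.1 hp).1, ?_, ?_⟩
  · refine fun z hz => ⟨_, (hfl z hz).1, slabFaces_subset_hereditary (hS z hz).1
      (Finset.filter_subset _ _) (Finset.nonempty_iff_ne_empty.2 fun h => ?_)⟩
    have := hsum z hz
    rw [show s z = ∅ from h] at this
    simp at this
  · intro z hz σ hσ hzσ p hp
    obtain ⟨t, -, h2, h3⟩ := hsupp z hz σ hσ hzσ
    refine (h2 p ?_).1
    by_contra hpt
    exact (hmem z hz p).1 hp (hout z hz t h3 p hpt)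
  · intro k hk t ht c hc hc1
    have hk' : (1 : ℝ) ≤ k := by exact_mod_cast hk
    obtain ⟨σ, hσ, hcone⟩ := slabFaces_mem_cone ht
    set z := ∑ p ∈ t, c p • p with hz
    have hzσ : z ∈ cone (convexHull ℝ (σ : Set E)) :=
      (convex_cone_convexHull σ).sum_mem hc hc1 hcone
    have hzX : z ∈ cone X.space := mem_cone_space_iff.2 ⟨σ, hσ, hzσ⟩
    have hfst : z.fst = ∑ p ∈ t, c p • p.fst := by
      rw [hz, fst_sum]
      rfl
    have hsnd : z.snd = ∑ p ∈ t, c p * p.snd := by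
      rw [hz, snd_sum]
      rfl
    have hlo : (k : ℝ) ≤ z.snd := by
      have h1 : ∑ p ∈ t, c p * (k : ℝ) ≤ ∑ p ∈ t, c p * p.snd :=
        Finset.sum_le_sum fun p hp => mul_le_mul_of_nonneg_left
          (by rcases slabFaces_snd ht hp with h | h <;> linarith) (hc p hp)
      rwa [← Finset.sum_mul, hc1, one_mul, ← hsnd] at h1
    have hhi : z.snd ≤ k + 1 := by
      have h1 : ∑ p ∈ t, c p * p.snd ≤ ∑ p ∈ t, c p * ((k : ℝ) + 1) :=
        Finset.sum_le_sum fun p hp => mul_le_mul_of_nonneg_left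
          (by rcases slabFaces_snd ht hp with h | h <;> linarith) (hc p hp)
      rwa [← Finset.sum_mul, hc1, one_mul, ← hsnd] at h1
    have hz1 : z ∈ coneAbove 1 X.space := ⟨hzX, hk'.trans hlo⟩
    obtain ⟨hg, hgm⟩ := hrep _ (hbase z hzX (by linarith))
    have hval : ∀ φ : ConeSpace E → ℝ, Λ ⌊z.snd⌋₊ z φ = ∑ p ∈ t, c p * φ p := by
      intro φ
      have h1 : Λ k z φ = ∑ p ∈ t, c p • φ p :=
        slabLaw_slabFaces hF hk ht hc hc1 hg hsnd.symm (by rw [hgm, ← hfst]; rfl) φ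
      rcases hhi.lt_or_eq with h | h
      · rwa [(Nat.floor_eq_iff (by linarith)).2 ⟨hlo, h⟩]
      · have h2 : ⌊z.snd⌋₊ = k + 1 := by rw [h]; exact_mod_cast Nat.floor_natCast (k + 1)
        have h3 := slabLaw_top_eq_bottom k (rep (basePoint z)) φ
        rw [Nat.cast_succ, ← h] at h3
        rw [h2]
        exact h3.symm.trans h1
    refine ⟨hz1, fun q hq => ?_, fun q hq => ?_⟩
    · refine (hval _).trans ?_
      rw [Finset.sum_eq_single_of_mem q hq fun p _ hp => by rw [ind_neg hp, mul_zero],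
        ind_pos rfl, mul_one]
    · refine (hval _).trans (Finset.sum_eq_zero fun p hp => ?_)
      rw [ind_neg (by rintro rfl; exact hq hp), mul_zero]
  · intro z hz z' hz' hzz u
    have h1 := hlip z hz z' hz' hzz (fun p => SignType.sign (lam z p - lam z' p)) fun p => by
      rcases lt_trichotomy (lam z p - lam z' p) 0 with h | h | h <;> simp [h]
    have hsub1 : S z ⊆ S z ∪ S z' ∪ u := fun p hp => by simp [hp]
    have hsub2 : S z' ⊆ S z ∪ S z' ∪ u := fun p hp => by simp [hp]
    rw [(hS z hz).2.2 _ hsub1, (hS z' hz').2.2 _ hsub2, ← Finset.sum_sub_distrib] at h1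
    simp only [← sub_mul, self_mul_sign] at h1
    exact (Finset.sum_le_sum_of_subset_of_nonneg Finset.subset_union_right
      fun _ _ _ => abs_nonneg _).trans ((le_abs_self _).trans h1)

end Weights

/-! ### Simplicial approximation -/

section Simplicial

variable {E : Type*} [NormedAddCommGroup E] [InnerProductSpace ℝ E]
variable {X : Geometry.SimplicialComplex ℝ E} {le : E → E → Prop} {D Q : ℝ}
variable {s : ConeSpace E → Finset (ConeSpace E)} {lam : ConeSpace E → ConeSpace E → ℝ}

theorem ConeWeights.nonempty (h : ConeWeights X le D Q s lam) {z : ConeSpace E}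
    (hz : z ∈ coneAbove 1 X.space) : (s z).Nonempty := by
  obtain ⟨k, -, hk⟩ := h.face z hz
  exact slabFaces_nonempty hk

theorem ConeWeights.dist_le_of_mem (h : ConeWeights X le D Q s lam) {k : ℕ} (hk : 1 ≤ k)
    {t : Finset (ConeSpace E)} (ht : t ∈ slabFaces X.faces le k) {p q : ConeSpace E} (hp : p ∈ t)
    (hq : q ∈ t) : dist p q ≤ 2 * D := by
  have hcard : (0 : ℝ) < t.card := by exact_mod_cast Finset.card_pos.2 ⟨p, hp⟩
  obtain ⟨hz, h1, -⟩ := h.affine k hk t ht (fun _ => 1 / t.card) (fun _ _ => by positivity)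
    (by rw [Finset.sum_const, nsmul_eq_mul, mul_one_div_cancel hcard.ne'])
  -- all vertices have positive weight at the barycenter
  have h2 : ∀ p ∈ t, dist p (∑ p ∈ t, (1 / (t.card : ℝ)) • p) ≤ D := fun p hp =>
    h.dist_le _ hz p ((h.mem_iff _ hz p).2 (by rw [h1 p hp]; positivity))
  have h3 := dist_triangle_right p q (∑ p ∈ t, (1 / (t.card : ℝ)) • p)
  linarith [h2 p hp, h2 q hq]

/-- The vertices of a simplex of the standard triangulation are affinely independent, since
barycentric coordinates are unique. -/
theorem ConeWeights.card_le [FiniteDimensional ℝ E] (h : ConeWeights X le D Q s lam) {k : ℕ}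
    (hk : 1 ≤ k) {t : Finset (ConeSpace E)} (ht : t ∈ slabFaces X.faces le k) :
    t.card ≤ Module.finrank ℝ (ConeSpace E) + 1 := by
  by_contra! hlt
  obtain ⟨f, hf1, hf0, x, hx, hfx⟩ :=
    Module.exists_nontrivial_relation_sum_zero_of_finrank_succ_lt_card hlt
  have hcard : (0 : ℝ) < t.card := by exact_mod_cast Finset.card_pos.2 ⟨x, hx⟩
  set B := ∑ p ∈ t, |f p| with hB
  have hB0 : 0 ≤ B := Finset.sum_nonneg fun _ _ => abs_nonneg _
  set δ : ℝ := 1 / (t.card * (1 + B)) with hδ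
  have hδ0 : 0 < δ := by positivity
  have hδB : δ * (1 + B) = 1 / t.card := by
    rw [hδ]
    field_simp
  obtain ⟨-, h1, -⟩ := h.affine k hk t ht (fun _ => 1 / t.card) (fun _ _ => by positivity)
    (by rw [Finset.sum_const, nsmul_eq_mul, mul_one_div_cancel hcard.ne'])
  obtain ⟨-, h2, -⟩ := h.affine k hk t ht (fun p => 1 / t.card + δ * f p)
    (fun p hp => by
      have h3 : |f p| ≤ B := Finset.single_le_sum (f := fun p => |f p|)
        (fun _ _ => abs_nonneg _) hp
      have h4 : -(1 + B) ≤ f p := by linarith [neg_abs_le (f p)]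
      have h5 := mul_le_mul_of_nonneg_left h4 hδ0.le
      linarith)
    (by rw [Finset.sum_add_distrib, ← Finset.mul_sum, hf0, mul_zero, add_zero, Finset.sum_const,
      nsmul_eq_mul, mul_one_div_cancel hcard.ne'])
  have h3 : ∑ p ∈ t, (1 / (t.card : ℝ) + δ * f p) • p = ∑ p ∈ t, (1 / (t.card : ℝ)) • p := by
    simp only [add_smul, mul_smul, Finset.sum_add_distrib, ← Finset.smul_sum, hf1, smul_zero,
      add_zero]
  have h4 := h2 x hx
  rw [h3, h1 x hx] at h4
  have h5 : δ * f x = 0 := by linarith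
  exact (mul_ne_zero hδ0.ne' hfx) h5

/-- Every point can be assigned a vertex in whose open star the whole ball of a fixed radius
around the point is contained. -/
theorem ConeWeights.exists_vertex [FiniteDimensional ℝ E] (h : ConeWeights X le D Q s lam)
    (hQ : 0 ≤ Q) : ∃ (ε : ℝ) (w : ConeSpace E → ConeSpace E), 0 < ε ∧
      ∀ z ∈ coneAbove 1 X.space, w z ∈ s z ∧
        ∀ z' ∈ coneAbove 1 X.space, dist z z' < ε → w z ∈ s z' := by
  set M : ℝ := Module.finrank ℝ (ConeSpace E) + 1 with hM
  have hM0 : 0 < M := by positivity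
  have hw : ∀ z, ∃ w, z ∈ coneAbove 1 X.space → w ∈ s z ∧ 1 / M ≤ lam z w := by
    intro z
    by_cases hz : z ∈ coneAbove 1 X.space
    · obtain ⟨k, hk, ht⟩ := h.face z hz
      have hne := slabFaces_nonempty ht
      have hcard : (0 : ℝ) < (s z).card := by exact_mod_cast hne.card_pos
      have hle : ((s z).card : ℝ) ≤ M := by
        rw [hM]
        exact_mod_cast h.card_le hk ht
      obtain ⟨w, hws, hw⟩ := Finset.exists_le_of_sum_le (f := fun _ => 1 / ((s z).card : ℝ))
        (g := lam z) hne
        (by rw [h.sum_eq_one z hz, Finset.sum_const, nsmul_eq_mul, mul_one_div_cancel hcard.ne'])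
      exact ⟨w, fun _ => ⟨hws, (one_div_le_one_div_of_le hcard hle).trans hw⟩⟩
    · exact ⟨0, fun h => absurd h hz⟩
  choose w hw using hw
  refine ⟨min 1 (1 / (M * (Q + 1))), w, by positivity, fun z hz => ⟨(hw z hz).1, ?_⟩⟩
  intro z' hz' hd
  have h1 := h.lipschitz z hz z' hz' (hd.le.trans (min_le_left _ _)) {w z}
  rw [Finset.sum_singleton] at h1
  have h2 : (Q + 1) * dist z z' < 1 / M := by
    have := mul_lt_mul_of_pos_left (hd.trans_le (min_le_right _ _)) (by linarith : 0 < Q + 1)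
    refine this.trans_eq ?_
    field_simp
  rw [h.mem_iff z' hz']
  intro h0
  rw [h0, sub_zero] at h1
  have h3 := (hw z hz).2
  have h4 := le_abs_self (lam z (w z))
  have h5 : 0 ≤ dist z z' := dist_nonneg
  linarith

/-- The extension of a map on vertices which is affine on simplices. -/
noncomputable def interpolate {W : Type*} [AddCommGroup W] [Module ℝ W]
    (s : ConeSpace E → Finset (ConeSpace E)) (lam : ConeSpace E → ConeSpace E → ℝ)
    (f : ConeSpace E → W) (z : ConeSpace E) : W := ∑ p ∈ s z, lam z p • f p

section Interpolate

variable {W : Type*} [NormedAddCommGroup W] [NormedSpace ℝ W]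

theorem ConeWeights.interpolate_mem (h : ConeWeights X le D Q s lam) {z : ConeSpace E}
    (hz : z ∈ coneAbove 1 X.space) {C : Set W} (hC : Convex ℝ C) {f : ConeSpace E → W}
    (hf : ∀ p ∈ s z, f p ∈ C) : interpolate s lam f z ∈ C :=
  hC.sum_mem (fun p _ => h.nonneg z hz p) (h.sum_eq_one z hz) hf

theorem ConeWeights.interpolate_affine (h : ConeWeights X le D Q s lam) {k : ℕ} (hk : 1 ≤ k)
    {t : Finset (ConeSpace E)} (ht : t ∈ slabFaces X.faces le k) {c : ConeSpace E → ℝ}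
    (hc : ∀ p ∈ t, 0 ≤ c p) (hc1 : ∑ p ∈ t, c p = 1) (f : ConeSpace E → W) :
    interpolate s lam f (∑ p ∈ t, c p • p) = ∑ p ∈ t, c p • f p := by
  obtain ⟨hz, h1, h2⟩ := h.affine k hk t ht c hc hc1
  have hsub : s (∑ p ∈ t, c p • p) ⊆ t := fun p hp => by
    by_contra hpt
    exact (h.mem_iff _ hz p).1 hp (h2 p hpt)
  unfold interpolate
  rw [Finset.sum_subset hsub fun p _ hp => ?_]
  · exact Finset.sum_congr rfl fun p hp => by rw [h1 p hp]
  · rw [not_not.1 (mt (h.mem_iff _ hz p).2 hp), zero_smul]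

theorem ConeWeights.interpolate_vertex (h : ConeWeights X le D Q s lam) {k : ℕ} (hk : 1 ≤ k)
    {t : Finset (ConeSpace E)} (ht : t ∈ slabFaces X.faces le k) {p : ConeSpace E} (hp : p ∈ t)
    (f : ConeSpace E → W) : interpolate s lam f p = f p := by
  have := h.interpolate_affine hk (slabFaces_subset_hereditary ht
    (Finset.singleton_subset_iff.2 hp) (Finset.singleton_nonempty p)) (c := fun _ => 1)
    (by simp) (by simp) f
  simpa using this

theorem ConeWeights.dist_interpolate_le (h : ConeWeights X le D Q s lam) {z z' : ConeSpace E}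
    (hz : z ∈ coneAbove 1 X.space) (hz' : z' ∈ coneAbove 1 X.space) (hzz : dist z z' ≤ 1)
    {f : ConeSpace E → W} {y : W} {r : ℝ} (hf : ∀ p ∈ s z, dist (f p) y ≤ r)
    (hf' : ∀ p ∈ s z', dist (f p) y ≤ r) :
    dist (interpolate s lam f z) (interpolate s lam f z') ≤ r * Q * dist z z' := by
  classical
  have hr : 0 ≤ r := by
    obtain ⟨p, hp⟩ := h.nonempty hz
    exact dist_nonneg.trans (hf p hp)
  have key : ∀ x ∈ coneAbove 1 X.space, s x ⊆ s z ∪ s z' →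
      interpolate s lam f x = y + ∑ p ∈ s z ∪ s z', lam x p • (f p - y) := by
    intro x hx hsub
    have h0 : ∀ p ∈ s z ∪ s z', p ∉ s x → lam x p = 0 := fun p _ hp =>
      not_not.1 (mt (h.mem_iff x hx p).2 hp)
    simp only [smul_sub, Finset.sum_sub_distrib, ← Finset.sum_smul]
    rw [← Finset.sum_subset hsub h0, h.sum_eq_one x hx, one_smul, add_sub_cancel]
    exact Finset.sum_subset hsub fun p hp hp' => by rw [h0 p hp hp', zero_smul]
  rw [key z hz Finset.subset_union_left, key z' hz' Finset.subset_union_right, dist_add_left,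
    dist_eq_norm, ← Finset.sum_sub_distrib]
  simp only [← sub_smul]
  calc ‖∑ p ∈ s z ∪ s z', (lam z p - lam z' p) • (f p - y)‖
      ≤ ∑ p ∈ s z ∪ s z', |lam z p - lam z' p| * r := by
        refine norm_sum_le_of_le _ fun p hp => ?_
        rw [norm_smul, Real.norm_eq_abs, ← dist_eq_norm]
        refine mul_le_mul_of_nonneg_left ?_ (abs_nonneg _)
        exact (Finset.mem_union.1 hp).elim (hf p) (hf' p)
    _ ≤ (Q * dist z z') * r := by
        rw [← Finset.sum_mul]
        exact mul_le_mul_of_nonneg_right (h.lipschitz z hz z' hz' hzz _) hr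
    _ = r * Q * dist z z' := by ring

end Interpolate

variable [CompleteSpace E] [FiniteDimensional ℝ E]

/-- A coarse map of pairs between cones is close to a Lipschitz simplicial map. The target is
rescaled so much that the image of a simplex lies in a small ball; the vertices with large weight
at the images of the vertices then span a simplex. -/
theorem exists_simplicial_approximation {X X₀ Y Y₀ : Geometry.SimplicialComplex ℝ E}
    (hX : X.faces.Finite) (hY : Y.faces.Finite) (hX₀ : X₀.faces ⊆ X.faces)
    (hY₀ : Y₀.faces ⊆ Y.faces) {leX leY : E → E → Prop} (hleX : IsLocalOrder X.faces leX)
    (hleY : IsLocalOrder Y.faces leY) {φ : ConeSpace E → ConeSpace E}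
    (hφ : CoarseOn φ (cone Y.space))
    (hφp : MapsPair φ (cone Y.space) (cone Y₀.space) (cone X.space) (cone X₀.space)) :
    ∃ L : ℕ, 0 < L ∧ ∃ f : ConeSpace E → ConeSpace E,
      MapsPair f (coneAbove L Y.space) (coneAbove L Y₀.space) (cone X.space) (cone X₀.space) ∧
      LipOn f (coneAbove L Y.space) ∧ CloseOn f φ (coneAbove L Y.space) ∧
      ∃ C : ℝ, 0 < C ∧
        IsSimplicial f (coneFacesAbove L Y.faces leY) (scaleFaces C (coneFaces X.faces leX)) := by
  classical
  obtain ⟨DX, QX, sX, lamX, hDX, hQX, hwX⟩ := exists_coneWeights hX hleX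
  obtain ⟨DY, QY, sY, lamY, hDY, hQY, hwY⟩ := exists_coneWeights hY hleY
  obtain ⟨ε, w, hε, hw⟩ := hwX.exists_vertex hQX
  obtain ⟨a, b, ha, hb, hab⟩ := hφ.largeLipOn (isLipRetract_cone hY)
  obtain ⟨R, hR0, hR⟩ := exists_norm_bound hX
  set C : ℝ := (a * (2 * DY) + b) / ε + 1 with hC
  have hC0 : 0 < C := by positivity
  have hCε : a * (2 * DY) + b < C * ε := by
    rw [hC, add_mul, div_mul_cancel₀ _ hε.ne']
    linarith
  obtain ⟨ρ, hρ⟩ := ((hφ.2 (Metric.closedBall 0 ((R + 1) * C))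
    Metric.isBounded_closedBall).subset_closedBall 0)
  -- points of large height are mapped to points at which the rescaled weights are defined
  have hhigh : ∀ y ∈ cone Y.space, ρ < y.snd → C⁻¹ • φ y ∈ coneAbove 1 X.space := by
    intro y hy hyρ
    have hφy := hφp.1 hy
    refine ⟨smul_mem_cone hφy (by positivity), ?_⟩
    have h1 : (R + 1) * C < ‖φ y‖ := by
      by_contra! h
      have := hρ ⟨hy, by rwa [mem_preimage, mem_closedBall_zero_iff]⟩
      rw [mem_closedBall_zero_iff] at this
      linarith [(le_abs_self _).trans (abs_snd_le_norm y)]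
    have h2 := norm_le_of_mem_cone hR hφy
    have h3 : C < (φ y).snd := lt_of_mul_lt_mul_left (h1.trans_le h2) (by linarith)
    rw [WithLp.smul_snd, smul_eq_mul, ← div_eq_inv_mul, le_div_iff₀ hC0]
    linarith
  let L : ℕ := ⌈ρ + DY⌉₊ + 2
  have hL2 : (2 : ℝ) ≤ L := by
    simp only [L]
    push_cast
    linarith [(Nat.cast_nonneg ⌈ρ + DY⌉₊ : (0 : ℝ) ≤ ⌈ρ + DY⌉₊)]
  have hLρ : ρ + DY < L := by
    have := Nat.le_ceil (ρ + DY)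
    simp only [L]
    push_cast
    linarith
  have hL1 : ∀ {z : ConeSpace E}, z ∈ coneAbove L Y.space → z ∈ coneAbove 1 Y.space :=
    fun hz => ⟨hz.1, by linarith [hz.2]⟩
  let v : ConeSpace E → ConeSpace E := fun y => w (C⁻¹ • φ y)
  let f₀ : ConeSpace E → ConeSpace E := fun y => C • v y
  let f := interpolate sY lamY f₀
  have hcone : ∀ {K : Geometry.SimplicialComplex ℝ E}, K.faces ⊆ Y.faces →
      ∀ z ∈ coneAbove L K.space, ∀ p ∈ sY z, p ∈ cone K.space ∧ ρ < p.snd := by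
    intro K hK z hz p hp
    obtain ⟨σ, hσ, hzσ⟩ := mem_cone_space_iff.1 hz.1
    have hzY : z ∈ coneAbove 1 Y.space :=
      hL1 ⟨mem_cone_space_iff.2 ⟨σ, hK hσ, hzσ⟩, hz.2⟩
    refine ⟨mem_cone_space_iff.2 ⟨σ, hσ, hwY.mem_cone z hzY σ (hK hσ) hzσ p hp⟩, ?_⟩
    have h1 := hwY.dist_le z hzY p hp
    have h2 := (abs_le.1 (abs_snd_sub_le_dist p z)).1
    linarith [hz.2]
  have hsub : ∀ {K : Geometry.SimplicialComplex ℝ E}, K.faces ⊆ Y.faces →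
      coneAbove L K.space ⊆ coneAbove L Y.space := by
    rintro K hK z ⟨hz, hzL⟩
    obtain ⟨σ, hσ, hzσ⟩ := mem_cone_space_iff.1 hz
    exact ⟨mem_cone_space_iff.2 ⟨σ, hK hσ, hzσ⟩, hzL⟩
  -- the images of the vertices of a simplex are vertices of a simplex
  have hsimp : ∀ t : Finset (ConeSpace E), (∃ k, 1 ≤ k ∧ t ∈ slabFaces Y.faces leY k) →
      (∀ p ∈ t, p ∈ cone Y.space ∧ ρ < p.snd) → ∀ p ∈ t, ∀ q ∈ t, v p ∈ sX (C⁻¹ • φ q) := by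
    rintro t ⟨k, hk, ht⟩ hty p hp q hq
    refine (hw _ (hhigh p (hty p hp).1 (hty p hp).2)).2 _ (hhigh q (hty q hq).1 (hty q hq).2) ?_
    rw [dist_smul₀, norm_inv, Real.norm_of_nonneg hC0.le, inv_mul_lt_iff₀ hC0]
    refine lt_of_le_of_lt ((hab p (hty p hp).1 q (hty q hq).1).trans ?_) hCε
    have := mul_le_mul_of_nonneg_left (hwY.dist_le_of_mem hk ht hp hq) ha
    linarith
  have hmaps : ∀ {K K' : Geometry.SimplicialComplex ℝ E}, K.faces ⊆ Y.faces → K'.faces ⊆ X.faces →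
      MapsTo φ (cone K.space) (cone K'.space) →
      MapsTo f (coneAbove L K.space) (cone K'.space) := by
    intro K K' hK hK' hKK z hz
    have hzY := hL1 (hsub hK hz)
    obtain ⟨q, hq⟩ := hwY.nonempty hzY
    have hq' := hcone hK z hz q hq
    have hqX := hhigh q (hcone subset_rfl z (hsub hK hz) q hq).1 hq'.2
    obtain ⟨τ, hτ, hqτ⟩ := mem_cone_space_iff.1
      (smul_mem_cone (hKK hq'.1) (inv_nonneg.2 hC0.le))
    refine mem_cone_space_iff.2 ⟨τ, hτ, hwY.interpolate_mem hzY (convex_cone_convexHull τ)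
      fun p hp => smul_mem_cone ?_ hC0.le⟩
    exact hwX.mem_cone _ hqX τ (hK' hτ) hqτ _
      (hsimp _ (hwY.face z hzY) (hcone subset_rfl z (hsub hK hz)) p hp q hq)
  have hnear : ∀ z ∈ coneAbove L Y.space, ∀ p ∈ sY z,
      dist (f₀ p) (φ z) ≤ C * DX + (a * DY + b) := by
    intro z hz p hp
    obtain ⟨hpY, hpρ⟩ := hcone subset_rfl z hz p hp
    have hx := hhigh p hpY hpρ
    have h1 := hwX.dist_le _ hx _ (hw _ hx).1
    have h2 : dist (f₀ p) (φ p) ≤ C * DX := by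
      have e : φ p = C • C⁻¹ • φ p := (smul_inv_smul₀ hC0.ne' _).symm
      rw [e, dist_smul₀, Real.norm_of_nonneg hC0.le]
      refine mul_le_mul_of_nonneg_left ?_ hC0.le
      simpa only [v, smul_inv_smul₀ hC0.ne'] using h1
    have h3 := hab p hpY z hz.1
    have h4 := mul_le_mul_of_nonneg_left (hwY.dist_le z (hL1 hz) p hp) ha
    linarith [dist_triangle (f₀ p) (φ p) (φ z)]
  have hclose : CloseOn f φ (coneAbove L Y.space) := ⟨C * DX + (a * DY + b), fun z hz => by
    have := hwY.interpolate_mem (hL1 hz) (convex_closedBall (φ z) (C * DX + (a * DY + b)))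
      (f := f₀) fun p hp => Metric.mem_closedBall.2 (hnear z hz p hp)
    exact Metric.mem_closedBall.1 this⟩
  have hlip : LipOn f (coneAbove L Y.space) := by
    have hlarge : LargeLipOn φ (coneAbove L Y.space) :=
      LargeLipOn.mono ⟨a, b, ha, hb, hab⟩ coneAbove_subset
    refine (hlarge.of_close hclose).lipOn_of_local one_pos
      (C := (C * DX + (a * DY + b) + (a + b)) * QY) (by positivity) fun z hz z' hz' hd => ?_
    refine hwY.dist_interpolate_le (hL1 hz) (hL1 hz') hd.le (y := φ z)
      (fun p hp => (hnear z hz p hp).trans (by linarith)) fun p hp => ?_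
    have h1 := hab z' hz'.1 z hz.1
    rw [dist_comm z' z] at h1
    have h2 := mul_le_mul_of_nonneg_left hd.le ha
    linarith [dist_triangle (f₀ p) (φ z') (φ z), hnear z' hz' p hp]
  refine ⟨L, by omega, f, ⟨hmaps subset_rfl subset_rfl hφp.1, hmaps hY₀ hX₀ hφp.2⟩, hlip, hclose,
    C, hC0, ?_⟩
  rintro t ⟨ht, htL⟩
  have ht' : ∃ k, 1 ≤ k ∧ t ∈ slabFaces Y.faces leY k := by
    rcases ht with ⟨⟨p, hp⟩, s, -, hs⟩ | ht
    · have h1 := htL p hp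
      rcases hs p hp with rfl | ⟨v, -, rfl⟩
      · rw [WithLp.zero_snd] at h1
        linarith
      · rw [conePoint_snd] at h1
        linarith
    · exact ht
  obtain ⟨k, hk, htk⟩ := ht'
  have hfv : ∀ p ∈ t, f p = f₀ p := fun p hp => hwY.interpolate_vertex hk htk hp f₀
  obtain ⟨σ, hσ, htσ⟩ := slabFaces_mem_cone htk
  have htY : ∀ p ∈ t, p ∈ cone Y.space ∧ ρ < p.snd := fun p hp =>
    ⟨mem_cone_space_iff.2 ⟨σ, hσ, htσ p hp⟩, by linarith [htL p hp]⟩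
  constructor
  · obtain ⟨q, hq⟩ := slabFaces_nonempty htk
    obtain ⟨l, hl, hfl⟩ := hwX.face _ (hhigh q (htY q hq).1 (htY q hq).2)
    have hv : t.image v ∈ slabFaces X.faces leX l := slabFaces_subset_hereditary hfl
      (Finset.image_subset_iff.2 fun p hp => hsimp t ⟨k, hk, htk⟩ htY p hp q hq)
      ((slabFaces_nonempty htk).image v)
    refine ⟨t.image f, ⟨t.image v, Or.inr ⟨l, hl, hv⟩, ?_⟩, Finset.coe_image⟩
    rw [Finset.coe_image, Finset.coe_image, image_image]
    exact image_congr fun p hp => hfv p hp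
  · intro c hc hc1
    exact (hwY.interpolate_affine hk htk hc hc1 f₀).trans
      (Finset.sum_congr rfl fun p hp => by rw [hfv p hp])

end Simplicial

/-! ### Relative approximation of maps and of homotopies -/

section Relative

variable {E : Type*} [NormedAddCommGroup E] [InnerProductSpace ℝ E]

theorem space_mono {A B : Geometry.SimplicialComplex ℝ E} (h : A.faces ⊆ B.faces) :
    A.space ⊆ B.space := fun x hx => by
  obtain ⟨σ, hσ, hxσ⟩ := Geometry.SimplicialComplex.mem_space_iff.1 hx
  exact Geometry.SimplicialComplex.mem_space_iff.2 ⟨σ, h hσ, hxσ⟩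

theorem cone_subcomplex_regular {K A B : Geometry.SimplicialComplex ℝ E} (hK : K.faces.Finite)
    (hA : A.faces ⊆ K.faces) (hB : B.faces ⊆ K.faces) :
    ∃ ε κ : ℝ, 0 < ε ∧ 0 ≤ κ ∧ ∀ z ∈ cone A.space, ∀ z' ∈ cone B.space, dist z z' < ε →
      ∃ y ∈ cone A.space ∩ cone B.space, dist z y ≤ κ * dist z z' := by
  obtain ⟨C, hC0, hC⟩ := exists_cone_regular hK
  refine ⟨1, C, one_pos, hC0, fun z hz z' hz' _ => ?_⟩
  obtain ⟨σ, hσ, hzσ⟩ := mem_cone_space_iff.1 hz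
  obtain ⟨τ, hτ, hzτ⟩ := mem_cone_space_iff.1 hz'
  obtain ⟨y, ⟨hy, hy'⟩, hd⟩ := hC σ (hA hσ) τ (hB hτ) z hzσ z' hzτ
  exact ⟨y, ⟨mem_cone_space_iff.2 ⟨σ, hσ, hy⟩, mem_cone_space_iff.2 ⟨τ, hτ, hy'⟩⟩, hd⟩

theorem coneAbove_subcomplex_regular {K A B : Geometry.SimplicialComplex ℝ E}
    (hK : K.faces.Finite) (hA : A.faces ⊆ K.faces) (hB : B.faces ⊆ K.faces) {L : ℝ} (hL : 0 < L) :
    ∃ ε κ : ℝ, 0 < ε ∧ 0 ≤ κ ∧ ∀ z ∈ coneAbove L A.space, ∀ z' ∈ coneAbove L B.space,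
      dist z z' < ε → ∃ y ∈ coneAbove L A.space ∩ coneAbove L B.space,
        dist z y ≤ κ * dist z z' := by
  obtain ⟨ε, κ, hε, hκ, h⟩ := exists_coneAbove_regular hK hL
  refine ⟨ε, κ, hε, hκ, fun z hz z' hz' hd => ?_⟩
  obtain ⟨σ, hσ, hzσ⟩ := mem_cone_space_iff.1 hz.1
  obtain ⟨τ, hτ, hzτ⟩ := mem_cone_space_iff.1 hz'.1
  obtain ⟨y, ⟨hy, hy'⟩, hd⟩ := h σ (hA hσ) τ (hB hτ) z ⟨hzσ, hz.2⟩ z' ⟨hzτ, hz'.2⟩ hd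
  exact ⟨y, ⟨⟨mem_cone_space_iff.2 ⟨σ, hσ, hy.1⟩, hy.2⟩,
    ⟨mem_cone_space_iff.2 ⟨τ, hτ, hy'.1⟩, hy'.2⟩⟩, hd⟩

theorem isClosed_cylinder {A : Type*} [PseudoMetricSpace A] {S : Set A} {q : A → ℝ}
    (hS : IsClosed S) (hq : LipOn q S) : IsClosed (cylinder q S) := by
  obtain ⟨K, hK⟩ := hq
  obtain ⟨g, hg, hgq⟩ := hK.extend_real
  have e : cylinder q S = (Prod.fst ⁻¹' S ∩ {z : A × ℝ | 0 ≤ z.2}) ∩ {z | z.2 ≤ g z.1 + 1} := by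
    ext z
    constructor
    · rintro ⟨h1, h2, h3⟩
      exact ⟨⟨h1, h2⟩, by change z.2 ≤ g z.1 + 1; rw [← hgq h1]; exact h3⟩
    · rintro ⟨⟨h1, h2⟩, h3⟩
      exact ⟨h1, h2, by rw [hgq h1]; exact h3⟩
  rw [e]
  refine ((hS.preimage continuous_fst).inter (isClosed_le continuous_const continuous_snd)).inter
    (isClosed_le continuous_snd ?_)
  exact (hg.continuous.comp continuous_fst).add continuous_const

/-- A control function for a coarse homotopy can be replaced by a Lipschitz one. -/
theorem exists_lipschitz_control {S S₁ : Set (ConeSpace E)} {p : ConeSpace E → ℝ}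
    (hS : IsLipRetract S) (hS₁ : S₁ ⊆ S) (hp0 : ∀ y ∈ S, 0 ≤ p y) (hp : CoarseOn p S)
    (hp₁ : LipOn p S₁) :
    ∃ q : ConeSpace E → ℝ, (∀ y ∈ S, 0 ≤ q y) ∧ LipOn q S ∧ CloseOn q p S ∧
      (∀ y ∈ S₁, q y = p y) ∧ (LipOn p S → ∀ y ∈ S, q y = p y) := by
  by_cases h : LipOn p S
  · exact ⟨p, hp0, h, ⟨0, fun _ _ => (dist_self _).le⟩, fun _ _ => rfl, fun _ _ _ => rfl⟩
  have hT : IsLipRetract (Ici (0 : ℝ)) := fun _ => ⟨fun t => max t 0,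
    ⟨1, LipschitzWith.id.max_const 0⟩, fun t => le_max_right t 0, fun t ht => max_eq_left ht⟩
  obtain ⟨q, hq, hqp, hc, hq0⟩ := (hp.largeLipOn hS).exists_lipOn_eqOn hS₁ hp₁ hT hp0
  exact ⟨q, hq0, hq, hc, hqp, fun h' => absurd h' h⟩

variable [FiniteDimensional ℝ E]

/-- Two close Lipschitz maps of pairs are homotopic through a Lipschitz homotopy: the prescribed
values at the two ends define a map which is Lipschitz on a large scale. -/
theorem exists_lipschitz_homotopy_of_close {A : Type*} [PseudoMetricSpace A] {S S₀ : Set A}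
    {T T₀ : Set (ConeSpace E)} {f φ : A → ConeSpace E} (hS₀ : S₀ ⊆ S) (hT : IsLipRetract T)
    (hT₀ : IsLipRetract T₀) (hTT : T₀ ⊆ T) (hf : LipOn f S) (hφ : LipOn φ S)
    (hfφ : CloseOn f φ S) (hfS : MapsPair f S S₀ T T₀) (hφS : MapsPair φ S S₀ T T₀) :
    ∃ H : A × ℝ → ConeSpace E, LipOn H (S ×ˢ Icc (0 : ℝ) 1) ∧
      MapsPair H (S ×ˢ Icc (0 : ℝ) 1) (S₀ ×ˢ Icc (0 : ℝ) 1) T T₀ ∧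
      ∀ y ∈ S, H (y, 0) = φ y ∧ H (y, 1) = f y := by
  classical
  let F : A × ℝ → ConeSpace E := fun z => if z.2 = 1 then f z.1 else φ z.1
  let P : Set (A × ℝ) := {z | z.1 ∈ S ∧ (z.2 = 0 ∨ z.2 = 1)}
  have hPS : P ⊆ S ×ˢ Icc (0 : ℝ) 1 := by
    rintro z ⟨hz, h | h⟩ <;> exact ⟨hz, by simp [h], by simp [h]⟩
  have hF : LargeLipOn F (S ×ˢ Icc (0 : ℝ) 1) := by
    have h1 : LargeLipOn (fun z : A × ℝ => φ z.1) (S ×ˢ Icc (0 : ℝ) 1) := by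
      obtain ⟨a, b, ha, hb, h⟩ := hφ.largeLipOn
      refine ⟨a, b, ha, hb, fun x hx y hy => (h _ hx.1 _ hy.1).trans ?_⟩
      have : dist x.1 y.1 ≤ dist x y := le_max_left _ _
      gcongr
    refine h1.of_close ?_
    obtain ⟨r, hr⟩ := hfφ
    refine ⟨max r 0, fun z hz => ?_⟩
    simp only [F]
    split_ifs
    · exact (hr _ hz.1).trans (le_max_left _ _)
    · rw [dist_self]
      exact le_max_right _ _
  have hFP : LipOn F P := by
    refine (hF.mono hPS).lipOn_of_local one_pos (C := ?_) ?_ ?_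
    · exact (lipOn_iff.1 hf).choose + (lipOn_iff.1 hφ).choose
    · exact add_nonneg (lipOn_iff.1 hf).choose_spec.1 (lipOn_iff.1 hφ).choose_spec.1
    · obtain ⟨hc1, h1⟩ := (lipOn_iff.1 hf).choose_spec
      obtain ⟨hc2, h2⟩ := (lipOn_iff.1 hφ).choose_spec
      set c₁ := (lipOn_iff.1 hf).choose
      set c₂ := (lipOn_iff.1 hφ).choose
      rintro x ⟨hx, hx2⟩ y ⟨hy, hy2⟩ hd
      have hd1 : dist x.1 y.1 ≤ dist x y := le_max_left _ _
      have hd2 : dist x.2 y.2 < 1 := (le_max_right (dist x.1 y.1) _).trans_lt hd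
      have e1 := mul_le_mul_of_nonneg_left hd1 hc1
      have e2 := mul_le_mul_of_nonneg_left hd1 hc2
      have e3 : 0 ≤ c₁ * dist x y := mul_nonneg hc1 dist_nonneg
      have e4 : 0 ≤ c₂ * dist x y := mul_nonneg hc2 dist_nonneg
      rw [add_mul]
      rcases hx2 with hx2 | hx2 <;> rcases hy2 with hy2 | hy2
      · simp only [F, hx2, hy2, zero_ne_one, if_false]
        linarith [h2 _ hx _ hy]
      · rw [hx2, hy2] at hd2
        norm_num at hd2
      · rw [hx2, hy2] at hd2
        norm_num at hd2
      · simp only [F, hx2, hy2, if_true]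
        linarith [h1 _ hx _ hy]
  have hFS : MapsPair F (S ×ˢ Icc (0 : ℝ) 1) (S₀ ×ˢ Icc (0 : ℝ) 1) T T₀ := by
    constructor
    all_goals
      intro z hz
      simp only [F]
      split_ifs
    · exact hfS.1 hz.1
    · exact hφS.1 hz.1
    · exact hfS.2 hz.1
    · exact hφS.2 hz.1
  obtain ⟨H, hH, hHP, -, hHS⟩ := hF.exists_lipOn_eqOn_pair hPS
    (prod_mono hS₀ subset_rfl) hFP hT hT₀ hTT hFS
    ⟨1, 1, one_pos, zero_le_one, fun x hx y hy _ => ⟨(y.1, x.2),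
      ⟨⟨hS₀ hy.1, hx.2⟩, hy.1, (hPS hx).2⟩, by
        rw [one_mul, Prod.dist_eq, Prod.dist_eq, dist_self]
        exact max_le (le_max_left _ _) (dist_nonneg.trans (le_max_left _ _))⟩⟩
  refine ⟨H, hH, hHS, fun y hy => ⟨?_, ?_⟩⟩
  · rw [hHP (y, 0) ⟨hy, Or.inl rfl⟩]
    exact if_neg zero_ne_one
  · rw [hHP (y, 1) ⟨hy, Or.inr rfl⟩]
    exact if_pos rfl

/-- A coarse homotopy of maps of pairs is close to a Lipschitz homotopy between given Lipschitz
maps, and it can be kept fixed where it is Lipschitz. -/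
theorem exists_lipschitz_homotopy_of_coarse {S C S₀ C₀ S₁ C₁ T T₀ : Set (ConeSpace E)}
    (hC : IsLipRetract C) (hSC : S ⊆ C) (hS₀C : S₀ ⊆ C₀) (hS₁C : S₁ ⊆ C₁) (hC₁C : C₁ ⊆ C)
    (hS₀S : S₀ ⊆ S) (hS₁S : S₁ ⊆ S) (hS : IsClosed S)
    (hreg : ∃ ε κ : ℝ, 0 < ε ∧ 0 ≤ κ ∧ ∀ z ∈ S₁, ∀ z' ∈ S₀, dist z z' < ε →
      ∃ y ∈ S₁ ∩ S₀, dist z y ≤ κ * dist z z')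
    (hT : IsLipRetract T) (hT₀ : IsLipRetract T₀) (hTT : T₀ ⊆ T) (hC₀C : C₀ ⊆ C)
    {φ ψ : ConeSpace E → ConeSpace E} {p : ConeSpace E → ℝ}
    {H : ConeSpace E × ℝ → ConeSpace E} (hp0 : ∀ y ∈ C, 0 ≤ p y) (hp : CoarseOn p C)
    (hH : CoarseOn H (cylinder p C)) (hHS : MapsPair H (cylinder p C) (cylinder p C₀) T T₀)
    (hends : ∀ y ∈ C, H (y, 0) = φ y ∧ H (y, p y + 1) = ψ y) (hp₁ : LipOn p C₁)
    (hH₁ : LipOn H (cylinder p C₁)) {f g : ConeSpace E → ConeSpace E}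
    (hfS : MapsPair f S S₀ T T₀) (hf : LipOn f S) (hfφ : CloseOn f φ S)
    (hf₁ : ∀ y ∈ S₁, f y = φ y)
    (hgS : MapsPair g S S₀ T T₀) (hg : LipOn g S) (hgψ : CloseOn g ψ S)
    (hg₁ : ∀ y ∈ S₁, g y = ψ y) :
    ∃ (q : ConeSpace E → ℝ) (G : ConeSpace E × ℝ → ConeSpace E),
      (∀ y ∈ S, 0 ≤ q y) ∧ CoarseOn q S ∧ LipOn q S ∧ (∀ y ∈ S₁, q y = p y) ∧
      (LipOn p C → ∀ y ∈ S, q y = p y) ∧ LipOn G (cylinder q S) ∧ ProperOn G (cylinder q S) ∧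
      MapsPair G (cylinder q S) (cylinder q S₀) T T₀ ∧
      (∀ y ∈ S, G (y, 0) = f y ∧ G (y, q y + 1) = g y) ∧ ∀ z ∈ cylinder q S₁, G z = H z := by
  classical
  obtain ⟨q, hq0, hq, hqp, hq₁, hqL⟩ := exists_lipschitz_control hC hC₁C hp0 hp hp₁
  obtain ⟨Kq, hKq0, hKq⟩ := lipOn_iff.1 hq
  obtain ⟨r, hr⟩ := hqp
  obtain ⟨a, b, ha, hb, hab⟩ := CoarseOn.largeLipOn_cylinder hC hp hp0 hH
  obtain ⟨a', b', ha', hb', hab'⟩ := hp.largeLipOn hC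
  have hcyl : ∀ {A : Set (ConeSpace E)}, A ⊆ S → cylinder q A ⊆ cylinder q S :=
    fun h z hz => ⟨h hz.1, hz.2⟩
  -- the given homotopy, reparametrized to the new cylinder
  let cut : ConeSpace E × ℝ → ConeSpace E × ℝ := fun z => (z.1, min z.2 (p z.1 + 1))
  have hcut : ∀ {A B : Set (ConeSpace E)}, A ⊆ B → B ⊆ C →
      MapsTo cut (cylinder q A) (cylinder p B) := fun hAB hB z hz =>
    ⟨hAB hz.1, le_min hz.2.1 (by linarith [hp0 _ (hB (hAB hz.1))]), min_le_right _ _⟩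
  have hcutS := hcut hSC subset_rfl
  let F : ConeSpace E × ℝ → ConeSpace E := fun z => H (cut z)
  have hF : LargeLipOn F (cylinder q S) := by
    refine ⟨a * (1 + a'), a * b' + b, by positivity, by positivity, fun x hx y hy => ?_⟩
    have hd1 : dist x.1 y.1 ≤ dist x y := le_max_left _ _
    have hd2 : dist x.2 y.2 ≤ dist x y := le_max_right _ _
    have h1 := hab' _ (hSC hx.1) _ (hSC hy.1)
    have h2 : a' * dist x.1 y.1 ≤ a' * dist x y := mul_le_mul_of_nonneg_left hd1 ha'
    have h3 : 0 ≤ a' * dist x y := mul_nonneg ha' dist_nonneg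
    have h4 : dist (cut x) (cut y) ≤ (1 + a') * dist x y + b' := by
      refine max_le (by linarith) ?_
      rw [Real.dist_eq]
      refine (abs_min_sub_min_le_max _ _ _ _).trans (max_le ?_ ?_)
      · rw [← Real.dist_eq]
        linarith
      · rw [add_sub_add_right_eq_sub, ← Real.dist_eq]
        have h5 : 0 ≤ dist x y := dist_nonneg
        linarith
    have h5 := mul_le_mul_of_nonneg_left h4 ha
    have h6 := hab _ (hcutS hx) _ (hcutS hy)
    calc dist (F x) (F y) ≤ a * dist (cut x) (cut y) + b := h6
      _ ≤ a * ((1 + a') * dist x y + b') + b := by linarith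
      _ = a * (1 + a') * dist x y + (a * b' + b) := by ring
  -- the prescribed values at the two ends
  let F' : ConeSpace E × ℝ → ConeSpace E := fun z =>
    if z.2 = 0 then f z.1 else if z.2 = q z.1 + 1 then g z.1 else F z
  have hF'0 : ∀ y, F' (y, 0) = f y := fun y => if_pos rfl
  have hF'1 : ∀ y ∈ S, F' (y, q y + 1) = g y := fun y hy => by
    have : q y + 1 ≠ 0 := by linarith [hq0 y (hSC hy)]
    simp only [F', if_neg this, if_true]
  have hF'₁ : ∀ z ∈ cylinder q S₁, F' z = H z := by
    rintro ⟨y, t⟩ ⟨hy, ht0, ht1⟩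
    have hyq : q y = p y := hq₁ y (hS₁C hy)
    have hyC : y ∈ C := hC₁C (hS₁C hy)
    simp only at hy ht0 ht1
    simp only [F']
    split_ifs with h1 h2
    · rw [h1, hf₁ y hy, (hends y hyC).1]
    · rw [h2, hg₁ y hy, hyq, (hends y hyC).2]
    · simp only [F, cut]
      rw [min_eq_left (by rwa [← hyq])]
  have hclose : CloseOn F' F (cylinder q S) := by
    obtain ⟨r₁, hr₁⟩ := hfφ
    obtain ⟨r₂, hr₂⟩ := hgψ
    refine ⟨max r₁ (max (r₂ + (a * r + b)) 0), ?_⟩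
    rintro ⟨y, t⟩ ⟨hy, ht0, ht1⟩
    simp only at hy ht0 ht1
    have hyC := hSC hy
    have hpy := hp0 y hyC
    have hqy := hq0 y hyC
    simp only [F']
    split_ifs with h1 h2
    · refine le_trans ?_ (le_max_left _ _)
      have : F (y, t) = φ y := by
        simp only [F, cut, h1]
        rw [min_eq_left (by linarith), (hends y hyC).1]
      rw [this]
      exact hr₁ y hy
    · refine le_trans ?_ ((le_max_left _ _).trans (le_max_right _ _))
      have h3 : dist (F (y, t)) (H (y, p y + 1)) ≤ a * r + b := by
        refine (hab _ (hcutS ⟨hy, ht0, ht1⟩) _ ⟨hyC, by simp only; linarith, le_rfl⟩).trans ?_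
        have h4 := hr y hyC
        have h5 : dist (cut (y, t)) (y, p y + 1) ≤ r := by
          simp only [cut, h2]
          rw [Prod.dist_eq, dist_self]
          refine max_le (dist_nonneg.trans h4) ?_
          rw [Real.dist_eq] at h4 ⊢
          have h6 := abs_le.1 h4
          have h7 : 0 ≤ r := (abs_nonneg _).trans h4
          rcases le_total (q y + 1) (p y + 1) with h | h
          · simp only [min_eq_left h]
            rw [abs_le]
            constructor <;> linarith
          · simp only [min_eq_right h]
            simpa using h7
        have := mul_le_mul_of_nonneg_left h5 ha
        linarith
      rw [(hends y hyC).2] at h3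
      have h4 := hr₂ y hy
      have h5 := dist_triangle_right (g y) (F (y, t)) (ψ y)
      linarith
    · rw [dist_self]
      exact (le_max_right _ _).trans (le_max_right _ _)
  have hF'S : MapsPair F' (cylinder q S) (cylinder q S₀) T T₀ := by
    constructor
    all_goals
      intro z hz
      simp only [F']
      split_ifs
    · exact hfS.1 hz.1
    · exact hgS.1 hz.1
    · exact hHS.1 (hcutS hz)
    · exact hfS.2 hz.1
    · exact hgS.2 hz.1
    · exact hHS.2 (hcut hS₀C hC₀C hz)
  have hF' : LargeLipOn F' (cylinder q S) := hF.of_close hclose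
  -- moving a point of the bottom or of the top to another fiber
  let B : Set (ConeSpace E × ℝ) := {z | z.1 ∈ S ∧ z.2 = 0}
  let U : Set (ConeSpace E × ℝ) := {z | z.1 ∈ S ∧ z.2 = q z.1 + 1}
  have hBS : B ⊆ cylinder q S := fun z hz =>
    ⟨hz.1, hz.2.ge, by rw [hz.2]; linarith [hq0 _ (hSC hz.1)]⟩
  have hUS : U ⊆ cylinder q S := fun z hz =>
    ⟨hz.1, by rw [hz.2]; linarith [hq0 _ (hSC hz.1)], hz.2.le⟩
  have hmove : ∀ x ∈ B ∪ U, ∀ y ∈ S, ∃ t, (y, t) ∈ B ∪ U ∧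
      dist x (y, t) ≤ (1 + Kq) * dist x.1 y := by
    rintro x (hx | hx) y hy
    · refine ⟨0, Or.inl ⟨hy, rfl⟩, max_le ?_ ?_⟩
      · exact le_mul_of_one_le_left dist_nonneg (by linarith)
      · rw [hx.2, dist_self]
        positivity
    · refine ⟨q y + 1, Or.inr ⟨hy, rfl⟩, max_le ?_ ?_⟩
      · exact le_mul_of_one_le_left dist_nonneg (by linarith)
      · rw [hx.2, dist_add_right]
        have := hKq _ (hSC hx.1) _ (hSC hy)
        have h : 0 ≤ dist x.1 y := dist_nonneg
        linarith
  have hLB : LipOn F' B := by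
    obtain ⟨K, hK0, hK⟩ := lipOn_iff.1 hf
    refine lipOn_iff.2 ⟨K, hK0, fun x hx y hy => ?_⟩
    have e : ∀ z ∈ B, F' z = f z.1 := fun z hz => if_pos hz.2
    rw [e x hx, e y hy]
    exact (hK _ hx.1 _ hy.1).trans (mul_le_mul_of_nonneg_left (le_max_left _ _) hK0)
  have hLU : LipOn F' U := by
    obtain ⟨K, hK0, hK⟩ := lipOn_iff.1 hg
    refine lipOn_iff.2 ⟨K, hK0, fun x hx y hy => ?_⟩
    have e : ∀ z ∈ U, F' z = g z.1 := fun z hz => by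
      rw [← hF'1 z.1 hz.1, ← hz.2]
    rw [e x hx, e y hy]
    exact (hK _ hx.1 _ hy.1).trans (mul_le_mul_of_nonneg_left (le_max_left _ _) hK0)
  have hL₁ : LipOn F' (cylinder q S₁) := by
    refine (hH₁.mono fun z hz => ?_).congr hF'₁
    exact ⟨hS₁C hz.1, hz.2.1, by rw [← hq₁ _ (hS₁C hz.1)]; exact hz.2.2⟩
  have hLBU : LipOn F' (B ∪ U) := by
    refine (hF'.mono (union_subset hBS hUS)).lipOn_union hLB hLU
      ⟨1, 0, one_pos, le_rfl, fun x hx y hy hd => ?_⟩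
    -- the bottom and the top have distance at least one
    have h1 : dist x.2 y.2 < 1 := (le_max_right (dist x.1 y.1) _).trans_lt hd
    rw [hx.2, hy.2, Real.dist_eq, zero_sub, abs_neg] at h1
    linarith [le_abs_self (q y.1 + 1), hq0 _ (hSC hy.1)]
  have hPS : (B ∪ U) ∪ cylinder q S₁ ⊆ cylinder q S :=
    union_subset (union_subset hBS hUS) (hcyl hS₁S)
  have hmem : ∀ {A : Set (ConeSpace E)} {z : ConeSpace E × ℝ}, z ∈ B ∪ U → z.1 ∈ A →
      z ∈ cylinder q A := fun hz hA => ⟨hA, (union_subset hBS hUS hz).2⟩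
  have hLP : LipOn F' ((B ∪ U) ∪ cylinder q S₁) := by
    refine (hF'.mono hPS).lipOn_union hLBU hL₁
      ⟨1, 1 + Kq, one_pos, by positivity, fun x hx y hy _ => ?_⟩
    obtain ⟨t, ht, hd⟩ := hmove x hx y.1 (hS₁S hy.1)
    exact ⟨(y.1, t), ⟨ht, hmem ht hy.1⟩,
      hd.trans (mul_le_mul_of_nonneg_left (le_max_left _ _) (by positivity))⟩
  obtain ⟨ε, κ, hε, hκ, hεκ⟩ := hreg
  obtain ⟨G, hG, hGP, hGc, hGS⟩ := hF'.exists_lipOn_eqOn_pair hPS (hcyl hS₀S) hLP hT hT₀ hTT hF'S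
    ⟨ε, (1 + Kq) * (1 + κ), hε, by positivity, fun x hx y hy hd => by
      have hd1 : dist x.1 y.1 ≤ dist x y := le_max_left _ _
      have hd0 : 0 ≤ dist x y := dist_nonneg
      rcases hx with hx | hx
      · obtain ⟨t, ht, hdt⟩ := hmove x hx y.1 (hS₀S hy.1)
        refine ⟨(y.1, t), ⟨Or.inl ht, hmem ht hy.1⟩, hdt.trans ?_⟩
        rw [mul_assoc]
        refine mul_le_mul_of_nonneg_left (hd1.trans ?_) (by positivity)
        exact le_mul_of_one_le_left hd0 (by linarith)
      · obtain ⟨z, ⟨hz₁, hz₀⟩, hz⟩ := hεκ _ hx.1 _ hy.1 (hd1.trans_lt hd)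
        have hqz := hq0 z (hSC (hS₁S hz₁))
        have hle : 0 ≤ min x.2 (q z + 1) := le_min hx.2.1 (by linarith)
        refine ⟨(z, min x.2 (q z + 1)), ⟨Or.inr ⟨hz₁, hle, min_le_right _ _⟩,
          hz₀, hle, min_le_right _ _⟩, ?_⟩
        have h1 : dist x.1 z ≤ κ * dist x y := hz.trans (mul_le_mul_of_nonneg_left hd1 hκ)
        have h2 := hKq _ (hSC (hS₁S hx.1)) _ (hSC (hS₁S hz₁))
        have h3 : dist x (z, min x.2 (q z + 1)) ≤ (1 + Kq) * dist x.1 z := by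
          have h4 : 0 ≤ dist x.1 z := dist_nonneg
          refine max_le (by linarith [mul_nonneg hKq0 h4]) ?_
          rw [Real.dist_eq] at h2 ⊢
          have h5 := (abs_le.1 h2).2
          have h6 := hx.2.2
          rcases le_total x.2 (q z + 1) with h | h
          · simp only [min_eq_left h, sub_self, abs_zero]
            positivity
          · simp only [min_eq_right h]
            rw [abs_of_nonneg (by linarith)]
            linarith
        refine h3.trans ?_
        rw [mul_assoc]
        refine mul_le_mul_of_nonneg_left (h1.trans ?_) (by positivity)
        exact mul_le_mul_of_nonneg_right (by linarith) hd0⟩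
  have hbdd : ∀ B' : Set (ConeSpace E), Bornology.IsBounded B' →
      Bornology.IsBounded (cylinder q S ∩ F ⁻¹' B') := by
    intro B' hB'
    obtain ⟨ρ, hρ⟩ := (hH.2 B' hB').subset_closedBall 0
    refine (Metric.isBounded_closedBall (x := (0 : ConeSpace E × ℝ)) (r := ρ + r)).subset ?_
    rintro ⟨y, t⟩ ⟨⟨hy, ht0, ht1⟩, hz⟩
    have h1 := hρ ⟨hcutS ⟨hy, ht0, ht1⟩, hz⟩
    simp only at hy ht0 ht1
    rw [mem_closedBall_zero_iff, Prod.norm_def, max_le_iff] at h1 ⊢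
    obtain ⟨h2, h3⟩ := h1
    have h4 := hr y (hSC hy)
    have h5 : 0 ≤ r := dist_nonneg.trans h4
    rw [Real.dist_eq] at h4
    have h6 := (abs_le.1 h4).2
    simp only [cut, Real.norm_eq_abs] at h2 h3 ⊢
    refine ⟨by linarith, ?_⟩
    rw [abs_of_nonneg ht0]
    have h7 := (le_abs_self _).trans h3
    rcases le_total t (p y + 1) with h | h
    · rw [min_eq_left h] at h7
      linarith
    · rw [min_eq_right h] at h7
      linarith
  have hqS : LipOn q S := hq.mono hSC
  refine ⟨q, G, fun y hy => hq0 y (hSC hy), ?_, hqS, fun y hy => hq₁ y (hS₁C hy),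
    fun h y hy => hqL h y (hSC hy), hG, ?_, hGS, fun y hy => ⟨?_, ?_⟩, fun z hz => ?_⟩
  · exact CoarseOn.of_lipOn_close hqS (hp.mono hSC) (CloseOn.mono ⟨r, hr⟩ hSC)
  · exact hG.properOn (isClosed_cylinder hS hqS) fun B' hB' =>
      (hGc.trans hclose).isBounded_preimage hbdd hB'
  · rw [hGP (y, 0) (Or.inl (Or.inl ⟨hy, rfl⟩)), hF'0]
  · rw [hGP (y, q y + 1) (Or.inl (Or.inr ⟨hy, rfl⟩)), hF'1 y hy]
  · rw [hGP z (Or.inr hz), hF'₁ z hz]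

end Relative

end ConeApprox

open ConeApprox in
theorem mainTheorem5 (N : ℕ)
    (X X₀ Y Y₀ : Geometry.SimplicialComplex ℝ (EuclideanSpace ℝ (Fin N)))
    (hX : X.faces.Finite) (hY : Y.faces.Finite)
    (hX₀ : X₀.faces ⊆ X.faces) (hY₀ : Y₀.faces ⊆ Y.faces)
    (leX leY : EuclideanSpace ℝ (Fin N) → EuclideanSpace ℝ (Fin N) → Prop)
    (hleX : IsLocalOrder X.faces leX) (hleY : IsLocalOrder Y.faces leY) :
    -- approximation of a coarse map of pairs
    (∀ φ : ConeSpace (EuclideanSpace ℝ (Fin N)) → ConeSpace (EuclideanSpace ℝ (Fin N)),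
      CoarseOn φ (cone Y.space) →
      MapsPair φ (cone Y.space) (cone Y₀.space) (cone X.space) (cone X₀.space) →
      ∃ L : ℕ, 0 < L ∧
      ∃ f : ConeSpace (EuclideanSpace ℝ (Fin N)) → ConeSpace (EuclideanSpace ℝ (Fin N)),
        MapsPair f (coneAbove L Y.space) (coneAbove L Y₀.space) (cone X.space) (cone X₀.space) ∧
        LipOn f (coneAbove L Y.space) ∧
        ProperOn f (coneAbove L Y.space) ∧
        CloseOn f φ (coneAbove L Y.space) ∧
        (∃ C : ℝ, 0 < C ∧
          IsSimplicial f (coneFacesAbove L Y.faces leY) (scaleFaces C (coneFaces X.faces leX))) ∧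
        -- the relative statement
        ∀ Y₁ : Geometry.SimplicialComplex ℝ (EuclideanSpace ℝ (Fin N)), Y₁.faces ⊆ Y.faces →
          LipOn φ (cone Y₁.space) →
          (∃ H : ConeSpace (EuclideanSpace ℝ (Fin N)) × ℝ → ConeSpace (EuclideanSpace ℝ (Fin N)),
            LipOn H (coneAbove L Y₁.space ×ˢ Set.Icc (0 : ℝ) 1) ∧
            MapsPair H (coneAbove L Y₁.space ×ˢ Set.Icc (0 : ℝ) 1)
              (coneAbove L (Y₁ ⊓ Y₀).space ×ˢ Set.Icc (0 : ℝ) 1) (cone X.space) (cone X₀.space) ∧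
            ∀ y ∈ coneAbove L Y₁.space, H (y, 0) = φ y ∧ H (y, 1) = f y) ∧
          ∃ f' : ConeSpace (EuclideanSpace ℝ (Fin N)) → ConeSpace (EuclideanSpace ℝ (Fin N)),
            MapsPair f' (coneAbove L Y.space) (coneAbove L Y₀.space)
              (cone X.space) (cone X₀.space) ∧
            LipOn f' (coneAbove L Y.space) ∧
            ProperOn f' (coneAbove L Y.space) ∧
            CloseOn f' f (coneAbove L Y.space) ∧
            ∀ y ∈ coneAbove L Y₁.space, f' y = φ y) ∧
    -- approximation of a coarse homotopy of pairs
    (∀ Y₁ : Geometry.SimplicialComplex ℝ (EuclideanSpace ℝ (Fin N)), Y₁.faces ⊆ Y.faces →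
      ∀ φ ψ : ConeSpace (EuclideanSpace ℝ (Fin N)) → ConeSpace (EuclideanSpace ℝ (Fin N)),
      CoarseOn φ (cone Y.space) →
      MapsPair φ (cone Y.space) (cone Y₀.space) (cone X.space) (cone X₀.space) →
      CoarseOn ψ (cone Y.space) →
      MapsPair ψ (cone Y.space) (cone Y₀.space) (cone X.space) (cone X₀.space) →
      ∀ (p : ConeSpace (EuclideanSpace ℝ (Fin N)) → ℝ)
        (H : ConeSpace (EuclideanSpace ℝ (Fin N)) × ℝ → ConeSpace (EuclideanSpace ℝ (Fin N))),
      (∀ y ∈ cone Y.space, 0 ≤ p y) → CoarseOn p (cone Y.space) →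
      CoarseOn H (cylinder p (cone Y.space)) →
      MapsPair H (cylinder p (cone Y.space)) (cylinder p (cone Y₀.space))
        (cone X.space) (cone X₀.space) →
      (∀ y ∈ cone Y.space, H (y, 0) = φ y ∧ H (y, p y + 1) = ψ y) →
      LipOn p (cone Y₁.space) →
      LipOn H (cylinder p (cone Y₁.space)) →
      ProperOn H (cylinder p (cone Y₁.space)) →
      ∀ L : ℝ, 0 < L →
      ∀ f g : ConeSpace (EuclideanSpace ℝ (Fin N)) → ConeSpace (EuclideanSpace ℝ (Fin N)),
      MapsPair f (coneAbove L Y.space) (coneAbove L Y₀.space) (cone X.space) (cone X₀.space) →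
      LipOn f (coneAbove L Y.space) → ProperOn f (coneAbove L Y.space) →
      CloseOn f φ (coneAbove L Y.space) → (∀ y ∈ coneAbove L Y₁.space, f y = φ y) →
      MapsPair g (coneAbove L Y.space) (coneAbove L Y₀.space) (cone X.space) (cone X₀.space) →
      LipOn g (coneAbove L Y.space) → ProperOn g (coneAbove L Y.space) →
      CloseOn g ψ (coneAbove L Y.space) → (∀ y ∈ coneAbove L Y₁.space, g y = ψ y) →
      ∃ (q : ConeSpace (EuclideanSpace ℝ (Fin N)) → ℝ)
        (G : ConeSpace (EuclideanSpace ℝ (Fin N)) × ℝ → ConeSpace (EuclideanSpace ℝ (Fin N))),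
        (∀ y ∈ coneAbove L Y.space, 0 ≤ q y) ∧
        CoarseOn q (coneAbove L Y.space) ∧
        LipOn q (coneAbove L Y.space) ∧
        (∀ y ∈ coneAbove L Y₁.space, q y = p y) ∧
        (LipOn p (cone Y.space) → ∀ y ∈ coneAbove L Y.space, q y = p y) ∧
        LipOn G (cylinder q (coneAbove L Y.space)) ∧
        ProperOn G (cylinder q (coneAbove L Y.space)) ∧
        MapsPair G (cylinder q (coneAbove L Y.space)) (cylinder q (coneAbove L Y₀.space))
          (cone X.space) (cone X₀.space) ∧
        (∀ y ∈ coneAbove L Y.space, G (y, 0) = f y ∧ G (y, q y + 1) = g y) ∧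
        ∀ z ∈ cylinder q (coneAbove L Y₁.space), G z = H z) := by
  have hX₀fin : X₀.faces.Finite := hX.subset hX₀
  have hTX := isLipRetract_cone hX
  have hTX₀ := isLipRetract_cone hX₀fin
  have hXX : cone X₀.space ⊆ cone X.space := cone_mono (space_mono hX₀)
  have hYY : cone Y₀.space ⊆ cone Y.space := cone_mono (space_mono hY₀)
  refine ⟨fun φ hφ hφp => ?_, ?_⟩
  · obtain ⟨L, hL, f, hfp, hf, hfφ, hsimp⟩ :=
      exists_simplicial_approximation hX hY hX₀ hY₀ hleX hleY hφ hφp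
    have hbdd : ∀ B' : Set (ConeSpace (EuclideanSpace ℝ (Fin N))), Bornology.IsBounded B' →
        Bornology.IsBounded (coneAbove L Y.space ∩ φ ⁻¹' B') := (hφ.mono coneAbove_subset).2
    refine ⟨L, hL, f, hfp, hf, hf.properOn (isClosed_coneAbove hY L) fun B' hB' =>
      hfφ.isBounded_preimage hbdd hB', hfφ, hsimp, fun Y₁ hY₁ hφ₁ => ⟨?_, ?_⟩⟩
    · have h₁ : coneAbove (L : ℝ) Y₁.space ⊆ coneAbove L Y.space :=
        coneAbove_mono (space_mono hY₁)
      have h₀ : coneAbove (L : ℝ) (Y₁ ⊓ Y₀).space ⊆ coneAbove L Y₀.space :=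
        coneAbove_mono (space_mono fun _ h => h.2)
      refine exists_lipschitz_homotopy_of_close (coneAbove_mono (space_mono fun _ h => h.1))
        hTX hTX₀ hXX (hf.mono h₁) (hφ₁.mono coneAbove_subset) (hfφ.mono h₁)
        ⟨hfp.1.mono_left h₁, hfp.2.mono_left h₀⟩
        ⟨hφp.1.mono_left (h₁.trans coneAbove_subset), hφp.2.mono_left (h₀.trans coneAbove_subset)⟩
    · obtain ⟨f', hf', hf'φ, hclose, hf'p⟩ :=
        (hφ.largeLipOn (isLipRetract_cone hY)).exists_lipOn_eqOn_pair
          (cone_mono (space_mono hY₁)) hYY hφ₁ hTX hTX₀ hXX hφp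
          (cone_subcomplex_regular hY hY₁ hY₀)
      have hf'L := hf'.mono (coneAbove_subset (R := L))
      have hcloseL := hclose.mono (coneAbove_subset (R := L))
      exact ⟨f', ⟨hf'p.1.mono_left coneAbove_subset, hf'p.2.mono_left coneAbove_subset⟩, hf'L,
        hf'L.properOn (isClosed_coneAbove hY L) fun B' hB' => hcloseL.isBounded_preimage hbdd hB',
        hcloseL.trans hfφ.symm, fun y hy => hf'φ y hy.1⟩
  · intro Y₁ hY₁ φ ψ _ _ _ _ p H hp0 hp hH hHp hends hp₁ hH₁ _ L hL f g hfp hf _ hfφ hf₁ hgp hg _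
      hgψ hg₁
    exact exists_lipschitz_homotopy_of_coarse (isLipRetract_cone hY) coneAbove_subset
      coneAbove_subset coneAbove_subset (cone_mono (space_mono hY₁))
      (coneAbove_mono (space_mono hY₀)) (coneAbove_mono (space_mono hY₁))
      (isClosed_coneAbove hY L) (coneAbove_subcomplex_regular hY hY₁ hY₀ hL) hTX hTX₀ hXX hYY
      hp0 hp hH hHp hends hp₁ hH₁ hfp hf hfφ hf₁ hgp hg hgψ hg₁
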